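/- Let $(\epsilon_k)_{k\in\mathbb Z}$ be i.i.d. random elements of a measurable space and let $(\epsilon_k')_{k\in\mathbb Z}$ be an independent copy of this sequence on the same probability space. For $m\ge 1$ and a measurable real function $f_m$ of $m$ variables put, for $k\in\mathbb Z$, $$X_{km}=f_m(\epsilon_k,\epsilon_{k-1},\ldots,\epsilon_{k-m+1}),$$ and, for $k\ge1$, let $X_{km}^*$ be obtained from $X_{km}$ by replacing every $\epsilon_j$ with $j\le 0$ by $\epsilon_j'$. Put $S_{nm}=\sum_{k=1}^n X_{km}$, $s_{nm}^2=n^{-1}\mathbb E S_{nm}^2$ (with $s_{nm}\ge 0$), $s_m^2=\sum_{k\in\mathbb Z}\mathbb E X_{0m}X_{km}$, $\|X\|_p=(\mathbb E|X|^p)^{1/p}$, and let $\Phi$ be the standard normal distribution function. Let $p>2$, $\mathfrak a>0$, $s_->0$, $0\le M,D<\infty$, $0<\mathfrak m<1$ and $0<c\le K<\infty$. Then there is a constant $C>0$, depending only on $p,\mathfrak a,s_-,M,D,\mathfrak m,c,K$, such that the following holds. Let $n\ge1$ and $m$ be integers with $c\,n^{\mathfrak m}\le m\le K n^{\mathfrak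 m}$ (for instance $m=\lfloor n^{\mathfrak m}\rfloor$, with $c=1/2$, $K=1$), and assume that 1. $\|X_{km}\|_p\le M$ and $\mathbb E X_{km}=0$ for all $k\in\mathbb Z$, 2. $\sum_{k=1}^\infty k^{\mathfrak a}\,\|X_{km}-X_{km}^*\|_p\le D$, 3. $s_m^2\ge s_-^2$. Then $$\sup_{x\in\mathbb R}\Bigl|\mathbb P\bigl(S_{nm}/\sqrt n\le x\bigr)-\Phi\bigl(x/s_{nm}\bigr)\Bigr|\le C\,n^{-(p\wedge 3)/2+1}$$ (where, in the degenerate case $s_{nm}=0$, $\Phi(x/s_{nm})$ is read as $\Phi(0)$). -/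

import Mathlib

open MeasureTheory ProbabilityTheory
open scoped ENNReal NNReal

universe u v

noncomputable section

namespace MDependent

variable {Ω : Type u} {E : Type v}

/-- `(ε_k)` is an i.i.d. sequence indexed by `ℤ` and `(ε'_k)` is an independent copy of it on the
same probability space: all the variables `ε_k`, `ε'_k` are mutually independent and have the
same law. -/
structure IsIIDWithCopy [MeasurableSpace Ω] [MeasurableSpace E]
    (μ : Measure Ω) (ε ε' : ℤ → Ω → E) : Prop where
  measurable : ∀ k, Measurable (ε k)
  measurable_copy : ∀ k, Measurable (ε' k)
  indep : iIndepFun (Sum.elim ε ε') μ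
  identDistrib : ∀ k, IdentDistrib (ε k) (ε 0) μ μ
  identDistrib_copy : ∀ k, IdentDistrib (ε' k) (ε 0) μ μ

/-- `X_{km} = f(ε_k, ε_{k-1}, …, ε_{k-m+1})`. -/
def proc {m : ℕ} (f : (Fin m → E) → ℝ) (ε : ℤ → Ω → E) (k : ℤ) (ω : Ω) : ℝ :=
  f fun i => ε (k - (i : ℕ)) ω

/-- The innovations in which every `ε_j` with `j ≤ 0` is replaced by `ε'_j`. -/
def starNoise (ε ε' : ℤ → Ω → E) (j : ℤ) : Ω → E :=
  if j ≤ 0 then ε' j else ε j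

/-- `X*_{km}`, obtained from `X_{km}` by replacing every `ε_j`, `j ≤ 0`, by `ε'_j`. -/
def procStar {m : ℕ} (f : (Fin m → E) → ℝ) (ε ε' : ℤ → Ω → E) (k : ℤ) (ω : Ω) : ℝ :=
  proc f (starNoise ε ε') k ω

/-- `s_m² = ∑_{k ∈ ℤ} E[X_{0m} X_{km}]`. Under the assumptions below the terms with `|k| ≥ m`
vanish, so that this is a finite sum. -/
def longRunVariance [MeasurableSpace Ω] (μ : Measure Ω) {m : ℕ}
    (f : (Fin m → E) → ℝ) (ε : ℤ → Ω → E) : ℝ :=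
  ∑' k : ℤ, ∫ ω, proc f ε 0 ω * proc f ε k ω ∂μ

/-- The moment, dependence and non-degeneracy conditions, with explicit bounds `M`, `D`, `s`
(which do not depend on `m`: this is the uniformity in `m`). -/
structure DependenceAssumption [MeasurableSpace Ω] (μ : Measure Ω) (ε ε' : ℤ → Ω → E)
    (p a s : ℝ) (M D : ℝ≥0) {m : ℕ} (f : (Fin m → E) → ℝ) : Prop where
  moment : ∀ k : ℤ, eLpNorm (proc f ε k) (ENNReal.ofReal p) μ ≤ M
  mean_zero : ∀ k : ℤ, ∫ ω, proc f ε k ω ∂μ = 0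
  dependence :
    ∑' k : ℕ, ENNReal.ofReal (((k : ℝ) + 1) ^ a) *
      eLpNorm (fun ω => proc f ε ((k : ℤ) + 1) ω - procStar f ε ε' ((k : ℤ) + 1) ω)
        (ENNReal.ofReal p) μ ≤ D
  nondegenerate : s ^ 2 ≤ longRunVariance μ f ε

/-- `S_{nm} = ∑_{k=1}^n X_{km}`. -/
def partialSum {m : ℕ} (f : (Fin m → E) → ℝ) (ε : ℤ → Ω → E) (n : ℕ) (ω : Ω) : ℝ :=
  ∑ k ∈ Finset.Icc 1 n, proc f ε (k : ℤ) ω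

/-- `s_{nm} = (n⁻¹ ‖S_{nm}‖₂²)^{1/2}`. -/
def sampleStd [MeasurableSpace Ω] (μ : Measure Ω) {m : ℕ}
    (f : (Fin m → E) → ℝ) (ε : ℤ → Ω → E) (n : ℕ) : ℝ :=
  Real.sqrt ((∫ ω, (partialSum f ε n ω) ^ 2 ∂μ) / n)

/-- The standard normal distribution function. -/
def stdNormalCDF (x : ℝ) : ℝ := cdf (gaussianReal 0 1) x

end MDependent

end

/-! By Esseen's smoothing inequality it suffices to compare the characteristic function of S_n/√n
with that of the centred normal law of the same variance, for 0 < t ≤ κ√n, with an error O(n^{1-p/2}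
t/(1+t²)). The rate only sees p ∧ 3, so p may be lowered to `min p 3` and the weight exponent to α =
`min a (1/2)`. Write ψ_L(θ) and v_L for the characteristic function and the variance of a sum of L
consecutive terms; the frequency of interest is θ = t/√n. All constants must be uniform in m.

Dependence. Integrating out of X_k all innovations but the last l changes it in L^p by at most δ_l =
‖X_l - X_l^*‖_p (Jensen), and Σ l^α δ_l ≤ D. So a block starting after time a equals T + R, where T
ignores the innovations up to a and ‖R‖_p ≤ D whatever the length: dependence between adjacent
blocks is a boundary effect. Up to O(l^{-α}), R is a function R' of the innovations within distance
l of a, while the sums on both sides are within O(√l) of sums independent of R'. Expanding exp(iθR)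
(`Localization`) yields ψ_{a+b} = ψ_a ψ_b - θ²(v_{a+b} - v_a - v_b)/2 + error, together with coarser
first-order versions. The moment bound ‖S_L‖_p = O(√L) that this needs comes from repeated halving,
and v_L ≥ c₀L for large L follows from the lower bound on the long run variance. `CharData` collects
these facts.

Low frequencies, |θ|√L ≤ 1. The quadratic correction is the change of the Gaussian exponent, so
halving recursively gives |ψ_L - exp(-v_L θ²/2)| = O(L|θ|^p) (`norm_sub_gauss_le`). In particular
ψ_L has Gaussian decay there, and further halving keeps |ψ_L| ≤ 1 - η when Lθ² ≥ 1/16 and |θ| is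
small.

Full sum. Cut n into q ≈ n^δ blocks with δ small. For t ≤ √q/2 the low frequency estimate applies in
each block, ψ_n is close to a product, and the decay of the other factors makes the error summable
in t. For t ≥ √q/2 each block factor is at most 1 - η; since the block length exceeds m (this is
where m ≤ K n^𝔪 with 𝔪 < 1 enters), exact m-dependence gives |ψ_n| ≤ (|ψ_L| + C|θ|)^{n/(3L)}
(`norm_chf_le_pow`), which is below 1/n. -/

namespace WeakDep

/-! ### Elementary inequalities for exp(ix) -/

/-- The character `x ↦ exp (i x)`. -/
noncomputable def eI (x : ℝ) : ℂ := Complex.exp (x * Complex.I)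

lemma norm_eI (x : ℝ) : ‖eI x‖ = 1 := Complex.norm_exp_ofReal_mul_I x

lemma eI_add (x y : ℝ) : eI (x + y) = eI x * eI y := by
  simp [eI, add_mul, Complex.exp_add]

@[fun_prop]
lemma continuous_eI : Continuous eI := by unfold eI; fun_prop

@[fun_prop]
lemma measurable_eI : Measurable eI := continuous_eI.measurable

lemma norm_eI_sub_one_le (x : ℝ) : ‖eI x - 1‖ ≤ |x| := by
  have := Real.norm_exp_I_mul_ofReal_sub_one_le (x := x)
  rwa [mul_comm] at this

lemma norm_eI_sub_one_le_two (x : ℝ) : ‖eI x - 1‖ ≤ 2 := by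
  calc ‖eI x - 1‖ ≤ ‖eI x‖ + ‖(1 : ℂ)‖ := norm_sub_le _ _
    _ = 2 := by rw [norm_eI, norm_one]; norm_num

lemma norm_eI_sub_eI_le (x y : ℝ) : ‖eI x - eI y‖ ≤ |x - y| := by
  have : eI x - eI y = eI y * (eI (x - y) - 1) := by
    rw [mul_sub, ← eI_add, mul_one, add_sub_cancel]
  rw [this, norm_mul, norm_eI, one_mul]
  exact norm_eI_sub_one_le _

lemma norm_eI_sub_one_le_rpow (x : ℝ) {r : ℝ} (h0 : 0 ≤ r) (h1 : r ≤ 1) :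
    ‖eI x - 1‖ ≤ 2 * |x| ^ r := by
  rcases le_total |x| 1 with hx | hx
  · have : |x| ^ (1 : ℝ) ≤ |x| ^ r := Real.rpow_le_rpow_of_exponent_ge_of_imp (abs_nonneg x) hx h1
      (by intro _ h; linarith)
    rw [Real.rpow_one] at this
    linarith [norm_eI_sub_one_le x, abs_nonneg x]
  · have : 1 ≤ |x| ^ r := Real.one_le_rpow hx h0
    linarith [norm_eI_sub_one_le_two x]

lemma norm_eI_sub_linear_le_sq (x : ℝ) : ‖eI x - 1 - x * Complex.I‖ ≤ 2 * x ^ 2 := by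
  have hn : ‖(x : ℂ) * Complex.I‖ = |x| := by simp
  rcases le_total |x| 1 with hx | hx
  · have := Complex.norm_exp_sub_one_sub_id_le (x := x * Complex.I) (by rw [hn]; exact hx)
    rw [hn, sq_abs] at this
    unfold eI
    nlinarith [sq_nonneg x]
  · calc ‖eI x - 1 - x * Complex.I‖ ≤ ‖eI x - 1‖ + ‖(x : ℂ) * Complex.I‖ := norm_sub_le _ _
      _ ≤ |x| + |x| := by rw [hn]; gcongr; exact norm_eI_sub_one_le x
      _ ≤ 2 * x ^ 2 := by rw [← sq_abs]; nlinarith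

lemma norm_eI_sub_linear_le_abs (x : ℝ) : ‖eI x - 1 - x * Complex.I‖ ≤ 2 * |x| := by
  have hn : ‖(x : ℂ) * Complex.I‖ = |x| := by simp
  calc ‖eI x - 1 - x * Complex.I‖ ≤ ‖eI x - 1‖ + ‖(x : ℂ) * Complex.I‖ := norm_sub_le _ _
    _ ≤ |x| + |x| := by rw [hn]; gcongr; exact norm_eI_sub_one_le x
    _ = 2 * |x| := by ring

lemma norm_eI_sub_linear_le_rpow (x : ℝ) {r : ℝ} (h0 : 1 ≤ r) (h1 : r ≤ 2) :
    ‖eI x - 1 - x * Complex.I‖ ≤ 2 * |x| ^ r := by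
  rcases le_total |x| 1 with hx | hx
  · have : |x| ^ (2 : ℝ) ≤ |x| ^ r := Real.rpow_le_rpow_of_exponent_ge_of_imp (abs_nonneg x) hx h1
      (by intro _ h; linarith)
    rw [Real.rpow_two, sq_abs] at this
    linarith [norm_eI_sub_linear_le_sq x]
  · have : |x| ^ (1 : ℝ) ≤ |x| ^ r := Real.rpow_le_rpow_of_exponent_le hx h0
    rw [Real.rpow_one] at this
    linarith [norm_eI_sub_linear_le_abs x]

lemma norm_eI_sub_quadratic_le_rpow (x : ℝ) {r : ℝ} (h0 : 2 ≤ r) (h1 : r ≤ 3) :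
    ‖eI x - 1 - x * Complex.I + x ^ 2 / 2‖ ≤ 3 * |x| ^ r := by
  have hn : ‖(x : ℂ) * Complex.I‖ = |x| := by simp
  rcases le_total |x| 1 with hx | hx
  · have h3 : |x| ^ (3 : ℝ) ≤ |x| ^ r := Real.rpow_le_rpow_of_exponent_ge_of_imp (abs_nonneg x) hx h1
      (by intro _ h; linarith)
    have := Complex.exp_bound (x := x * Complex.I) (by rw [hn]; exact hx) (n := 3) (by norm_num)
    rw [hn] at this
    have e : Complex.exp (x * Complex.I) -
        ∑ m ∈ Finset.range 3, ((x : ℂ) * Complex.I) ^ m / (m.factorial : ℂ) =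
        eI x - 1 - x * Complex.I + x ^ 2 / 2 := by
      simp [Finset.sum_range_succ, eI, mul_pow, Nat.factorial]
      ring
    rw [e] at this
    have h3' : |x| ^ (3 : ℝ) = |x| ^ 3 := by norm_cast
    rw [h3'] at h3
    refine this.trans ?_
    have hpos : 0 ≤ |x| ^ 3 := by positivity
    norm_num [Nat.factorial]
    linarith
  · have : |x| ^ (2 : ℝ) ≤ |x| ^ r := Real.rpow_le_rpow_of_exponent_le hx h0
    rw [Real.rpow_two, sq_abs] at this
    have h2 : ‖((x : ℂ) ^ 2 / 2)‖ = x ^ 2 / 2 := by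
      rw [norm_div, norm_pow]; simp
    calc ‖eI x - 1 - x * Complex.I + x ^ 2 / 2‖
        ≤ ‖eI x - 1 - x * Complex.I‖ + ‖((x : ℂ) ^ 2 / 2)‖ := norm_add_le _ _
      _ ≤ 2 * x ^ 2 + x ^ 2 / 2 := by rw [h2]; gcongr; exact norm_eI_sub_linear_le_sq x
      _ ≤ 3 * |x| ^ r := by nlinarith [sq_nonneg x]

/-- With g(x) = exp(ix) - 1 - ix one has g(x) - g(y) = (exp(iy) - 1)(exp(i(x-y)) - 1) + g(x-y). Both
terms are small with x - y, which will be the effect of deleting a few summands. -/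
lemma norm_linear_remainder_sub_le (x y : ℝ) {p : ℝ} (h0 : 2 ≤ p) (h1 : p ≤ 3) :
    ‖(eI x - 1 - x * Complex.I) - (eI y - 1 - y * Complex.I)‖
      ≤ 2 * |y| ^ (p - 2) * |x - y| + 2 * |x - y| ^ (p - 1) := by
  have e : (eI x - 1 - x * Complex.I) - (eI y - 1 - y * Complex.I) =
      (eI y - 1) * (eI (x - y) - 1) + (eI (x - y) - 1 - ((x - y : ℝ) : ℂ) * Complex.I) := by
    have : eI x = eI y * eI (x - y) := by rw [← eI_add, add_sub_cancel]
    rw [this]; push_cast; ring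
  rw [e]
  refine (norm_add_le _ _).trans (add_le_add ?_ ?_)
  · rw [norm_mul]
    exact mul_le_mul (norm_eI_sub_one_le_rpow y (by linarith) (by linarith))
      (norm_eI_sub_one_le _) (norm_nonneg _) (by positivity)
  · exact norm_eI_sub_linear_le_rpow _ (by linarith) (by linarith)

/-- The left side is homogeneous of degree p, hence at most the p-th power of the largest variable.
Integrated after normalisation, this replaces Hölder's inequality for three functions at the price
of a factor 3. -/
lemma mul_mul_rpow_le {x y z p : ℝ} (hx : 0 ≤ x) (hy : 0 ≤ y) (hz : 0 ≤ z) (hp : 2 < p) :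
    x * y * z ^ (p - 2) ≤ x ^ p + y ^ p + z ^ p := by
  have key : ∀ w : ℝ, 0 ≤ w → x ≤ w → y ≤ w → z ≤ w → x * y * z ^ (p - 2) ≤ w ^ p := by
    intro w hw h1 h2 h3
    calc x * y * z ^ (p - 2) ≤ w * w * w ^ (p - 2) := by gcongr
      _ = w ^ p := by
        rcases hw.eq_or_lt with rfl | hw
        · rw [Real.zero_rpow (show p ≠ 0 by linarith)]; simp
        · rw [show w * w = w ^ (2 : ℝ) by rw [Real.rpow_two]; ring, ← Real.rpow_add hw]; congr 1; ring
  have a1 := Real.rpow_nonneg hx p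
  have a2 := Real.rpow_nonneg hy p
  have a3 := Real.rpow_nonneg hz p
  rcases le_total x y with h1 | h1 <;> rcases le_total y z with h2 | h2 <;>
    rcases le_total x z with h3 | h3
  all_goals first
    | linarith [key x hx (by linarith) (by linarith) (by linarith)]
    | linarith [key y hy (by linarith) (by linarith) (by linarith)]
    | linarith [key z hz (by linarith) (by linarith) (by linarith)]

/-! ### Random variables with a bound on their L^p norm -/

section LpBound
variable {Ω : Type u} [MeasurableSpace Ω] {μ : Measure Ω} {p : ℝ} {Y Z W : Ω → ℝ} {c d e : ℝ}

/-- `Y` is a random variable with `‖Y‖_p ≤ c`. -/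
def LpBound (μ : Measure Ω) (p : ℝ) (Y : Ω → ℝ) (c : ℝ) : Prop :=
  Measurable Y ∧ eLpNorm Y (ENNReal.ofReal p) μ ≤ ENNReal.ofReal c

namespace LpBound

lemma memLp (h : LpBound μ p Y c) : MemLp Y (ENNReal.ofReal p) μ :=
  ⟨h.1.aestronglyMeasurable, h.2.trans_lt ENNReal.ofReal_lt_top⟩

lemma mono (h : LpBound μ p Y c) (hcd : c ≤ d) : LpBound μ p Y d :=
  ⟨h.1, h.2.trans (ENNReal.ofReal_le_ofReal hcd)⟩

lemma add (hp : 1 ≤ p) (hc : 0 ≤ c) (hd : 0 ≤ d) (h : LpBound μ p Y c) (h' : LpBound μ p Z d) :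
    LpBound μ p (fun ω => Y ω + Z ω) (c + d) := by
  refine ⟨h.1.add h'.1, ?_⟩
  rw [ENNReal.ofReal_add hc hd]
  exact (eLpNorm_add_le h.1.aestronglyMeasurable h'.1.aestronglyMeasurable
    (by simpa using hp)).trans (add_le_add h.2 h'.2)

lemma sub (hp : 1 ≤ p) (hc : 0 ≤ c) (hd : 0 ≤ d) (h : LpBound μ p Y c) (h' : LpBound μ p Z d) :
    LpBound μ p (fun ω => Y ω - Z ω) (c + d) := by
  refine ⟨h.1.sub h'.1, ?_⟩
  rw [ENNReal.ofReal_add hc hd]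
  exact (eLpNorm_sub_le h.1.aestronglyMeasurable h'.1.aestronglyMeasurable
    (by simpa using hp)).trans (add_le_add h.2 h'.2)

lemma zero : LpBound μ p (fun _ => 0) 0 := ⟨measurable_const, by simp⟩

lemma sum {ι : Type*} (hp : 1 ≤ p) (s : Finset ι) (F : ι → Ω → ℝ) (b : ι → ℝ)
    (hb : ∀ i ∈ s, 0 ≤ b i) (h : ∀ i ∈ s, LpBound μ p (F i) (b i)) :
    LpBound μ p (fun ω => ∑ i ∈ s, F i ω) (∑ i ∈ s, b i) := by
  classical
  induction s using Finset.induction_on with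
  | empty => simpa using zero
  | insert a s ha ih =>
    simp only [Finset.sum_insert ha]
    exact add hp (hb a (by simp)) (Finset.sum_nonneg fun i hi => hb i (by simp [hi]))
      (h a (by simp)) (ih (fun i hi => hb i (by simp [hi])) (fun i hi => h i (by simp [hi])))

lemma integrable_rpow (hp : 0 < p) (h : LpBound μ p Y c) :
    Integrable (fun ω => |Y ω| ^ p) μ := by
  have := h.memLp.integrable_norm_rpow (by simpa using hp) ENNReal.ofReal_ne_top
  simpa [ENNReal.toReal_ofReal hp.le] using this

lemma integral_rpow_le (hp : 0 < p) (hc : 0 ≤ c) (h : LpBound μ p Y c) :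
    ∫ ω, |Y ω| ^ p ∂μ ≤ c ^ p := by
  have h1 := h.memLp.eLpNorm_eq_integral_rpow_norm (by simpa using hp) ENNReal.ofReal_ne_top
  rw [ENNReal.toReal_ofReal hp.le] at h1
  have h2 := h.2
  rw [h1, ENNReal.ofReal_le_ofReal_iff hc] at h2
  have h0 : 0 ≤ ∫ ω, |Y ω| ^ p ∂μ := integral_nonneg fun ω => by positivity
  have h3 := Real.rpow_le_rpow (by positivity) h2 hp.le
  rwa [← Real.rpow_mul (by simpa using h0), inv_mul_cancel₀ hp.ne', Real.rpow_one] at h3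

lemma of_integral_rpow_le (hp : 0 < p) (hc : 0 ≤ c) (hY : Measurable Y)
    (hi : Integrable (fun ω => |Y ω| ^ p) μ) (h : ∫ ω, |Y ω| ^ p ∂μ ≤ c ^ p) :
    LpBound μ p Y c := by
  have hm : MemLp Y (ENNReal.ofReal p) μ := by
    rw [← integrable_norm_rpow_iff hY.aestronglyMeasurable (by simpa using hp)
      ENNReal.ofReal_ne_top]
    simpa [ENNReal.toReal_ofReal hp.le] using hi
  refine ⟨hY, ?_⟩
  rw [hm.eLpNorm_eq_integral_rpow_norm (by simpa using hp) ENNReal.ofReal_ne_top,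
    ENNReal.toReal_ofReal hp.le]
  refine ENNReal.ofReal_le_ofReal ?_
  have h0 : 0 ≤ ∫ ω, |Y ω| ^ p ∂μ := integral_nonneg fun ω => by positivity
  have h3 := Real.rpow_le_rpow h0 h (inv_nonneg.2 hp.le)
  rwa [← Real.rpow_mul hc, mul_inv_cancel₀ hp.ne', Real.rpow_one] at h3

lemma exponent_mono [IsProbabilityMeasure μ] {q : ℝ} (hq : q ≤ p) (h : LpBound μ p Y c) :
    LpBound μ q Y c :=
  ⟨h.1, (eLpNorm_le_eLpNorm_of_exponent_le (ENNReal.ofReal_le_ofReal hq)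
    h.1.aestronglyMeasurable).trans h.2⟩

lemma integrable [IsProbabilityMeasure μ] (hp : 1 ≤ p) (h : LpBound μ p Y c) :
    Integrable Y μ := h.memLp.integrable (by simpa using hp)

lemma integral_abs_le [IsProbabilityMeasure μ] (hp : 1 ≤ p) (hc : 0 ≤ c) (h : LpBound μ p Y c) :
    ∫ ω, |Y ω| ∂μ ≤ c := by
  simpa using (h.exponent_mono hp).integral_rpow_le one_pos hc

lemma integrable_sq [IsProbabilityMeasure μ] (hp : 2 ≤ p) (h : LpBound μ p Y c) :
    Integrable (fun ω => Y ω ^ 2) μ := by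
  simpa using (h.exponent_mono hp).integrable_rpow two_pos

lemma integral_sq_le [IsProbabilityMeasure μ] (hp : 2 ≤ p) (hc : 0 ≤ c) (h : LpBound μ p Y c) :
    ∫ ω, Y ω ^ 2 ∂μ ≤ c ^ 2 := by
  simpa using (h.exponent_mono hp).integral_rpow_le two_pos hc

lemma integrable_mul [IsProbabilityMeasure μ] (hp : 2 ≤ p) (h : LpBound μ p Y c)
    (h' : LpBound μ p Z d) : Integrable (fun ω => Y ω * Z ω) μ := by
  have h2 : MemLp Y 2 μ := by simpa using (h.exponent_mono hp).memLp
  have h2' : MemLp Z 2 μ := by simpa using (h'.exponent_mono hp).memLp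
  exact h2.integrable_mul h2'

/-- Cauchy–Schwarz through the arithmetic-geometric mean inequality, with the weights that balance
the two bounds; this is why c and d are positive. -/
lemma integral_abs_mul_le [IsProbabilityMeasure μ] (hp : 2 ≤ p) (hc : 0 < c) (hd : 0 < d)
    (h : LpBound μ p Y c) (h' : LpBound μ p Z d) : ∫ ω, |Y ω| * |Z ω| ∂μ ≤ c * d := by
  have hi : Integrable (fun ω => |Y ω| * |Z ω|) μ := by
    simpa [abs_mul] using (h.integrable_mul hp h').abs
  have pt : ∀ ω, |Y ω| * |Z ω| ≤ (d / (2 * c)) * Y ω ^ 2 + (c / (2 * d)) * Z ω ^ 2 := by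
    intro ω
    have h0 : 0 ≤ (d * |Y ω| - c * |Z ω|) ^ 2 / (2 * c * d) := by positivity
    have : (d * |Y ω| - c * |Z ω|) ^ 2 / (2 * c * d) =
      (d / (2 * c)) * |Y ω| ^ 2 + (c / (2 * d)) * |Z ω| ^ 2 - |Y ω| * |Z ω| := by
      field_simp; ring
    rw [this, sq_abs, sq_abs] at h0
    linarith
  calc ∫ ω, |Y ω| * |Z ω| ∂μ
      ≤ ∫ ω, ((d / (2 * c)) * Y ω ^ 2 + (c / (2 * d)) * Z ω ^ 2) ∂μ :=
        integral_mono hi (((h.integrable_sq hp).const_mul _).add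
          ((h'.integrable_sq hp).const_mul _)) pt
    _ = (d / (2 * c)) * ∫ ω, Y ω ^ 2 ∂μ + (c / (2 * d)) * ∫ ω, Z ω ^ 2 ∂μ := by
        rw [integral_add ((h.integrable_sq hp).const_mul _) ((h'.integrable_sq hp).const_mul _),
          integral_const_mul, integral_const_mul]
    _ ≤ (d / (2 * c)) * c ^ 2 + (c / (2 * d)) * d ^ 2 := by
        gcongr
        · exact h.integral_sq_le hp hc.le
        · exact h'.integral_sq_le hp hd.le
    _ = c * d := by field_simp; ring

lemma integrable_mul_mul_rpow (hp : 2 < p) (h : LpBound μ p Y c) (h' : LpBound μ p Z d)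
    (h'' : LpBound μ p W e) : Integrable (fun ω => |Y ω| * |Z ω| * |W ω| ^ (p - 2)) μ := by
  refine Integrable.mono' (((h.integrable_rpow (by linarith)).add
    (h'.integrable_rpow (by linarith))).add (h''.integrable_rpow (by linarith))) ?_ ?_
  · have := h.1; have := h'.1; have := h''.1
    exact Measurable.aestronglyMeasurable (by fun_prop)
  · refine Filter.Eventually.of_forall fun ω => ?_
    rw [Real.norm_of_nonneg (by positivity)]
    exact mul_mul_rpow_le (abs_nonneg _) (abs_nonneg _) (abs_nonneg _) hp

lemma integral_mul_mul_rpow_le (hp : 2 < p) (hc : 0 < c) (hd : 0 < d) (he : 0 < e)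
    (h : LpBound μ p Y c) (h' : LpBound μ p Z d) (h'' : LpBound μ p W e) :
    ∫ ω, |Y ω| * |Z ω| * |W ω| ^ (p - 2) ∂μ ≤ 3 * (c * d * e ^ (p - 2)) := by
  have hp0 : 0 < p := by linarith
  set q := c * d * e ^ (p - 2) with hq
  have hq0 : 0 < q := by positivity
  have pt : ∀ ω, |Y ω| * |Z ω| * |W ω| ^ (p - 2) ≤
      q / c ^ p * |Y ω| ^ p + q / d ^ p * |Z ω| ^ p + q / e ^ p * |W ω| ^ p := by
    intro ω
    have := mul_mul_rpow_le (x := |Y ω| / c) (y := |Z ω| / d) (z := |W ω| / e) (by positivity)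
      (by positivity) (by positivity) hp
    rw [Real.div_rpow (abs_nonneg _) hc.le, Real.div_rpow (abs_nonneg _) hd.le,
      Real.div_rpow (abs_nonneg _) he.le, Real.div_rpow (abs_nonneg _) he.le] at this
    have h2 := mul_le_mul_of_nonneg_left this hq0.le
    calc |Y ω| * |Z ω| * |W ω| ^ (p - 2) =
        q * (|Y ω| / c * (|Z ω| / d) * (|W ω| ^ (p - 2) / e ^ (p - 2))) := by
          rw [hq]; field_simp
      _ ≤ _ := h2
      _ = _ := by ring
  have i1 := (h.integrable_rpow hp0).const_mul (q / c ^ p)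
  have i2 := (h'.integrable_rpow hp0).const_mul (q / d ^ p)
  have i3 := (h''.integrable_rpow hp0).const_mul (q / e ^ p)
  calc ∫ ω, |Y ω| * |Z ω| * |W ω| ^ (p - 2) ∂μ ≤ ∫ ω, (q / c ^ p * |Y ω| ^ p +
        q / d ^ p * |Z ω| ^ p + q / e ^ p * |W ω| ^ p) ∂μ :=
        integral_mono (integrable_mul_mul_rpow hp h h' h'') ((i1.add i2).add i3) pt
    _ = q / c ^ p * ∫ ω, |Y ω| ^ p ∂μ + q / d ^ p * ∫ ω, |Z ω| ^ p ∂μ +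
        q / e ^ p * ∫ ω, |W ω| ^ p ∂μ := by
        rw [integral_add (f := fun ω => q / c ^ p * |Y ω| ^ p + q / d ^ p * |Z ω| ^ p) (i1.add i2) i3,
          integral_add i1 i2, integral_const_mul, integral_const_mul, integral_const_mul]
    _ ≤ q / c ^ p * c ^ p + q / d ^ p * d ^ p + q / e ^ p * e ^ p := by
        gcongr
        · exact h.integral_rpow_le hp0 hc.le
        · exact h'.integral_rpow_le hp0 hd.le
        · exact h''.integral_rpow_le hp0 he.le
    _ = 3 * q := by field_simp; ring

end LpBound
end LpBound

end WeakDep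

namespace WeakDep

/-! ### Perturbing a characteristic function by a localised remainder -/

section Localization
variable {Ω : Type u} [MeasurableSpace Ω] {μ : Measure Ω} {p : ℝ}

lemma integrable_of_norm_le {f : Ω → ℂ} {g : Ω → ℝ} (hf : Measurable f) (hg : Integrable g μ)
    (h : ∀ ω, ‖f ω‖ ≤ g ω) : Integrable f μ :=
  hg.mono' hf.aestronglyMeasurable (Filter.Eventually.of_forall h)

lemma norm_integral_le_of_le {f : Ω → ℂ} {g : Ω → ℝ} {c : ℝ} (hg : Integrable g μ)
    (h : ∀ ω, ‖f ω‖ ≤ g ω) (hc : ∫ ω, g ω ∂μ ≤ c) : ‖∫ ω, f ω ∂μ‖ ≤ c :=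
  (norm_integral_le_of_norm_le hg (Filter.Eventually.of_forall h)).trans hc

lemma integrable_eI [IsProbabilityMeasure μ] {U : Ω → ℝ} (hU : Measurable U) :
    Integrable (fun ω => eI (U ω)) μ :=
  integrable_of_norm_le (by fun_prop) (integrable_const 1) fun ω => (norm_eI _).le

lemma norm_integral_eI_le [IsProbabilityMeasure μ] (U : Ω → ℝ) :
    ‖∫ ω, eI (U ω) ∂μ‖ ≤ 1 :=
  norm_integral_le_of_le (integrable_const 1) (fun ω => (norm_eI _).le) (by simp)

/-- `U'` and the centred variable `R'` are independent approximations of `U` and `R`. -/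
structure Localization (μ : Measure Ω) (p : ℝ) (U R U' R' : Ω → ℝ) (ρ β Λ d : ℝ) : Prop where
  indep : IndepFun U' R' μ
  mean : ∫ ω, R ω ∂μ = 0
  mean' : ∫ ω, R' ω ∂μ = 0
  bound_R : LpBound μ p R d
  bound_R' : LpBound μ p R' d
  bound_sub : LpBound μ p (fun ω => R ω - R' ω) ρ
  bound_incr : LpBound μ p (fun ω => U ω - U' ω) β
  bound_U : LpBound μ p U Λ
  bound_U' : LpBound μ p U' Λ
  ρ_pos : 0 < ρ
  β_pos : 0 < β
  β_le : β ≤ Λ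
  d_pos : 0 < d

namespace Localization
variable {U R U' R' : Ω → ℝ} {ρ β Λ d : ℝ}

lemma integral_mul_comp_eq_zero (h : Localization μ p U R U' R' ρ β Λ d) {g : ℝ → ℂ}
    (hg : Measurable g) : ∫ ω, (R' ω : ℂ) * g (U' ω) ∂μ = 0 := by
  have hR := h.bound_R'.1
  have hU := h.bound_U'.1
  have hi : IndepFun (fun ω => (R' ω : ℂ)) (fun ω => g (U' ω)) μ :=
    h.indep.symm.comp Complex.measurable_ofReal hg
  have := hi.integral_fun_mul_eq_mul_integral (by fun_prop) (hg.comp hU).aestronglyMeasurable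
  rw [this, integral_complex_ofReal, h.mean']
  simp

/-- The decomposition R g(U) = (R - R') g(U) + R' (g(U) - g(U')) + R' g(U') is used, here with g(x)
= exp(iθx). The last term has mean zero because R' is centred and independent of U'. The first costs
ρ, the size of R - R'; the second costs dβ, the sizes of R' and of U - U'. Other choices of g give
the next two estimates. -/
lemma norm_integral_mul_eI_le [IsProbabilityMeasure μ] (hp : 2 < p)
    (h : Localization μ p U R U' R' ρ β Λ d) (θ : ℝ) :
    ‖∫ ω, (R ω : ℂ) * eI (θ * U ω) ∂μ‖ ≤ ρ + |θ| * (d * β) := by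
  have mR := h.bound_R.1; have mR' := h.bound_R'.1
  have mU := h.bound_U.1; have mU' := h.bound_U'.1
  have i0 := h.bound_sub.integrable (by linarith)
  have b0 : ∀ ω, ‖((R ω - R' ω : ℝ) : ℂ) * eI (θ * U ω)‖ ≤ |R ω - R' ω| := fun ω => by
    rw [norm_mul, norm_eI, mul_one, Complex.norm_real, Real.norm_eq_abs]
  have i1 : Integrable (fun ω => |θ| * (|R' ω| * |U ω - U' ω|)) μ := by
    have := (h.bound_R'.integrable_mul hp.le h.bound_incr).abs
    simp only [abs_mul] at this
    exact this.const_mul _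
  have b1 : ∀ ω, ‖(R' ω : ℂ) * (eI (θ * U ω) - eI (θ * U' ω))‖ ≤
      |θ| * (|R' ω| * |U ω - U' ω|) := fun ω => by
    rw [norm_mul, Complex.norm_real, Real.norm_eq_abs]
    have := norm_eI_sub_eI_le (θ * U ω) (θ * U' ω)
    rw [← mul_sub, abs_mul] at this
    calc _ ≤ |R' ω| * (|θ| * |U ω - U' ω|) := by gcongr
      _ = _ := by ring
  have b2 : ∀ ω, ‖(R' ω : ℂ) * eI (θ * U' ω)‖ ≤ |R' ω| := fun ω => by
    rw [norm_mul, norm_eI, mul_one, Complex.norm_real, Real.norm_eq_abs]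
  have e : ∫ ω, (R ω : ℂ) * eI (θ * U ω) ∂μ =
      ∫ ω, ((R ω - R' ω : ℝ) : ℂ) * eI (θ * U ω) ∂μ +
      ∫ ω, (R' ω : ℂ) * (eI (θ * U ω) - eI (θ * U' ω)) ∂μ := by
    have z := h.integral_mul_comp_eq_zero (g := fun x => eI (θ * x)) (by fun_prop)
    rw [← add_zero (_ + _), ← z, ← integral_add, ← integral_add]
    · congr 1; ext ω; push_cast; ring
    · exact (integrable_of_norm_le (by fun_prop) i0.abs b0).add
        (integrable_of_norm_le (by fun_prop) i1 b1)
    · exact integrable_of_norm_le (by fun_prop) (h.bound_R'.integrable (by linarith)).abs b2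
    · exact integrable_of_norm_le (by fun_prop) i0.abs b0
    · exact integrable_of_norm_le (by fun_prop) i1 b1
  rw [e]
  refine (norm_add_le _ _).trans (add_le_add ?_ ?_)
  · exact norm_integral_le_of_le i0.abs b0 (h.bound_sub.integral_abs_le (by linarith) h.ρ_pos.le)
  · refine norm_integral_le_of_le i1 b1 ?_
    rw [integral_const_mul]
    gcongr
    exact h.bound_R'.integral_abs_mul_le hp.le h.d_pos h.β_pos h.bound_incr

lemma Λ_pos (h : Localization μ p U R U' R' ρ β Λ d) : 0 < Λ := h.β_pos.trans_le h.β_le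

lemma abs_integral_mul_le [IsProbabilityMeasure μ] (hp : 2 < p)
    (h : Localization μ p U R U' R' ρ β Λ d) :
    |∫ ω, R ω * U ω ∂μ| ≤ ρ * Λ + d * β := by
  have mR' := h.bound_R'.1
  have mU' := h.bound_U'.1
  have z : ∫ ω, R' ω * U' ω ∂μ = 0 := by
    rw [h.indep.symm.integral_fun_mul_eq_mul_integral (by fun_prop) (by fun_prop), h.mean',
      zero_mul]
  have i1 := h.bound_sub.integrable_mul hp.le h.bound_U
  have i2 := h.bound_R'.integrable_mul hp.le h.bound_incr
  have i3 := h.bound_R'.integrable_mul hp.le h.bound_U'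
  have e : ∫ ω, R ω * U ω ∂μ =
      ∫ ω, (R ω - R' ω) * U ω ∂μ + ∫ ω, R' ω * (U ω - U' ω) ∂μ := by
    rw [← add_zero (_ + _), ← z, ← integral_add i1 i2, ← integral_add (i1.fun_add i2) i3]
    congr 1; ext ω; ring
  rw [e]
  refine (abs_add_le _ _).trans (add_le_add ?_ ?_)
  · refine (abs_integral_le_integral_abs).trans ?_
    simp only [abs_mul]
    exact h.bound_sub.integral_abs_mul_le hp.le h.ρ_pos h.Λ_pos h.bound_U
  · refine (abs_integral_le_integral_abs).trans ?_
    simp only [abs_mul]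
    exact h.bound_R'.integral_abs_mul_le hp.le h.d_pos h.β_pos h.bound_incr

lemma rpow_sub_one {x q : ℝ} (hx : 0 ≤ x) (hq : 2 < q) : x ^ (q - 1) = x * x ^ (q - 2) := by
  rcases hx.eq_or_lt with rfl | hx
  · rw [Real.zero_rpow (by linarith), zero_mul]
  · rw [show q - 1 = 1 + (q - 2) by ring, Real.rpow_add hx, Real.rpow_one]

lemma rpow_eq_sq_mul {x q : ℝ} (hx : 0 ≤ x) (hq : 2 < q) : x ^ q = x ^ 2 * x ^ (q - 2) := by
  rcases hx.eq_or_lt with rfl | hx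
  · rw [Real.zero_rpow (by linarith)]; simp
  · rw [← Real.rpow_two, ← Real.rpow_add hx]; congr 1; ring

/-- The same decomposition with g(x) = exp(iθx) - 1 - iθx. Here |g(x)| is at most 2|θx|^{p-1}, the
increment g(U) - g(U') is controlled by `norm_linear_remainder_sub_le`, and the resulting products
of degree p by the three-function Hölder bound. -/
lemma norm_integral_mul_linear_remainder_le [IsProbabilityMeasure μ] (hp : 2 < p) (hp3 : p ≤ 3)
    (h : Localization μ p U R U' R' ρ β Λ d) (θ : ℝ) :
    ‖∫ ω, (R ω : ℂ) * (eI (θ * U ω) - 1 - ((θ * U ω : ℝ) : ℂ) * Complex.I) ∂μ‖ ≤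
      |θ| ^ (p - 1) * (12 * (ρ * Λ ^ (p - 1) + d * β * Λ ^ (p - 2))) := by
  have mR := h.bound_R.1; have mR' := h.bound_R'.1
  have mU := h.bound_U.1; have mU' := h.bound_U'.1
  have hΛ := h.Λ_pos
  have j0 := h.bound_sub.integrable_mul_mul_rpow hp h.bound_U h.bound_U
  have j1 := h.bound_R'.integrable_mul_mul_rpow hp h.bound_incr h.bound_U'
  have j2 := h.bound_R'.integrable_mul_mul_rpow hp h.bound_incr h.bound_incr
  have i0 := j0.const_mul (2 * |θ| ^ (p - 1))
  have i1 := (j1.const_mul (2 * |θ| ^ (p - 1))).add (j2.const_mul (2 * |θ| ^ (p - 1)))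
  have b0 : ∀ ω, ‖((R ω - R' ω : ℝ) : ℂ) *
      (eI (θ * U ω) - 1 - ((θ * U ω : ℝ) : ℂ) * Complex.I)‖ ≤
      2 * |θ| ^ (p - 1) * (|R ω - R' ω| * |U ω| * |U ω| ^ (p - 2)) := fun ω => by
    rw [norm_mul, Complex.norm_real, Real.norm_eq_abs]
    have := norm_eI_sub_linear_le_rpow (θ * U ω) (r := p - 1) (by linarith) (by linarith)
    rw [abs_mul, Real.mul_rpow (abs_nonneg _) (abs_nonneg _), rpow_sub_one (abs_nonneg (U ω)) hp]
      at this
    calc _ ≤ |R ω - R' ω| * (2 * (|θ| ^ (p - 1) * (|U ω| * |U ω| ^ (p - 2)))) := by gcongr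
      _ = _ := by ring
  have b1 : ∀ ω, ‖(R' ω : ℂ) * ((eI (θ * U ω) - 1 - ((θ * U ω : ℝ) : ℂ) * Complex.I) -
      (eI (θ * U' ω) - 1 - ((θ * U' ω : ℝ) : ℂ) * Complex.I))‖ ≤
      2 * |θ| ^ (p - 1) * (|R' ω| * |U ω - U' ω| * |U' ω| ^ (p - 2)) +
      2 * |θ| ^ (p - 1) * (|R' ω| * |U ω - U' ω| * |U ω - U' ω| ^ (p - 2)) := fun ω => by
    rw [norm_mul, Complex.norm_real, Real.norm_eq_abs]
    have := norm_linear_remainder_sub_le (θ * U ω) (θ * U' ω) (p := p) (by linarith) (by linarith)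
    rw [← mul_sub, abs_mul, abs_mul, Real.mul_rpow (abs_nonneg _) (abs_nonneg _),
      Real.mul_rpow (abs_nonneg _) (abs_nonneg _), rpow_sub_one (abs_nonneg (U ω - U' ω)) hp]
      at this
    calc _ ≤ |R' ω| * (2 * (|θ| ^ (p - 2) * |U' ω| ^ (p - 2)) * (|θ| * |U ω - U' ω|) +
        2 * (|θ| ^ (p - 1) * (|U ω - U' ω| * |U ω - U' ω| ^ (p - 2)))) := by gcongr
      _ = _ := by rw [rpow_sub_one (abs_nonneg θ) hp]; ring
  have i2 : Integrable (fun ω => |R' ω| * 2 + |θ| * (|R' ω * U' ω|)) μ :=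
    ((h.bound_R'.integrable (by linarith)).abs.mul_const 2).add
      ((h.bound_R'.integrable_mul hp.le h.bound_U').abs.const_mul _)
  have b2 : ∀ ω, ‖(R' ω : ℂ) * (eI (θ * U' ω) - 1 - ((θ * U' ω : ℝ) : ℂ) * Complex.I)‖ ≤
      |R' ω| * 2 + |θ| * (|R' ω * U' ω|) := fun ω => by
    rw [norm_mul, Complex.norm_real, Real.norm_eq_abs]
    have : ‖(eI (θ * U' ω) - 1 - ((θ * U' ω : ℝ) : ℂ) * Complex.I)‖ ≤ 2 + |θ| * |U' ω| := by
      refine (norm_sub_le _ _).trans (add_le_add (norm_eI_sub_one_le_two _) ?_)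
      simp
    rw [abs_mul]
    calc _ ≤ |R' ω| * (2 + |θ| * |U' ω|) := by gcongr
      _ = _ := by ring
  have e : ∫ ω, (R ω : ℂ) * (eI (θ * U ω) - 1 - ((θ * U ω : ℝ) : ℂ) * Complex.I) ∂μ =
      ∫ ω, ((R ω - R' ω : ℝ) : ℂ) *
        (eI (θ * U ω) - 1 - ((θ * U ω : ℝ) : ℂ) * Complex.I) ∂μ +
      ∫ ω, (R' ω : ℂ) * ((eI (θ * U ω) - 1 - ((θ * U ω : ℝ) : ℂ) * Complex.I) -
        (eI (θ * U' ω) - 1 - ((θ * U' ω : ℝ) : ℂ) * Complex.I)) ∂μ := by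
    have z := h.integral_mul_comp_eq_zero
      (g := fun x => eI (θ * x) - 1 - ((θ * x : ℝ) : ℂ) * Complex.I) (by fun_prop)
    rw [← add_zero (_ + _), ← z, ← integral_add, ← integral_add]
    · congr 1; ext ω; push_cast; ring
    · exact (integrable_of_norm_le (by fun_prop) i0 b0).add
        (integrable_of_norm_le (by fun_prop) i1 b1)
    · exact integrable_of_norm_le (by fun_prop) i2 b2
    · exact integrable_of_norm_le (by fun_prop) i0 b0
    · exact integrable_of_norm_le (by fun_prop) i1 b1
  rw [e]
  have hβ : β ^ (p - 2) ≤ Λ ^ (p - 2) :=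
    Real.rpow_le_rpow h.β_pos.le h.β_le (by linarith)
  have hθ : 0 ≤ |θ| ^ (p - 1) := by positivity
  have d0 := h.d_pos; have β0 := h.β_pos; have ρ0 := h.ρ_pos
  refine (norm_add_le _ _).trans ((add_le_add
    (b := |θ| ^ (p - 1) * (6 * (ρ * Λ ^ (p - 1))))
    (d := |θ| ^ (p - 1) * (12 * (d * β * Λ ^ (p - 2)))) ?_ ?_).trans ?_)
  · refine norm_integral_le_of_le i0 b0 ?_
    rw [integral_const_mul]
    have := h.bound_sub.integral_mul_mul_rpow_le hp ρ0 hΛ hΛ h.bound_U h.bound_U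
    rw [rpow_sub_one hΛ.le hp]
    calc _ ≤ 2 * |θ| ^ (p - 1) * (3 * (ρ * Λ * Λ ^ (p - 2))) := by gcongr
      _ = _ := by ring
  · refine norm_integral_le_of_le i1 b1 ?_
    have k1 := h.bound_R'.integral_mul_mul_rpow_le hp d0 β0 hΛ h.bound_incr h.bound_U'
    have k2 := h.bound_R'.integral_mul_mul_rpow_le hp d0 β0 β0 h.bound_incr h.bound_incr
    simp only [Pi.add_apply]
    rw [integral_add (j1.const_mul _) (j2.const_mul _), integral_const_mul, integral_const_mul]
    calc _ ≤ 2 * |θ| ^ (p - 1) * (3 * (d * β * Λ ^ (p - 2))) +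
          2 * |θ| ^ (p - 1) * (3 * (d * β * Λ ^ (p - 2))) := by
          gcongr
          refine k2.trans ?_
          gcongr
      _ = _ := by ring
  · have : 0 ≤ |θ| ^ (p - 1) * (6 * (ρ * Λ ^ (p - 1))) := by positivity
    linarith

/-- First-order expansion of exp(iθR): the linear term carries the gain from localisation, the rest
is O(θ²R²). -/
lemma norm_charFun_add_sub_le [IsProbabilityMeasure μ] (hp : 2 < p)
    (h : Localization μ p U R U' R' ρ β Λ d) (θ : ℝ) :
    ‖∫ ω, eI (θ * (U ω + R ω)) ∂μ - ∫ ω, eI (θ * U ω) ∂μ‖ ≤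
      |θ| * (ρ + |θ| * (d * β)) + 2 * θ ^ 2 * d ^ 2 := by
  have mR := h.bound_R.1; have mU := h.bound_U.1
  have j := (h.bound_R.integrable_sq hp.le).const_mul (2 * θ ^ 2)
  have b0 : ∀ ω, ‖eI (θ * U ω) * (eI (θ * R ω) - 1 - ((θ * R ω : ℝ) : ℂ) * Complex.I)‖ ≤
      2 * θ ^ 2 * R ω ^ 2 := fun ω => by
    rw [norm_mul, norm_eI, one_mul]
    refine (norm_eI_sub_linear_le_sq _).trans (le_of_eq (by ring))
  have b1 : ∀ ω, ‖(R ω : ℂ) * eI (θ * U ω)‖ ≤ |R ω| := fun ω => by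
    rw [norm_mul, norm_eI, mul_one, Complex.norm_real, Real.norm_eq_abs]
  have i1 : Integrable (fun ω => (R ω : ℂ) * eI (θ * U ω)) μ :=
    integrable_of_norm_le (by fun_prop) (h.bound_R.integrable (by linarith)).abs b1
  have e : ∫ ω, eI (θ * (U ω + R ω)) ∂μ - ∫ ω, eI (θ * U ω) ∂μ =
      ((θ : ℂ) * Complex.I) * ∫ ω, (R ω : ℂ) * eI (θ * U ω) ∂μ +
      ∫ ω, eI (θ * U ω) * (eI (θ * R ω) - 1 - ((θ * R ω : ℝ) : ℂ) * Complex.I) ∂μ := by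
    rw [← integral_const_mul, ← integral_sub (integrable_eI (by fun_prop))
      (integrable_eI (by fun_prop)), ← integral_add (i1.const_mul _)]
    · congr 1; ext ω; rw [mul_add, eI_add]; push_cast; ring
    · exact integrable_of_norm_le (by fun_prop) j b0
  rw [e]
  refine (norm_add_le _ _).trans (add_le_add ?_ ?_)
  · rw [norm_mul]
    simp only [norm_mul, Complex.norm_I, mul_one, Complex.norm_real, Real.norm_eq_abs]
    gcongr
    exact h.norm_integral_mul_eI_le hp θ
  · refine norm_integral_le_of_le j b0 ?_
    rw [integral_const_mul]
    gcongr
    exact h.bound_R.integral_sq_le hp.le h.d_pos.le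

/-- Expand exp(iθR) to second order, then exp(iθU) to first order in the term iθR exp(iθU) and to
order zero in the term with R². The contribution of E R vanishes; what survives is -θ²(E RU + E
R²/2). The three remainders are bounded by d^p, by the linear remainder estimate, and by d²Λ^{p-2}.
-/
lemma norm_charFun_add_sub_quadratic_le [IsProbabilityMeasure μ] (hp : 2 < p) (hp3 : p ≤ 3)
    (h : Localization μ p U R U' R' ρ β Λ d) (θ : ℝ) :
    ‖∫ ω, eI (θ * (U ω + R ω)) ∂μ - ∫ ω, eI (θ * U ω) ∂μ +
      (θ ^ 2 * (∫ ω, R ω * U ω ∂μ + (∫ ω, R ω ^ 2 ∂μ) / 2) : ℝ)‖ ≤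
      |θ| ^ p * (12 * (ρ * Λ ^ (p - 1) + d * β * Λ ^ (p - 2) + d ^ 2 * Λ ^ (p - 2) + d ^ p)) := by
  have mR := h.bound_R.1; have mU := h.bound_U.1
  have hΛ := h.Λ_pos
  have d0 := h.d_pos; have β0 := h.β_pos; have ρ0 := h.ρ_pos
  have hp0 : 0 < p := by linarith
  have jA := (h.bound_R.integrable_rpow hp0).const_mul (3 * |θ| ^ p)
  have bA : ∀ ω, ‖eI (θ * U ω) * (eI (θ * R ω) - 1 - ((θ * R ω : ℝ) : ℂ) * Complex.I +
      ((θ * R ω : ℝ) : ℂ) ^ 2 / 2)‖ ≤ 3 * |θ| ^ p * |R ω| ^ p := fun ω => by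
    rw [norm_mul, norm_eI, one_mul]
    refine (norm_eI_sub_quadratic_le_rpow _ hp.le hp3).trans (le_of_eq ?_)
    rw [abs_mul, Real.mul_rpow (abs_nonneg _) (abs_nonneg _)]; ring
  have jC0 := h.bound_R.integrable_mul_mul_rpow hp h.bound_R h.bound_U
  have jC := jC0.const_mul (2 * |θ| ^ (p - 2))
  have bC : ∀ ω, ‖((R ω : ℝ) : ℂ) ^ 2 * (eI (θ * U ω) - 1)‖ ≤
      2 * |θ| ^ (p - 2) * (|R ω| * |R ω| * |U ω| ^ (p - 2)) := fun ω => by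
    rw [norm_mul, norm_pow, Complex.norm_real, Real.norm_eq_abs]
    have := norm_eI_sub_one_le_rpow (θ * U ω) (r := p - 2) (by linarith) (by linarith)
    rw [abs_mul, Real.mul_rpow (abs_nonneg _) (abs_nonneg _)] at this
    calc _ ≤ |R ω| ^ 2 * (2 * (|θ| ^ (p - 2) * |U ω| ^ (p - 2))) := by gcongr
      _ = _ := by ring
  have jB : Integrable (fun ω => |R ω| * 2 + |θ| * (|R ω * U ω|)) μ :=
    ((h.bound_R.integrable (by linarith)).abs.mul_const 2).add
      ((h.bound_R.integrable_mul hp.le h.bound_U).abs.const_mul _)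
  have bB : ∀ ω, ‖(R ω : ℂ) * (eI (θ * U ω) - 1 - ((θ * U ω : ℝ) : ℂ) * Complex.I)‖ ≤
      |R ω| * 2 + |θ| * (|R ω * U ω|) := fun ω => by
    rw [norm_mul, Complex.norm_real, Real.norm_eq_abs]
    have : ‖(eI (θ * U ω) - 1 - ((θ * U ω : ℝ) : ℂ) * Complex.I)‖ ≤ 2 + |θ| * |U ω| := by
      refine (norm_sub_le _ _).trans (add_le_add (norm_eI_sub_one_le_two _) ?_)
      simp
    rw [abs_mul]
    calc _ ≤ |R ω| * (2 + |θ| * |U ω|) := by gcongr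
      _ = _ := by ring
  have iA := integrable_of_norm_le (by fun_prop) jA bA
  have iB := (integrable_of_norm_le (by fun_prop) jB bB).const_mul ((θ : ℂ) * Complex.I)
  have iC := (integrable_of_norm_le (by fun_prop) jC bC).const_mul ((θ : ℂ) ^ 2 / 2)
  have iR := h.bound_R.integrable (by linarith)
  have iRU := h.bound_R.integrable_mul hp.le h.bound_U
  have iR2 := h.bound_R.integrable_sq hp.le
  have iQ : Integrable (fun ω => θ ^ 2 * (R ω * U ω + R ω ^ 2 / 2)) μ :=
    (iRU.add (iR2.div_const 2)).const_mul _
  have iL : Integrable (fun ω => eI (θ * (U ω + R ω)) - eI (θ * U ω)) μ :=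
    Integrable.sub (integrable_eI (by fun_prop)) (integrable_eI (by fun_prop))
  have zR : ∫ ω, ((R ω : ℝ) : ℂ) ∂μ = 0 := by rw [integral_complex_ofReal, h.mean]; simp
  have iRc : Integrable (fun ω => ((θ : ℂ) * Complex.I) * (R ω : ℂ)) μ :=
    (iR.ofReal (𝕜 := ℂ)).const_mul _
  have iQc : Integrable (fun ω => ((θ ^ 2 * (R ω * U ω + R ω ^ 2 / 2) : ℝ) : ℂ)) μ :=
    iQ.ofReal (𝕜 := ℂ)
  have e : ∫ ω, eI (θ * (U ω + R ω)) ∂μ - ∫ ω, eI (θ * U ω) ∂μ +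
      (θ ^ 2 * (∫ ω, R ω * U ω ∂μ + (∫ ω, R ω ^ 2 ∂μ) / 2) : ℝ) =
      ∫ ω, eI (θ * U ω) * (eI (θ * R ω) - 1 - ((θ * R ω : ℝ) : ℂ) * Complex.I +
        ((θ * R ω : ℝ) : ℂ) ^ 2 / 2) ∂μ +
      ((θ : ℂ) * Complex.I) *
        ∫ ω, (R ω : ℂ) * (eI (θ * U ω) - 1 - ((θ * U ω : ℝ) : ℂ) * Complex.I) ∂μ -
      ((θ : ℂ) ^ 2 / 2) * ∫ ω, ((R ω : ℝ) : ℂ) ^ 2 * (eI (θ * U ω) - 1) ∂μ := by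
    have e1 : (θ ^ 2 * (∫ ω, R ω * U ω ∂μ + (∫ ω, R ω ^ 2 ∂μ) / 2) : ℝ) =
        ∫ ω, θ ^ 2 * (R ω * U ω + R ω ^ 2 / 2) ∂μ := by
      rw [integral_const_mul, integral_add iRU (iR2.div_const 2), integral_div]
    have e2 : ((θ : ℂ) * Complex.I) * ∫ ω, ((R ω : ℝ) : ℂ) ∂μ = 0 := by rw [zR, mul_zero]
    rw [e1, ← integral_complex_ofReal, ← integral_sub (integrable_eI (by fun_prop))
      (integrable_eI (by fun_prop)), ← integral_add iL iQc, ← sub_zero (∫ ω, (_ + _) ∂μ), ← e2,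
      ← integral_const_mul, ← integral_const_mul, ← integral_const_mul,
      ← integral_sub (iL.fun_add iQc) iRc, ← integral_add iA iB, ← integral_sub (iA.fun_add iB) iC]
    congr 1; ext ω
    rw [mul_add, eI_add]; push_cast
    ring_nf
    rw [Complex.I_sq]
    ring
  rw [e]
  have hθ2 : |θ| ^ p = |θ| ^ 2 * |θ| ^ (p - 2) := rpow_eq_sq_mul (abs_nonneg _) hp
  have hθ1 : |θ| ^ p = |θ| * |θ| ^ (p - 1) := by
    rw [hθ2, rpow_sub_one (abs_nonneg _) hp]; ring
  have kA : ‖∫ ω, eI (θ * U ω) * (eI (θ * R ω) - 1 - ((θ * R ω : ℝ) : ℂ) * Complex.I +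
        ((θ * R ω : ℝ) : ℂ) ^ 2 / 2) ∂μ‖ ≤ 3 * |θ| ^ p * d ^ p := by
    refine norm_integral_le_of_le jA bA ?_
    rw [integral_const_mul]
    gcongr
    exact h.bound_R.integral_rpow_le hp0 d0.le
  have kC : ‖∫ ω, ((R ω : ℝ) : ℂ) ^ 2 * (eI (θ * U ω) - 1) ∂μ‖ ≤
      2 * |θ| ^ (p - 2) * (3 * (d * d * Λ ^ (p - 2))) := by
    refine norm_integral_le_of_le jC bC ?_
    rw [integral_const_mul]
    gcongr
    exact h.bound_R.integral_mul_mul_rpow_le hp d0 d0 hΛ h.bound_R h.bound_U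
  have kB := h.norm_integral_mul_linear_remainder_le hp hp3 θ
  have n1 : ‖(θ : ℂ) * Complex.I‖ = |θ| := by simp
  have n2 : ‖(θ : ℂ) ^ 2 / 2‖ = |θ| ^ 2 / 2 := by rw [norm_div, norm_pow]; simp
  calc _ ≤ 3 * |θ| ^ p * d ^ p + |θ| * (|θ| ^ (p - 1) *
        (12 * (ρ * Λ ^ (p - 1) + d * β * Λ ^ (p - 2)))) +
        |θ| ^ 2 / 2 * (2 * |θ| ^ (p - 2) * (3 * (d * d * Λ ^ (p - 2)))) := by
        refine (norm_sub_le _ _).trans (add_le_add ((norm_add_le _ _).trans (add_le_add kA ?_)) ?_)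
        · rw [norm_mul, n1]; gcongr
        · rw [norm_mul, n2]; gcongr
    _ = |θ| ^ p * (3 * d ^ p + 12 * (ρ * Λ ^ (p - 1) + d * β * Λ ^ (p - 2)) +
        3 * (d ^ 2 * Λ ^ (p - 2))) := by
        rw [mul_comm (3 * |θ| ^ p), ← mul_assoc |θ| (|θ| ^ (p - 1)), ← hθ1, hθ2]; ring
    _ ≤ _ := by
        gcongr
        have : 0 ≤ d ^ p := by positivity
        have : 0 ≤ d ^ 2 * Λ ^ (p - 2) := by positivity
        linarith

end Localization
end Localization
end WeakDep

namespace WeakDep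

set_option linter.unusedSectionVars false

/-! ### Weakly dependent stationary arrays and their block sums -/

section Array
variable {Ω : Type u}

/-- `∑_{a < k ≤ a + L} X_k`. -/
def blockSum (X : ℤ → Ω → ℝ) (a : ℤ) (L : ℕ) (ω : Ω) : ℝ :=
  ∑ j ∈ Finset.range L, X (a + 1 + j) ω

/-- `∑_{a < k ≤ a + L} X_k^{(k-a)}`, where `X_k^{(l)}` depends on the last `l` innovations only. -/
def truncSum (Xt : ℕ → ℤ → Ω → ℝ) (a : ℤ) (L : ℕ) (ω : Ω) : ℝ :=
  ∑ j ∈ Finset.range L, Xt (j + 1) (a + 1 + j) ω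

/-- The characteristic function of `∑_{0 < k ≤ L} X_k`. -/
noncomputable def chf [MeasurableSpace Ω] (μ : Measure Ω) (X : ℤ → Ω → ℝ) (L : ℕ) (θ : ℝ) : ℂ :=
  ∫ ω, eI (θ * blockSum X 0 L ω) ∂μ

/-- The variance of `∑_{0 < k ≤ L} X_k`. -/
noncomputable def var [MeasurableSpace Ω] (μ : Measure Ω) (X : ℤ → Ω → ℝ) (L : ℕ) : ℝ :=
  ∫ ω, blockSum X 0 L ω ^ 2 ∂μ

/-- A stationary centred `m`-dependent sequence `X` with approximations `Xt l` depending on the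
last `l` innovations; `𝓕 A` is the σ-algebra of the innovations with index in `A`. -/
structure WeakArray [MeasurableSpace Ω] (μ : Measure Ω) (p α M D : ℝ) (m : ℕ)
    (𝓕 : Set ℤ → MeasurableSpace Ω) (X : ℤ → Ω → ℝ) (Xt : ℕ → ℤ → Ω → ℝ) (δ : ℕ → ℝ) : Prop where
  two_lt : 2 < p
  le_three : p ≤ 3
  α_pos : 0 < α
  one_le_M : 1 ≤ M
  one_le_D : 1 ≤ D
  le : ∀ A, 𝓕 A ≤ ‹MeasurableSpace Ω›
  mono : ∀ A B, A ⊆ B → 𝓕 A ≤ 𝓕 B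
  indep : ∀ A B, Disjoint A B → Indep (𝓕 A) (𝓕 B) μ
  meas_X : ∀ k : ℤ, Measurable[𝓕 (Set.Ioc (k - m) k)] (X k)
  meas_Xt : ∀ (l : ℕ) (k : ℤ), Measurable[𝓕 (Set.Ioc (k - l) k)] (Xt l k)
  mean : ∀ k, ∫ ω, X k ω ∂μ = 0
  mean_t : ∀ l k, ∫ ω, Xt l k ω ∂μ = 0
  moment : ∀ k, LpBound μ p (X k) M
  δ_nonneg : ∀ l, 0 ≤ δ l
  approx : ∀ l k, 1 ≤ l → LpBound μ p (fun ω => X k ω - Xt l k ω) (δ l)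
  sum_le : ∀ N : ℕ, ∑ i ∈ Finset.range N, ((i : ℝ) + 1) ^ α * δ (i + 1) ≤ D
  stationary : ∀ (a : ℤ) (L : ℕ), IdentDistrib (blockSum X a L) (blockSum X 0 L) μ μ
  stationary_cov : ∀ (k : ℤ) (d : ℕ), ∫ ω, X k ω * X (k + d) ω ∂μ = ∫ ω, X 0 ω * X d ω ∂μ

lemma blockSum_add (X : ℤ → Ω → ℝ) (a : ℤ) (b c : ℕ) (ω : Ω) :
    blockSum X a (b + c) ω = blockSum X a b ω + blockSum X (a + b) c ω := by
  unfold blockSum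
  rw [Finset.sum_range_add]
  congr 1
  refine Finset.sum_congr rfl fun j _ => ?_
  congr 1; push_cast; ring

/-- For 0 ≤ v ≤ u, convexity (in the form of Bernoulli's inequality) gives (u+v)^p ≤ u^p + p v
(u+v)^{p-1}, and (u+v)^{p-1} ≤ (2u)^{p-1} ≤ 4u^{p-1} since p ≤ 3; hence the 12 = 3·4. The leading
terms keep the constant 1, which the recursion for the moments needs. -/
lemma abs_add_rpow_le (x y : ℝ) {p : ℝ} (hp : 2 ≤ p) (hp3 : p ≤ 3) :
    |x + y| ^ p ≤ |x| ^ p + |y| ^ p + 12 * (|x| * |y| ^ (p - 1) + |x| ^ (p - 1) * |y|) := by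
  have key : ∀ u v : ℝ, 0 ≤ v → v ≤ u → (u + v) ^ p ≤ u ^ p + 12 * (u ^ (p - 1) * v) := by
    intro u v hv hvu
    rcases (hv.trans hvu).eq_or_lt with hu | hu
    · have : v = 0 := by linarith
      simp [← hu, this, Real.zero_rpow (show p ≠ 0 by linarith)]
    have hs : 0 < u + v := by linarith
    have b := one_add_mul_self_le_rpow_one_add (s := -(v / (u + v))) (p := p)
      (by rw [neg_le_neg_iff, div_le_one hs]; linarith) (by linarith)
    have e : 1 + -(v / (u + v)) = u / (u + v) := by field_simp; ring
    rw [e, Real.div_rpow hu.le hs.le, le_div_iff₀ (by positivity)] at b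
    have e2 : (u + v) ^ p = (u + v) * (u + v) ^ (p - 1) := by
      rw [show p = 1 + (p - 1) by ring, Real.rpow_add hs, Real.rpow_one]; ring_nf
    have e3 : (1 + p * -(v / (u + v))) * (u + v) ^ p = (u + v) ^ p - p * v * (u + v) ^ (p - 1) := by
      rw [e2]; field_simp; ring
    rw [e3] at b
    have h4 : (u + v) ^ (p - 1) ≤ 4 * u ^ (p - 1) := by
      calc (u + v) ^ (p - 1) ≤ (2 * u) ^ (p - 1) := by
            apply Real.rpow_le_rpow hs.le (by linarith) (by linarith)
        _ = 2 ^ (p - 1) * u ^ (p - 1) := Real.mul_rpow (by norm_num) hu.le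
        _ ≤ 4 * u ^ (p - 1) := by
            gcongr
            calc (2 : ℝ) ^ (p - 1) ≤ 2 ^ (2 : ℝ) :=
                  Real.rpow_le_rpow_of_exponent_le (by norm_num) (by linarith)
              _ = 4 := by norm_num
    have : p * v * (u + v) ^ (p - 1) ≤ 3 * v * (4 * u ^ (p - 1)) := by gcongr
    nlinarith
  have h1 : |x + y| ^ p ≤ (|x| + |y|) ^ p :=
    Real.rpow_le_rpow (abs_nonneg _) (abs_add_le x y) (by linarith)
  have a1 : 0 ≤ |x| ^ p := by positivity
  have a2 : 0 ≤ |y| ^ p := by positivity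
  have a3 : 0 ≤ |x| * |y| ^ (p - 1) := by positivity
  have a4 : 0 ≤ |x| ^ (p - 1) * |y| := by positivity
  rcases le_total |y| |x| with h | h
  · linarith [key |x| |y| (abs_nonneg _) h]
  · have := key |y| |x| (abs_nonneg _) h
    rw [add_comm |y|, mul_comm (|y| ^ (p - 1))] at this
    linarith

namespace WeakArray
variable [mΩ : MeasurableSpace Ω] {μ : Measure Ω} {p α M D : ℝ} {m : ℕ}
  {𝓕 : Set ℤ → MeasurableSpace Ω} {X : ℤ → Ω → ℝ} {Xt : ℕ → ℤ → Ω → ℝ} {δ : ℕ → ℝ}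

lemma measurable_blockSum (h : WeakArray μ p α M D m 𝓕 X Xt δ) {a : ℤ} {L : ℕ} {A : Set ℤ}
    (hA : Set.Ioc (a + 1 - m) (a + L) ⊆ A) : Measurable[𝓕 A] (blockSum X a L) := by
  unfold blockSum
  refine Finset.measurable_fun_sum _ fun j hj => (h.meas_X _).mono (h.mono _ _ ?_) le_rfl
  refine (Set.Ioc_subset_Ioc ?_ ?_).trans hA
  · omega
  · have := Finset.mem_range.1 hj; omega

lemma measurable_truncSum (h : WeakArray μ p α M D m 𝓕 X Xt δ) {a : ℤ} {L : ℕ} {A : Set ℤ}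
    (hA : Set.Ioc a (a + L) ⊆ A) : Measurable[𝓕 A] (truncSum Xt a L) := by
  unfold truncSum
  refine Finset.measurable_fun_sum _ fun j hj => (h.meas_Xt _ _).mono (h.mono _ _ ?_) le_rfl
  refine (Set.Ioc_subset_Ioc ?_ ?_).trans hA
  · omega
  · have := Finset.mem_range.1 hj; omega

lemma indepFun (h : WeakArray μ p α M D m 𝓕 X Xt δ) {β γ : Type*} [MeasurableSpace β]
    [MeasurableSpace γ] {A B : Set ℤ} {Y : Ω → β} {Z : Ω → γ} (hY : Measurable[𝓕 A] Y)
    (hZ : Measurable[𝓕 B] Z) (hAB : Disjoint A B) : IndepFun Y Z μ := by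
  rw [IndepFun_iff_Indep]
  exact indep_of_indep_of_le_left (indep_of_indep_of_le_right (h.indep A B hAB) hZ.comap_le)
    hY.comap_le

lemma measurable_block (h : WeakArray μ p α M D m 𝓕 X Xt δ) (a : ℤ) (L : ℕ) :
    Measurable (blockSum X a L) :=
  (h.measurable_blockSum (A := Set.univ) (Set.subset_univ _)).mono (h.le _) le_rfl

lemma measurable_trunc (h : WeakArray μ p α M D m 𝓕 X Xt δ) (a : ℤ) (L : ℕ) :
    Measurable (truncSum Xt a L) :=
  (h.measurable_truncSum (A := Set.univ) (Set.subset_univ _)).mono (h.le _) le_rfl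

/-- Beyond index l the weights in `sum_le` are at least l^α. -/
lemma sum_tail_le (h : WeakArray μ p α M D m 𝓕 X Xt δ) {l : ℕ} (hl : 1 ≤ l) (N : ℕ) :
    ∑ j ∈ Finset.range N, δ (l + j + 1) ≤ D * (l : ℝ) ^ (-α) := by
  have hl0 : (0 : ℝ) < l := by exact_mod_cast hl
  have h1 : ∀ j ∈ Finset.range N, δ (l + j + 1) ≤
      (l : ℝ) ^ (-α) * ((((l + j : ℕ) : ℝ) + 1) ^ α * δ (l + j + 1)) := by
    intro j _
    have : (l : ℝ) ^ α ≤ (((l + j : ℕ) : ℝ) + 1) ^ α := by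
      apply Real.rpow_le_rpow hl0.le _ h.α_pos.le
      push_cast; linarith [(Nat.cast_nonneg j : (0 : ℝ) ≤ j)]
    calc δ (l + j + 1) = (l : ℝ) ^ (-α) * ((l : ℝ) ^ α * δ (l + j + 1)) := by
          rw [← mul_assoc, ← Real.rpow_add hl0]; simp
      _ ≤ _ := by have := h.δ_nonneg (l + j + 1); gcongr
  refine (Finset.sum_le_sum h1).trans ?_
  rw [← Finset.mul_sum, mul_comm]
  gcongr
  have h2 := h.sum_le (l + N)
  rw [Finset.sum_range_add] at h2
  have : 0 ≤ ∑ i ∈ Finset.range l, ((i : ℝ) + 1) ^ α * δ (i + 1) :=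
    Finset.sum_nonneg fun i _ => mul_nonneg (by positivity) (h.δ_nonneg _)
  linarith

lemma sum_δ_le (h : WeakArray μ p α M D m 𝓕 X Xt δ) (N : ℕ) :
    ∑ j ∈ Finset.range N, δ (j + 1) ≤ D := by
  refine (Finset.sum_le_sum fun j _ => ?_).trans (h.sum_le N)
  have : (1 : ℝ) ≤ ((j : ℝ) + 1) ^ α :=
    Real.one_le_rpow (by linarith [(Nat.cast_nonneg j : (0 : ℝ) ≤ j)]) h.α_pos.le
  nlinarith [h.δ_nonneg (j + 1)]

/-- Since the δ's are summable, ignoring the innovations up to time a costs a bounded amount,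
however long the block. -/
lemma remainder_bound (h : WeakArray μ p α M D m 𝓕 X Xt δ) (a : ℤ) (L : ℕ) :
    LpBound μ p (fun ω => blockSum X a L ω - truncSum Xt a L ω) D := by
  have h2 := h.two_lt
  have := LpBound.sum (μ := μ) (p := p) (by linarith) (Finset.range L)
    (fun j ω => X (a + 1 + j) ω - Xt (j + 1) (a + 1 + j) ω) (fun j => δ (j + 1))
    (fun j _ => h.δ_nonneg _) (fun j _ => h.approx _ _ (by omega))
  simp only [Finset.sum_sub_distrib] at this
  exact this.mono (h.sum_δ_le L)

variable [IsProbabilityMeasure μ]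

lemma bound_Xt (h : WeakArray μ p α M D m 𝓕 X Xt δ) {l : ℕ} (hl : 1 ≤ l) (k : ℤ) :
    LpBound μ p (Xt l k) (M + δ l) := by
  have h2 := h.two_lt
  have := (h.moment k).sub (by linarith) (by linarith [h.one_le_M]) (h.δ_nonneg l)
    (h.approx l k hl)
  simpa using this

lemma integral_truncSum (h : WeakArray μ p α M D m 𝓕 X Xt δ) (a : ℤ) (L : ℕ) :
    ∫ ω, truncSum Xt a L ω ∂μ = 0 := by
  have h2 := h.two_lt
  unfold truncSum
  rw [integral_finsetSum _ fun j _ => (h.bound_Xt (by omega) _).integrable (by linarith)]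
  exact Finset.sum_eq_zero fun j _ => h.mean_t _ _

lemma integral_blockSum (h : WeakArray μ p α M D m 𝓕 X Xt δ) (a : ℤ) (L : ℕ) :
    ∫ ω, blockSum X a L ω ∂μ = 0 := by
  have h2 := h.two_lt
  unfold blockSum
  rw [integral_finsetSum _ fun j _ => (h.moment _).integrable (by linarith)]
  exact Finset.sum_eq_zero fun j _ => h.mean _

lemma integral_eI_blockSum (h : WeakArray μ p α M D m 𝓕 X Xt δ) (a : ℤ) (L : ℕ) (θ : ℝ) :
    ∫ ω, eI (θ * blockSum X a L ω) ∂μ = chf μ X L θ :=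
  ((h.stationary a L).comp (u := fun x => eI (θ * x)) (by fun_prop)).integral_eq

lemma integral_sq_blockSum (h : WeakArray μ p α M D m 𝓕 X Xt δ) (a : ℤ) (L : ℕ) :
    ∫ ω, blockSum X a L ω ^ 2 ∂μ = var μ X L :=
  ((h.stationary a L).comp (u := fun x => x ^ 2) (by fun_prop)).integral_eq

lemma norm_integral_eI_sub_le (h : WeakArray μ p α M D m 𝓕 X Xt δ) {U V : Ω → ℝ} {c : ℝ}
    (hU : Measurable U) (hV : Measurable V) (hc : 0 ≤ c)
    (hb : LpBound μ p (fun ω => U ω - V ω) c) (θ : ℝ) :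
    ‖∫ ω, eI (θ * U ω) ∂μ - ∫ ω, eI (θ * V ω) ∂μ‖ ≤ |θ| * c := by
  have h2 := h.two_lt
  rw [← integral_sub (integrable_eI (by fun_prop)) (integrable_eI (by fun_prop))]
  refine norm_integral_le_of_le ((hb.integrable (by linarith)).abs.const_mul |θ|)
    (fun ω => (norm_eI_sub_eI_le _ _).trans (le_of_eq ?_)) ?_
  · rw [← mul_sub, abs_mul]
  · rw [integral_const_mul]; gcongr; exact hb.integral_abs_le (by linarith) hc

lemma integral_eI_add (h : WeakArray μ p α M D m 𝓕 X Xt δ) {U V : Ω → ℝ} {A B : Set ℤ}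
    (hU : Measurable[𝓕 A] U) (hV : Measurable[𝓕 B] V) (hAB : Disjoint A B) (θ : ℝ) :
    ∫ ω, eI (θ * (U ω + V ω)) ∂μ = (∫ ω, eI (θ * U ω) ∂μ) * ∫ ω, eI (θ * V ω) ∂μ := by
  have hi : IndepFun (fun ω => eI (θ * U ω)) (fun ω => eI (θ * V ω)) μ :=
    (h.indepFun hU hV hAB).comp (φ := fun x => eI (θ * x)) (ψ := fun x => eI (θ * x))
      (by fun_prop) (by fun_prop)
  have mU := hU.mono (h.le A) le_rfl
  have mV := hV.mono (h.le B) le_rfl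
  rw [← hi.integral_fun_mul_eq_mul_integral (by fun_prop) (by fun_prop)]
  simp only [mul_add, eI_add]

lemma disjoint_Iic_Ioc (a b c : ℤ) (hab : a ≤ b) : Disjoint (Set.Iic a) (Set.Ioc b c) := by
  rw [Set.disjoint_left]; intro x hx hy; simp at hx hy; omega

lemma measurable_past (h : WeakArray μ p α M D m 𝓕 X Xt δ) (a : ℕ) :
    Measurable[𝓕 (Set.Iic (a : ℤ))] (blockSum X 0 a) :=
  h.measurable_blockSum (fun x hx => by simp at hx ⊢; omega)

/-- The second block is replaced by its truncation, which is independent of the first: once in the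
joint characteristic function and once in the product, each time at cost D|θ|. No lower bound on the
block lengths is needed. -/
theorem norm_chf_add_sub_mul_le (h : WeakArray μ p α M D m 𝓕 X Xt δ) (a b : ℕ) (θ : ℝ) :
    ‖chf μ X (a + b) θ - chf μ X a θ * chf μ X b θ‖ ≤ 2 * D * |θ| := by
  have h2 := h.two_lt
  have hD := h.one_le_D
  have mS := h.measurable_block; have mT := h.measurable_trunc
  have mS1 := mS 0 a; have mS2 := mS a b; have mT2 := mT a b
  have e1 : chf μ X (a + b) θ =
      ∫ ω, eI (θ * (blockSum X 0 a ω + blockSum X a b ω)) ∂μ := by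
    unfold chf; simp only [blockSum_add, zero_add]
  have e2 := h.integral_eI_add (h.measurable_past a) (h.measurable_truncSum (a := a) (L := b)
    subset_rfl) (disjoint_Iic_Ioc _ _ _ le_rfl) θ
  have k1 := h.norm_integral_eI_sub_le (U := fun ω => blockSum X 0 a ω + blockSum X a b ω)
    (V := fun ω => blockSum X 0 a ω + truncSum Xt a b ω) (c := D) (by fun_prop) (by fun_prop)
    (by linarith) (by simpa using h.remainder_bound a b) θ
  have k2 := h.norm_integral_eI_sub_le (c := D) mS2 mT2 (by linarith) (h.remainder_bound a b) θ
  rw [← e1, e2] at k1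
  rw [h.integral_eI_blockSum] at k2
  have k3 : ‖chf μ X a θ‖ ≤ 1 := norm_integral_eI_le _
  have : chf μ X (a + b) θ - chf μ X a θ * chf μ X b θ =
      (chf μ X (a + b) θ - (∫ ω, eI (θ * blockSum X 0 a ω) ∂μ) *
        ∫ ω, eI (θ * truncSum Xt a b ω) ∂μ) -
      chf μ X a θ * (chf μ X b θ - ∫ ω, eI (θ * truncSum Xt a b ω) ∂μ) := by
    unfold chf; ring
  rw [this]
  refine (norm_sub_le _ _).trans ?_
  rw [norm_mul]
  nlinarith [norm_nonneg (chf μ X b θ - ∫ ω, eI (θ * truncSum Xt a b ω) ∂μ)]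

/-! ### Second moments -/

/-- `γ₀ + 2 ∑_{1 ≤ d ≤ l} γ_d` with the autocovariances `γ_d = E X₀ X_d`. -/
noncomputable def covSum (μ : Measure Ω) (X : ℤ → Ω → ℝ) (l : ℕ) : ℝ :=
  ∫ ω, X 0 ω * X (0 : ℕ) ω ∂μ + 2 * ∑ d ∈ Finset.range l, ∫ ω, X 0 ω * X ((d + 1 : ℕ) : ℤ) ω ∂μ

/-- Keeping only the last d+1 innovations in the later variable makes it independent of X₀, so the
covariance sees only the truncation error. -/
lemma abs_cov_le (h : WeakArray μ p α M D m 𝓕 X Xt δ) (d : ℕ) :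
    |∫ ω, X 0 ω * X ((d + 1 : ℕ) : ℤ) ω ∂μ| ≤ M * δ (d + 1) := by
  have h2 := h.two_lt
  have hM := h.one_le_M
  set k : ℤ := ((d + 1 : ℕ) : ℤ)
  have hi : IndepFun (X 0) (Xt (d + 1) k) μ :=
    h.indepFun (h.meas_X 0) (h.meas_Xt _ _) (by
      rw [Set.disjoint_left]; intro x hx hy; simp at hx hy; omega)
  have z : ∫ ω, X 0 ω * Xt (d + 1) k ω ∂μ = 0 := by
    rw [hi.integral_fun_mul_eq_mul_integral (h.moment 0).1.aestronglyMeasurable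
      (h.bound_Xt (by omega) _).1.aestronglyMeasurable, h.mean, zero_mul]
  have e : ∫ ω, X 0 ω * X k ω ∂μ = ∫ ω, X 0 ω * (X k ω - Xt (d + 1) k ω) ∂μ := by
    rw [← sub_zero (∫ ω, X 0 ω * X k ω ∂μ), ← z, ← integral_sub
      ((h.moment 0).integrable_mul h2.le (h.moment k))
      ((h.moment 0).integrable_mul h2.le (h.bound_Xt (by omega) k))]
    congr 1; ext ω; ring
  rw [e]
  refine abs_integral_le_integral_abs.trans ?_
  simp only [abs_mul]
  -- `integral_abs_mul_le` needs positive bounds while δ may vanish, hence the slack ε/M.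
  refine le_of_forall_pos_le_add fun ε hε => ?_
  have := (h.moment 0).integral_abs_mul_le h2.le (by linarith)
    (show 0 < δ (d + 1) + ε / M by have := h.δ_nonneg (d + 1); positivity)
    ((h.approx (d + 1) k (by omega)).mono (le_add_of_nonneg_right (by positivity)))
  refine this.trans (le_of_eq ?_)
  field_simp

lemma sum_abs_cov_le (h : WeakArray μ p α M D m 𝓕 X Xt δ) (l : ℕ) :
    ∑ d ∈ Finset.range l, |∫ ω, X 0 ω * X ((d + 1 : ℕ) : ℤ) ω ∂μ| ≤ M * D := by
  have hM := h.one_le_M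
  calc _ ≤ ∑ d ∈ Finset.range l, M * δ (d + 1) := Finset.sum_le_sum fun d _ => h.abs_cov_le d
    _ = M * ∑ d ∈ Finset.range l, δ (d + 1) := by rw [Finset.mul_sum]
    _ ≤ M * D := by gcongr; exact h.sum_δ_le l

lemma abs_covSum_le (h : WeakArray μ p α M D m 𝓕 X Xt δ) (l : ℕ) :
    |covSum μ X l| ≤ M ^ 2 + 2 * (M * D) := by
  have h2 := h.two_lt
  have hM := h.one_le_M
  unfold covSum
  refine (abs_add_le _ _).trans (add_le_add ?_ ?_)
  · refine abs_integral_le_integral_abs.trans ?_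
    simp only [abs_mul]
    have := (h.moment 0).integral_abs_mul_le h2.le (by linarith) (by linarith)
      (h.moment ((0 : ℕ) : ℤ))
    linarith [sq M]
  · rw [abs_mul, abs_two]
    gcongr
    exact (Finset.abs_sum_le_sum_abs _ _).trans (h.sum_abs_cov_le l)

lemma abs_covSum_sub_le (h : WeakArray μ p α M D m 𝓕 X Xt δ) {l : ℕ} (hl : 1 ≤ l) (N : ℕ) :
    |covSum μ X (l + N) - covSum μ X l| ≤ 2 * (M * (D * (l : ℝ) ^ (-α))) := by
  have hM := h.one_le_M
  unfold covSum
  rw [Finset.sum_range_add, mul_add, add_sub_add_left_eq_sub, add_sub_cancel_left, abs_mul, abs_two]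
  gcongr
  calc _ ≤ ∑ d ∈ Finset.range N, M * δ (l + d + 1) :=
        (Finset.abs_sum_le_sum_abs _ _).trans (Finset.sum_le_sum fun d _ => h.abs_cov_le (l + d))
    _ = M * ∑ d ∈ Finset.range N, δ (l + d + 1) := by rw [Finset.mul_sum]
    _ ≤ _ := by gcongr; exact h.sum_tail_le hl N

/-- The new summand contributes its variance and twice its covariances with the L earlier ones,
which by stationarity depend on the lags 1, …, L only. Thus v_L is the sum of the `covSum`, and
bounds on the latter give linear bounds on v_L. -/
lemma var_succ (h : WeakArray μ p α M D m 𝓕 X Xt δ) (L : ℕ) :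
    var μ X (L + 1) = var μ X L + covSum μ X L := by
  have h2 := h.two_lt
  have hS : LpBound μ p (blockSum X 0 L) (∑ _j ∈ Finset.range L, M) :=
    LpBound.sum (by linarith) _ _ _ (fun _ _ => by linarith [h.one_le_M]) (fun j _ => h.moment _)
  have hX := h.moment (0 + 1 + L)
  have i1 := hS.integrable_sq h2.le
  have i2 := hS.integrable_mul h2.le hX
  have i3 := hX.integrable_sq h2.le
  have e : ∀ ω, blockSum X 0 (L + 1) ω ^ 2 = blockSum X 0 L ω ^ 2 +
      2 * (blockSum X 0 L ω * X (0 + 1 + L) ω) + X (0 + 1 + L) ω ^ 2 := by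
    intro ω; unfold blockSum; rw [Finset.sum_range_succ]; ring
  unfold var
  simp only [e]
  rw [integral_add (i1.fun_add (i2.const_mul 2)) i3, integral_add i1 (i2.const_mul 2),
    integral_const_mul]
  have e3 : ∫ ω, X (0 + 1 + L) ω ^ 2 ∂μ = ∫ ω, X 0 ω * X (0 : ℕ) ω ∂μ := by
    rw [← h.stationary_cov (0 + 1 + L) 0]; congr 1; ext ω; simp [sq]
  have e2 : ∫ ω, blockSum X 0 L ω * X (0 + 1 + L) ω ∂μ =
      ∑ d ∈ Finset.range L, ∫ ω, X 0 ω * X ((d + 1 : ℕ) : ℤ) ω ∂μ := by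
    rw [← Finset.sum_range_reflect]
    simp only [blockSum, Finset.sum_mul]
    rw [integral_finsetSum _ fun j _ => (h.moment _).integrable_mul h2.le hX]
    refine Finset.sum_congr rfl fun j hj => ?_
    have hj := Finset.mem_range.1 hj
    rw [← h.stationary_cov (0 + 1 + j)]
    have : (0 + 1 + (j : ℤ)) + ((L - 1 - j + 1 : ℕ) : ℤ) = 0 + 1 + L := by omega
    rw [this]
  rw [e2, e3]; unfold covSum; ring

lemma var_eq_sum (h : WeakArray μ p α M D m 𝓕 X Xt δ) (L : ℕ) :
    var μ X L = ∑ l ∈ Finset.range L, covSum μ X l := by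
  induction L with
  | zero => simp [var, blockSum]
  | succ L ih => rw [h.var_succ, ih, Finset.sum_range_succ]

lemma var_nonneg (L : ℕ) : 0 ≤ var μ X L := integral_nonneg fun _ => sq_nonneg _

lemma var_le (h : WeakArray μ p α M D m 𝓕 X Xt δ) (L : ℕ) :
    var μ X L ≤ (M ^ 2 + 2 * (M * D)) * L := by
  rw [h.var_eq_sum]
  calc _ ≤ ∑ l ∈ Finset.range L, (M ^ 2 + 2 * (M * D)) :=
        Finset.sum_le_sum fun l _ => (le_abs_self _).trans (h.abs_covSum_le l)
    _ = _ := by rw [Finset.sum_const, Finset.card_range, nsmul_eq_mul, mul_comm]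

lemma bound_blockSum_two (h : WeakArray μ p α M D m 𝓕 X Xt δ) (a : ℤ) (L : ℕ) :
    LpBound μ 2 (blockSum X a L) ((M + D) * Real.sqrt L) := by
  have h2 := h.two_lt
  have hM := h.one_le_M; have hD := h.one_le_D
  have hS : LpBound μ p (blockSum X a L) (∑ _j ∈ Finset.range L, M) :=
    LpBound.sum (by linarith) _ _ _ (fun _ _ => by linarith [h.one_le_M]) (fun j _ => h.moment _)
  refine LpBound.of_integral_rpow_le two_pos (by positivity) hS.1
    (by simpa using hS.integrable_sq h2.le) ?_
  simp only [Real.rpow_two, sq_abs]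
  rw [h.integral_sq_blockSum, mul_pow, Real.sq_sqrt (Nat.cast_nonneg _)]
  refine (h.var_le L).trans ?_
  gcongr
  nlinarith

end WeakArray
end Array
end WeakDep

namespace WeakDep

set_option linter.unusedSectionVars false

namespace WeakArray
variable {Ω : Type u} [mΩ : MeasurableSpace Ω] {μ : Measure Ω} {p α M D : ℝ} {m : ℕ}
  {𝓕 : Set ℤ → MeasurableSpace Ω} {X : ℤ → Ω → ℝ} {Xt : ℕ → ℤ → Ω → ℝ} {δ : ℕ → ℝ}
  [IsProbabilityMeasure μ]

/-! ### Moments of block sums -/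

/-- Independence splits the mixed moment, and p - 1 ≤ 2 makes L² bounds sufficient for both factors.
So the mixed terms in the expansion of |Y+Z|^p need no information on p-th moments. -/
lemma integral_abs_mul_rpow_le (h : WeakArray μ p α M D m 𝓕 X Xt δ) {Y Z : Ω → ℝ} {v y z : ℝ}
    (hi : IndepFun Y Z μ) (hv : 0 ≤ v) (hy : 0 ≤ y) (hz : 0 ≤ z)
    (hY : LpBound μ 2 Y (v * y)) (hZ : LpBound μ 2 Z (v * z)) :
    Integrable (fun ω => |Y ω| * |Z ω| ^ (p - 1)) μ ∧
    ∫ ω, |Y ω| * |Z ω| ^ (p - 1) ∂μ ≤ v ^ p * (y * z ^ (p - 1)) := by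
  have h2 := h.two_lt; have h3 := h.le_three
  have mY := hY.1; have mZ := hZ.1
  have hi' : IndepFun (fun ω => |Y ω|) (fun ω => |Z ω| ^ (p - 1)) μ :=
    hi.comp (φ := fun x => |x|) (ψ := fun x => |x| ^ (p - 1)) (by fun_prop) (by fun_prop)
  have hZ' := hZ.exponent_mono (q := p - 1) (by linarith)
  have iZ := hZ'.integrable_rpow (by linarith)
  have iY := (hY.integrable (by norm_num)).abs
  refine ⟨hi'.integrable_mul iY iZ, ?_⟩
  rw [hi'.integral_fun_mul_eq_mul_integral iY.aestronglyMeasurable iZ.aestronglyMeasurable]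
  calc _ ≤ (v * y) * (v * z) ^ (p - 1) := by
        refine mul_le_mul (hY.integral_abs_le (by norm_num) (by positivity))
          (hZ'.integral_rpow_le (by linarith) (by positivity))
          (integral_nonneg fun _ => by positivity) (by positivity)
    _ = _ := by
        rw [Real.mul_rpow hv hz, Localization.rpow_eq_sq_mul hv h2, Localization.rpow_sub_one hv h2]
        ring

/-- As p/2 > 1, x ↦ x^{p/2} is strictly convex, and splitting L into two comparable parts gains a
factor below 1. -/
lemma sqrt_rpow_add_le {p : ℝ} (hp : 2 < p) {a b L : ℝ} (ha : 0 ≤ a) (hb : 0 ≤ b)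
    (hab : a + b = L) (haL : a ≤ 2 / 3 * L) (hbL : b ≤ 2 / 3 * L) :
    √a ^ p + √b ^ p ≤ (2 / 3 : ℝ) ^ (p / 2 - 1) * √L ^ p := by
  have hL : 0 ≤ L := by linarith
  have key : ∀ x : ℝ, 0 ≤ x → x ≤ 2 / 3 * L →
      √x ^ p ≤ x * ((2 / 3 : ℝ) ^ (p / 2 - 1) * L ^ (p / 2 - 1)) := by
    intro x hx hxL
    rw [← Real.mul_rpow (by norm_num) hL, Real.sqrt_eq_rpow, ← Real.rpow_mul hx]
    rcases hx.eq_or_lt with rfl | hx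
    · rw [Real.zero_rpow (by linarith), zero_mul]
    calc x ^ (1 / 2 * p) = x * x ^ (p / 2 - 1) := by
          rw [← Real.rpow_one_add' hx.le (by linarith)]; congr 1; ring
      _ ≤ _ := by gcongr; linarith
  have eL : √L ^ p = L * L ^ (p / 2 - 1) := by
    rw [Real.sqrt_eq_rpow, ← Real.rpow_mul hL, ← Real.rpow_one_add' hL (by linarith)]
    congr 1; ring
  rw [eL]
  calc _ ≤ a * ((2 / 3 : ℝ) ^ (p / 2 - 1) * L ^ (p / 2 - 1)) +
        b * ((2 / 3 : ℝ) ^ (p / 2 - 1) * L ^ (p / 2 - 1)) :=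
        add_le_add (key a ha haL) (key b hb hbL)
    _ = _ := by rw [← hab]; ring

/-- Strong induction by halving. Write the sum as S + T + R with S the first half and T the
truncated second half, independent of S. The pure p-th moments contract by the factor r^p, the mixed
ones are controlled by the L² bound `bound_blockSum_two`, and superadditivity of x^p combines both
into (rA + 24v)√L with v = M + 2D. The remainder R adds D. Proving A√L - D instead of A√L leaves
room for passing from a block to its truncation, so `hA2` contains 2D. -/
theorem bound_blockSum_sub (h : WeakArray μ p α M D m 𝓕 X Xt δ) {A r : ℝ} (hr : 0 ≤ r)
    (hrp : r ^ p = (2 / 3 : ℝ) ^ (p / 2 - 1)) (hA1 : M + D ≤ A)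
    (hA2 : r * A + 24 * (M + 2 * D) + 2 * D ≤ A) (L : ℕ) (hL : 1 ≤ L) :
    ∀ a : ℤ, LpBound μ p (blockSum X a L) (A * √L - D) := by
  have h2 := h.two_lt; have h3 := h.le_three
  have hM := h.one_le_M; have hD := h.one_le_D
  have hp0 : 0 < p := by linarith
  induction L using Nat.strong_induction_on with
  | _ L ih =>
  intro a
  rcases hL.eq_or_lt with rfl | hL2
  · have : blockSum X a 1 = X (a + 1) := by ext ω; simp [blockSum]
    rw [this]
    exact (h.moment _).mono (by simp; linarith)
  -- Halves rounded to integers; the ratio 2/3 is attained for L = 3.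
  obtain ⟨b, c, hb, hc, hbc, hb3, hc3⟩ : ∃ b c : ℕ, 1 ≤ b ∧ 1 ≤ c ∧ L = b + c ∧
      3 * b ≤ 2 * L ∧ 3 * c ≤ 2 * L := ⟨L / 2, L - L / 2, by omega, by omega, by omega, by omega,
        by omega⟩
  have sb : (1 : ℝ) ≤ √b := Real.one_le_sqrt.2 (by exact_mod_cast hb)
  have sc : (1 : ℝ) ≤ √c := Real.one_le_sqrt.2 (by exact_mod_cast hc)
  have sL : (1 : ℝ) ≤ √L := Real.one_le_sqrt.2 (by exact_mod_cast hL)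
  have hbL : (√b : ℝ) ≤ √L := Real.sqrt_le_sqrt (by exact_mod_cast (by omega))
  have hcL : (√c : ℝ) ≤ √L := Real.sqrt_le_sqrt (by exact_mod_cast (by omega))
  have hA0 : 0 ≤ A := by linarith
  have B1 : LpBound μ p (blockSum X a b) (A * √b) := (ih b (by omega) hb a).mono (by linarith)
  have B2 : LpBound μ p (truncSum Xt (a + b) c) (A * √c) := by
    have := (ih c (by omega) hc (a + b)).sub (by linarith) (by nlinarith) (by linarith)
      (h.remainder_bound (a + b) c)
    simpa using this
  have C1 : LpBound μ 2 (blockSum X a b) ((M + 2 * D) * √b) :=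
    (h.bound_blockSum_two a b).mono (by nlinarith)
  have C2 : LpBound μ 2 (truncSum Xt (a + b) c) ((M + 2 * D) * √c) := by
    have := (h.bound_blockSum_two (a + b) c).sub (by norm_num) (by positivity) (by linarith)
      ((h.remainder_bound (a + b) c).exponent_mono h2.le)
    refine LpBound.mono (c := (M + D) * √c + D) (by simpa using this) (by nlinarith)
  have hi : IndepFun (blockSum X a b) (truncSum Xt (a + b) c) μ :=
    h.indepFun (A := Set.Iic (a + b)) (h.measurable_blockSum (fun x hx => by simp at hx ⊢; omega))
      (h.measurable_truncSum subset_rfl) (disjoint_Iic_Ioc _ _ _ le_rfl)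
  set v := M + 2 * D with hv
  have v0 : 0 ≤ v := by linarith
  obtain ⟨i1, k1⟩ := h.integral_abs_mul_rpow_le hi v0 (by linarith) (by linarith) C1 C2
  obtain ⟨i2, k2⟩ := h.integral_abs_mul_rpow_le hi.symm v0 (by linarith) (by linarith) C2 C1
  have B := B1.add (by linarith) (by positivity) (by positivity) B2
  have tgt : LpBound μ p (fun ω => blockSum X a b ω + truncSum Xt (a + b) c ω)
      ((r * A + 24 * v) * √L) := by
    refine LpBound.of_integral_rpow_le hp0 (by positivity) B.1 (B.integrable_rpow hp0) ?_
    have j1 := B1.integrable_rpow hp0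
    have j2 := B2.integrable_rpow hp0
    have e1 : √b * √c ^ (p - 1) ≤ √L ^ p := by
      calc √b * √c ^ (p - 1) ≤ √L * √L ^ (p - 1) := by gcongr; linarith
        _ = √L ^ p := by
          rw [Localization.rpow_sub_one (by linarith) h2,
            Localization.rpow_eq_sq_mul (x := √(L : ℝ)) (by linarith) h2]; ring
    have e2 : √c * √b ^ (p - 1) ≤ √L ^ p := by
      calc √c * √b ^ (p - 1) ≤ √L * √L ^ (p - 1) := by gcongr; linarith
        _ = √L ^ p := by
          rw [Localization.rpow_sub_one (by linarith) h2,
            Localization.rpow_eq_sq_mul (x := √(L : ℝ)) (by linarith) h2]; ring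
    calc ∫ ω, |blockSum X a b ω + truncSum Xt (a + b) c ω| ^ p ∂μ
        ≤ ∫ ω, ((|blockSum X a b ω| ^ p + |truncSum Xt (a + b) c ω| ^ p) +
          12 * (|blockSum X a b ω| * |truncSum Xt (a + b) c ω| ^ (p - 1) +
            |truncSum Xt (a + b) c ω| * |blockSum X a b ω| ^ (p - 1))) ∂μ := by
          refine integral_mono (B.integrable_rpow hp0)
            ((j1.add j2).add ((i1.add i2).const_mul 12)) fun ω => ?_
          have := abs_add_rpow_le (blockSum X a b ω) (truncSum Xt (a + b) c ω) h2.le h3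
          rw [mul_comm (|blockSum X a b ω| ^ (p - 1))] at this
          exact this
      _ = (∫ ω, |blockSum X a b ω| ^ p ∂μ + ∫ ω, |truncSum Xt (a + b) c ω| ^ p ∂μ) +
          12 * (∫ ω, |blockSum X a b ω| * |truncSum Xt (a + b) c ω| ^ (p - 1) ∂μ +
            ∫ ω, |truncSum Xt (a + b) c ω| * |blockSum X a b ω| ^ (p - 1) ∂μ) := by
          rw [integral_add (j1.fun_add j2) ((i1.fun_add i2).const_mul 12), integral_add j1 j2,
            integral_const_mul, integral_add i1 i2]
      _ ≤ ((A * √b) ^ p + (A * √c) ^ p) + 12 * (v ^ p * √L ^ p + v ^ p * √L ^ p) := by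
          have := B1.integral_rpow_le hp0 (by positivity)
          have := B2.integral_rpow_le hp0 (by positivity)
          gcongr
          · exact k1.trans (by gcongr)
          · exact k2.trans (by gcongr)
      _ = A ^ p * (√b ^ p + √c ^ p) + 24 * v ^ p * √L ^ p := by
          rw [Real.mul_rpow hA0 (by linarith), Real.mul_rpow hA0 (by linarith)]; ring
      _ ≤ A ^ p * (r ^ p * √L ^ p) + 24 ^ p * v ^ p * √L ^ p := by
          have h24 : (24 : ℝ) ≤ 24 ^ p := by
            conv_lhs => rw [← Real.rpow_one 24]
            exact Real.rpow_le_rpow_of_exponent_le (by norm_num) (by linarith)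
          have := sqrt_rpow_add_le h2 (a := b) (b := c) (L := L) (by positivity) (by positivity)
            (by rw [hbc]; push_cast; ring)
            (by have : (3 * b : ℝ) ≤ 2 * L := by exact_mod_cast hb3
                linarith)
            (by have : (3 * c : ℝ) ≤ 2 * L := by exact_mod_cast hc3
                linarith)
          rw [← hrp] at this
          gcongr
      _ = ((r * A) ^ p + (24 * v) ^ p) * √L ^ p := by
          rw [Real.mul_rpow hr hA0, Real.mul_rpow (by norm_num) v0]; ring
      _ ≤ (r * A + 24 * v) ^ p * √L ^ p := by
          gcongr
          exact Real.add_rpow_le_rpow_add (by positivity) (by positivity) (by linarith)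
      _ = _ := by rw [← Real.mul_rpow (by positivity) (by linarith)]
  have := tgt.add (by linarith) (by positivity) (by linarith) (h.remainder_bound (a + b) c)
  have e : blockSum X a L = fun ω => (blockSum X a b ω + truncSum Xt (a + b) c ω) +
      (blockSum X (a + b) c ω - truncSum Xt (a + b) c ω) := by
    ext ω; rw [hbc, blockSum_add]; ring
  rw [e]
  refine this.mono ?_
  nlinarith

end WeakArray
end WeakDep

namespace WeakDep

set_option linter.unusedSectionVars false

namespace WeakArray
variable {Ω : Type u} [mΩ : MeasurableSpace Ω] {μ : Measure Ω} {p α M D : ℝ} {m : ℕ}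
  {𝓕 : Set ℤ → MeasurableSpace Ω} {X : ℤ → Ω → ℝ} {Xt : ℕ → ℤ → Ω → ℝ} {δ : ℕ → ℝ}
  [IsProbabilityMeasure μ] {A : ℝ}

/-! ### Joining two blocks -/

/-- The part of `blockSum X a b - truncSum Xt a b` that depends on the innovations with index in
`(a - l, a + l]` only. -/
def localRemainder (Xt : ℕ → ℤ → Ω → ℝ) (a : ℤ) (l : ℕ) (ω : Ω) : ℝ :=
  ∑ j ∈ Finset.range l, (Xt (l + j + 1) (a + 1 + j) ω - Xt (j + 1) (a + 1 + j) ω)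

lemma measurable_localRemainder (h : WeakArray μ p α M D m 𝓕 X Xt δ) (a : ℤ) (l : ℕ) :
    Measurable[𝓕 (Set.Ioc (a - l) (a + l))] (localRemainder Xt a l) := by
  unfold localRemainder
  refine Finset.measurable_fun_sum _ fun j hj => ?_
  have := Finset.mem_range.1 hj
  exact ((h.meas_Xt _ _).mono (h.mono _ _ (Set.Ioc_subset_Ioc (by omega) (by omega))) le_rfl).sub
    ((h.meas_Xt _ _).mono (h.mono _ _ (Set.Ioc_subset_Ioc (by omega) (by omega))) le_rfl)

lemma integral_localRemainder (h : WeakArray μ p α M D m 𝓕 X Xt δ) (a : ℤ) (l : ℕ) :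
    ∫ ω, localRemainder Xt a l ω ∂μ = 0 := by
  have h2 := h.two_lt
  have i : ∀ (l : ℕ) (k : ℤ), 1 ≤ l → Integrable (Xt l k) μ := fun l k hl =>
    (h.bound_Xt hl k).integrable (by linarith)
  unfold localRemainder
  have i' : ∀ j ∈ Finset.range l, Integrable
      (fun ω => Xt (l + j + 1) (a + 1 + j) ω - Xt (j + 1) (a + 1 + j) ω) μ := fun j _ =>
    (i _ _ (by omega)).sub (i _ _ (by omega))
  rw [integral_finsetSum _ i']
  refine Finset.sum_eq_zero fun j _ => ?_
  rw [integral_sub (i _ _ (by omega)) (i _ _ (by omega)), h.mean_t, h.mean_t, sub_zero]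

/-- The first l terms lose only their dependence on innovations before a - l, at cost Σ δ_{l+j+1}.
The later terms are dropped; they were already differences X - Xt with at least l+1 innovations
kept. Both are tails beyond l. -/
lemma bound_remainder_sub_local (h : WeakArray μ p α M D m 𝓕 X Xt δ) (a : ℤ) {b l : ℕ}
    (hl : 1 ≤ l) (hlb : l ≤ b) :
    LpBound μ p (fun ω => (blockSum X a b ω - truncSum Xt a b ω) - localRemainder Xt a l ω)
      (2 * D * (l : ℝ) ^ (-α)) := by
  have h2 := h.two_lt
  have hD := h.one_le_D
  have b1 : LpBound μ p (fun ω => ∑ j ∈ Finset.range l,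
      (X (a + 1 + j) ω - Xt (l + j + 1) (a + 1 + j) ω)) (D * (l : ℝ) ^ (-α)) :=
    (LpBound.sum (by linarith) (Finset.range l) _ (fun j => δ (l + j + 1))
      (fun j _ => h.δ_nonneg _) (fun j _ => h.approx _ _ (by omega))).mono (h.sum_tail_le hl l)
  have b2 : LpBound μ p (fun ω => ∑ j ∈ Finset.range (b - l),
      (X (a + 1 + (l + j : ℕ)) ω - Xt (l + j + 1) (a + 1 + (l + j : ℕ)) ω))
        (D * (l : ℝ) ^ (-α)) :=
    (LpBound.sum (by linarith) (Finset.range (b - l)) _ (fun j => δ (l + j + 1))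
      (fun j _ => h.δ_nonneg _) (fun j _ => h.approx _ _ (by omega))).mono (h.sum_tail_le hl _)
  have := b1.add (by linarith) (by positivity) (by positivity) b2
  refine LpBound.mono (c := D * (l : ℝ) ^ (-α) + D * (l : ℝ) ^ (-α)) ?_ (by linarith)
  convert this using 2 with ω
  obtain ⟨c, rfl⟩ := Nat.exists_eq_add_of_le hlb
  simp only [blockSum, truncSum, localRemainder, Finset.sum_range_add, Finset.sum_sub_distrib,
    Nat.add_sub_cancel_left]
  ring

/-- The local remainder uses innovations in (a-l, a+l]; the primed sum uses those up to a-l and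
those beyond a+l. The pair H, H' stands for the first block, or is zero when the second block is
treated alone; both versions are needed to compare ψ_{a+b} with ψ_a ψ_b. -/
theorem localization (h : WeakArray μ p α M D m 𝓕 X Xt δ) (hA1 : 1 ≤ A)
    (hA : ∀ (a : ℤ) (L : ℕ), LpBound μ p (blockSum X a L) (A * √L)) {a b l : ℕ} (hl : 1 ≤ l)
    (hlb : l ≤ b) {H H' : Ω → ℝ} (mH' : Measurable[𝓕 (Set.Iic ((a : ℤ) - l))] H')
    (hHH' : LpBound μ p (fun ω => H ω - H' ω) (A * √l)) (hH : LpBound μ p H (A * √a))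
    (hH' : LpBound μ p H' (A * √a)) :
    Localization μ p (fun ω => H ω + truncSum Xt a b ω)
      (fun ω => blockSum X a b ω - truncSum Xt a b ω)
      (fun ω => H' ω + truncSum Xt (a + l) (b - l) ω) (localRemainder Xt a l)
      (2 * D * (l : ℝ) ^ (-α)) (2 * (A + D) * √l) (2 * (A + D) * √((a + b : ℕ) : ℝ)) (3 * D) := by
  have h2 := h.two_lt
  have hD := h.one_le_D
  have hl0 : (0 : ℝ) < l := by exact_mod_cast hl
  have sl : (1 : ℝ) ≤ √l := Real.one_le_sqrt.2 (by exact_mod_cast hl)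
  have saL : √(a : ℝ) ≤ √((a + b : ℕ) : ℝ) := Real.sqrt_le_sqrt (by push_cast; linarith [b.cast_nonneg (α := ℝ)])
  have sbL : √(b : ℝ) ≤ √((a + b : ℕ) : ℝ) := Real.sqrt_le_sqrt (by push_cast; linarith [a.cast_nonneg (α := ℝ)])
  have sbl : √((b - l : ℕ) : ℝ) ≤ √(b : ℝ) := Real.sqrt_le_sqrt (by exact_mod_cast (by omega))
  have slL : √(l : ℝ) ≤ √((a + b : ℕ) : ℝ) := Real.sqrt_le_sqrt (by exact_mod_cast (by omega))
  have bT : ∀ (a : ℤ) (L : ℕ), LpBound μ p (truncSum Xt a L) (A * √L + D) := fun a L => by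
    have := (hA a L).sub (by linarith) (by positivity) (by linarith) (h.remainder_bound a L)
    simpa using this
  have lα : (l : ℝ) ^ (-α) ≤ 1 := Real.rpow_le_one_of_one_le_of_nonpos (by exact_mod_cast hl)
    (by linarith [h.α_pos])
  have hsub := h.bound_remainder_sub_local a hl hlb
  refine ⟨?_, ?_, h.integral_localRemainder _ _, (h.remainder_bound _ _).mono (by linarith), ?_,
    hsub, ?_, ?_, ?_, by positivity, by positivity, by gcongr, by linarith⟩
  · refine h.indepFun (A := Set.Iic ((a : ℤ) - l) ∪ Set.Ioc ((a : ℤ) + l) (a + b))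
      ((mH'.mono (h.mono _ _ Set.subset_union_left) le_rfl).add
        (h.measurable_truncSum ?_)) (h.measurable_localRemainder a l) ?_
    · refine Set.Subset.trans (Set.Ioc_subset_Ioc_right ?_) Set.subset_union_right
      omega
    · rw [Set.disjoint_left]; intro x hx hy; simp at hx hy; omega
  · rw [integral_sub ((hA _ _).integrable (by linarith)) ((bT _ _).integrable (by linarith)),
      h.integral_blockSum, h.integral_truncSum, sub_zero]
  · have := (h.remainder_bound a b).sub (by linarith) (by linarith) (by positivity) hsub
    refine LpBound.mono (c := D + 2 * D * (l : ℝ) ^ (-α)) (by simpa using this) (by nlinarith)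
  -- Each truncated sum is a block sum minus its remainder, so U - U' is made of the l deleted terms
  -- on each side, of size O(√l), and two remainders of size D.
  · have e : (fun ω => H ω + truncSum Xt a b ω - (H' ω + truncSum Xt (a + l) (b - l) ω)) =
        fun ω => (H ω - H' ω) + (blockSum X a l ω +
          ((blockSum X (a + l) (b - l) ω - truncSum Xt (a + l) (b - l) ω) -
          (blockSum X a b ω - truncSum Xt a b ω))) := by
      ext ω
      have := blockSum_add X a l (b - l) ω
      rw [Nat.add_sub_cancel' hlb] at this
      rw [this]; ring
    rw [e]
    have := hHH'.add (by linarith) (by positivity) (by positivity) ((hA a l).add (by linarith)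
      (by positivity) (by positivity) ((h.remainder_bound (a + l) (b - l)).sub (by linarith)
        (by linarith) (by linarith) (h.remainder_bound a b)))
    refine this.mono ?_
    nlinarith
  · have := hH.add (by linarith) (by positivity) (by positivity) (bT a b)
    exact this.mono (by nlinarith)
  · have := hH'.add (by linarith) (by positivity) (by positivity) (bT (a + l) (b - l))
    exact this.mono (by nlinarith)

theorem localization_block (h : WeakArray μ p α M D m 𝓕 X Xt δ) (hA1 : 1 ≤ A)
    (hA : ∀ (a : ℤ) (L : ℕ), LpBound μ p (blockSum X a L) (A * √L)) {a b l : ℕ} (hl : 1 ≤ l)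
    (hla : l ≤ a) (hlb : l ≤ b) :
    Localization μ p (fun ω => blockSum X 0 a ω + truncSum Xt a b ω)
      (fun ω => blockSum X a b ω - truncSum Xt a b ω)
      (fun ω => blockSum X 0 (a - l) ω + truncSum Xt (a + l) (b - l) ω) (localRemainder Xt a l)
      (2 * D * (l : ℝ) ^ (-α)) (2 * (A + D) * √l) (2 * (A + D) * √((a + b : ℕ) : ℝ)) (3 * D) := by
  refine h.localization hA1 hA hl hlb ?_ ?_ (hA 0 a) ?_
  · exact h.measurable_blockSum fun x hx => by simp at hx ⊢; omega
  · have e : (fun ω => blockSum X 0 a ω - blockSum X 0 (a - l) ω) =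
        blockSum X (0 + (a - l : ℕ)) l := by
      ext ω
      have := blockSum_add X 0 (a - l) l ω
      rw [Nat.sub_add_cancel hla] at this
      rw [this]; ring
    rw [e]
    exact hA _ _
  · refine (hA 0 (a - l)).mono ?_
    have : √((a - l : ℕ) : ℝ) ≤ √(a : ℝ) := Real.sqrt_le_sqrt (by exact_mod_cast (by omega))
    gcongr

theorem localization_zero (h : WeakArray μ p α M D m 𝓕 X Xt δ) (hA1 : 1 ≤ A)
    (hA : ∀ (a : ℤ) (L : ℕ), LpBound μ p (blockSum X a L) (A * √L)) {a b l : ℕ} (hl : 1 ≤ l)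
    (hlb : l ≤ b) :
    Localization μ p (truncSum Xt a b)
      (fun ω => blockSum X a b ω - truncSum Xt a b ω)
      (truncSum Xt (a + l) (b - l)) (localRemainder Xt a l)
      (2 * D * (l : ℝ) ^ (-α)) (2 * (A + D) * √l) (2 * (A + D) * √((a + b : ℕ) : ℝ)) (3 * D) := by
  have := h.localization hA1 hA hl hlb (a := a) (H := fun _ => 0) (H' := fun _ => 0)
    measurable_const (by simpa using LpBound.zero.mono (by positivity))
    (LpBound.zero.mono (by positivity)) (LpBound.zero.mono (by positivity))
  simpa using this

lemma chf_add_eq (a b : ℕ) (θ : ℝ) :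
    chf μ X (a + b) θ = ∫ ω, eI (θ * ((blockSum X 0 a ω + truncSum Xt a b ω) +
      (blockSum X a b ω - truncSum Xt a b ω))) ∂μ := by
  unfold chf
  congr 1; ext ω
  rw [blockSum_add, zero_add]; congr 2; ring

lemma chf_eq (h : WeakArray μ p α M D m 𝓕 X Xt δ) (a : ℤ) (b : ℕ) (θ : ℝ) :
    chf μ X b θ = ∫ ω, eI (θ * (truncSum Xt a b ω +
      (blockSum X a b ω - truncSum Xt a b ω))) ∂μ := by
  rw [← h.integral_eI_blockSum a]
  congr 1; ext ω
  congr 2; ring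

/-- With t the characteristic function of the truncated second block, ψ_{a+b} - ψ_a ψ_b = (ψ_{a+b} -
ψ_a t) - ψ_a (ψ_b - t). Each bracket adds the remainder R to a sum, and the first-order localised
expansion applies to both. -/
theorem norm_chf_add_sub_mul_le_of_le (h : WeakArray μ p α M D m 𝓕 X Xt δ) (hA1 : 1 ≤ A)
    (hA : ∀ (a : ℤ) (L : ℕ), LpBound μ p (blockSum X a L) (A * √L)) {a b l : ℕ} (hl : 1 ≤ l)
    (hla : l ≤ a) (hlb : l ≤ b) (θ : ℝ) :
    ‖chf μ X (a + b) θ - chf μ X a θ * chf μ X b θ‖ ≤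
      100 * (A + D) ^ 2 * (|θ| * (l : ℝ) ^ (-α) + θ ^ 2 * √l) := by
  have h2 := h.two_lt
  have hD := h.one_le_D
  have k1 := (h.localization_block hA1 hA hl hla hlb).norm_charFun_add_sub_le h2 θ
  have k2 := (h.localization_zero hA1 hA hl hlb (a := a)).norm_charFun_add_sub_le h2 θ
  have e2 := h.integral_eI_add (h.measurable_past a) (h.measurable_truncSum (a := a) (L := b)
    subset_rfl) (disjoint_Iic_Ioc _ _ _ le_rfl) θ
  rw [← chf_add_eq, e2] at k1
  rw [← h.chf_eq] at k2
  change ‖_ - chf μ X a θ * _‖ ≤ _ at k1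
  set t := ∫ ω, eI (θ * truncSum Xt a b ω) ∂μ
  have k3 : ‖chf μ X a θ‖ ≤ 1 := norm_integral_eI_le _
  have e : chf μ X (a + b) θ - chf μ X a θ * chf μ X b θ =
      (chf μ X (a + b) θ - chf μ X a θ * t) - chf μ X a θ * (chf μ X b θ - t) := by ring
  rw [e]
  have k4 : ‖chf μ X a θ * (chf μ X b θ - t)‖ ≤ ‖chf μ X b θ - t‖ := by
    rw [norm_mul]; nlinarith [norm_nonneg (chf μ X b θ - t)]
  refine (norm_sub_le _ _).trans ((add_le_add k1 (k4.trans k2)).trans ?_)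
  have sl : (1 : ℝ) ≤ √l := Real.one_le_sqrt.2 (by exact_mod_cast hl)
  have q1 : 4 * D ≤ 100 * (A + D) ^ 2 := by nlinarith
  have q2 : 12 * D * (A + D) * √l + 36 * D ^ 2 ≤ 100 * (A + D) ^ 2 * √l := by
    have : 36 * D ^ 2 ≤ 36 * D ^ 2 * √l := by nlinarith [sq_nonneg D]
    have : 12 * D * (A + D) + 36 * D ^ 2 ≤ 100 * (A + D) ^ 2 := by nlinarith
    nlinarith
  have q3 := mul_le_mul_of_nonneg_left q1
    (show 0 ≤ |θ| * (l : ℝ) ^ (-α) by positivity)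
  have q4 := mul_le_mul_of_nonneg_left q2 (sq_nonneg θ)
  have hθ : |θ| * |θ| = θ ^ 2 := by rw [← sq, sq_abs]
  calc _ = |θ| * (l : ℝ) ^ (-α) * (4 * D) + (|θ| * |θ|) * (12 * D * (A + D) * √l)
        + 36 * D ^ 2 * θ ^ 2 := by ring
    _ ≤ _ := by rw [hθ]; nlinarith

lemma var_add (h : WeakArray μ p α M D m 𝓕 X Xt δ) (hA1 : 1 ≤ A)
    (hA : ∀ (a : ℤ) (L : ℕ), LpBound μ p (blockSum X a L) (A * √L)) (a b : ℕ) :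
    var μ X (a + b) = var μ X a + var μ X b +
      2 * ∫ ω, (blockSum X a b ω - truncSum Xt a b ω) * blockSum X 0 a ω ∂μ := by
  have h2 := h.two_lt
  have hR := h.remainder_bound a b
  have hT : LpBound μ p (truncSum Xt a b) (A * √b + D) := by
    simpa using (hA a b).sub (by linarith) (by positivity) (by linarith [h.one_le_D]) hR
  have i1 := (hA 0 a).integrable_sq h2.le
  have i2 := (hA a b).integrable_sq h2.le
  have i3 := hR.integrable_mul h2.le (hA 0 a)
  have i4 := hT.integrable_mul h2.le (hA 0 a)
  have hi : IndepFun (truncSum Xt a b) (blockSum X 0 a) μ :=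
    (h.indepFun (h.measurable_past a) (h.measurable_truncSum (a := a) (L := b)
      subset_rfl) (disjoint_Iic_Ioc _ _ _ le_rfl)).symm
  have z : ∫ ω, truncSum Xt a b ω * blockSum X 0 a ω ∂μ = 0 := by
    rw [hi.integral_fun_mul_eq_mul_integral hT.1.aestronglyMeasurable
      (hA 0 a).1.aestronglyMeasurable, h.integral_truncSum, zero_mul]
  have e : ∀ ω, blockSum X 0 (a + b) ω ^ 2 = blockSum X 0 a ω ^ 2 + blockSum X a b ω ^ 2 +
      (2 * ((blockSum X a b ω - truncSum Xt a b ω) * blockSum X 0 a ω) +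
        2 * (truncSum Xt a b ω * blockSum X 0 a ω)) := by
    intro ω; rw [blockSum_add, zero_add]; ring
  rw [← h.integral_sq_blockSum a b]
  unfold var
  simp only [e]
  rw [integral_add (i1.fun_add i2) ((i3.const_mul 2).fun_add (i4.const_mul 2)), integral_add i1 i2,
    integral_add (i3.const_mul 2) (i4.const_mul 2), integral_const_mul, integral_const_mul, z]
  ring

/-- E R S_a = E R(S_a + T) - E R T, and each term has a localised bound. -/
lemma abs_integral_remainder_mul_le (h : WeakArray μ p α M D m 𝓕 X Xt δ) (hA1 : 1 ≤ A)
    (hA : ∀ (a : ℤ) (L : ℕ), LpBound μ p (blockSum X a L) (A * √L)) {a b l : ℕ} (hl : 1 ≤ l)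
    (hla : l ≤ a) (hlb : l ≤ b) :
    |∫ ω, (blockSum X a b ω - truncSum Xt a b ω) * blockSum X 0 a ω ∂μ| ≤
      24 * (A + D) ^ 2 * ((l : ℝ) ^ (-α) * √((a + b : ℕ) : ℝ) + √l) := by
  have h2 := h.two_lt
  have hD := h.one_le_D
  have L1 := h.localization_block hA1 hA hl hla hlb
  have L2 := h.localization_zero hA1 hA hl hlb (a := a)
  have k1 := L1.abs_integral_mul_le h2
  have k2 := L2.abs_integral_mul_le h2
  have e : ∫ ω, (blockSum X a b ω - truncSum Xt a b ω) * blockSum X 0 a ω ∂μ =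
      ∫ ω, (blockSum X a b ω - truncSum Xt a b ω) * (blockSum X 0 a ω + truncSum Xt a b ω) ∂μ -
      ∫ ω, (blockSum X a b ω - truncSum Xt a b ω) * truncSum Xt a b ω ∂μ := by
    rw [← integral_sub (L1.bound_R.integrable_mul h2.le L1.bound_U)
      (L2.bound_R.integrable_mul h2.le L2.bound_U)]
    congr 1; ext ω; ring
  rw [e]
  refine (abs_sub _ _).trans ((add_le_add k1 k2).trans ?_)
  have q : D * (A + D) ≤ (A + D) ^ 2 := by nlinarith
  have q1 := mul_le_mul_of_nonneg_right q
    (show 0 ≤ (l : ℝ) ^ (-α) * √((a + b : ℕ) : ℝ) by positivity)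
  have q2 := mul_le_mul_of_nonneg_right q (show 0 ≤ √(l : ℝ) by positivity)
  have q3 : 0 ≤ (A + D) ^ 2 * ((l : ℝ) ^ (-α) * √((a + b : ℕ) : ℝ)) := by positivity
  have q4 : 0 ≤ (A + D) ^ 2 * √(l : ℝ) := by positivity
  nlinarith

lemma norm_chf_sub_one_le (h : WeakArray μ p α M D m 𝓕 X Xt δ) (hA1 : 1 ≤ A)
    (hA : ∀ (a : ℤ) (L : ℕ), LpBound μ p (blockSum X a L) (A * √L)) (a : ℕ) (θ : ℝ) :
    ‖chf μ X a θ - 1‖ ≤ 2 * θ ^ 2 * (A ^ 2 * a) := by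
  have h2 := h.two_lt
  have hS := hA 0 a
  have mS := hS.1
  have i := hS.integrable (by linarith)
  have i2 := (hS.integrable_sq h2.le).const_mul (2 * θ ^ 2)
  have z : ∫ ω, (((θ * blockSum X 0 a ω : ℝ) : ℂ) * Complex.I) ∂μ = 0 := by
    rw [integral_mul_const, integral_complex_ofReal, integral_const_mul, h.integral_blockSum]
    simp
  have e : chf μ X a θ - 1 = ∫ ω, (eI (θ * blockSum X 0 a ω) - 1 -
      ((θ * blockSum X 0 a ω : ℝ) : ℂ) * Complex.I) ∂μ := by
    have i0 : Integrable (fun ω => eI (θ * blockSum X 0 a ω)) μ := integrable_eI (by fun_prop)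
    have i1 : Integrable (fun ω => eI (θ * blockSum X 0 a ω) - 1) μ := i0.sub (integrable_const _)
    have i3 : Integrable (fun ω => ((θ * blockSum X 0 a ω : ℝ) : ℂ) * Complex.I) μ :=
      ((i.const_mul θ).ofReal (𝕜 := ℂ)).mul_const _
    rw [integral_sub i1 i3, z, integral_sub i0 (integrable_const _)]
    simp [chf]
  rw [e]
  refine norm_integral_le_of_le i2 (fun ω => ?_) ?_
  · exact (norm_eI_sub_linear_le_sq _).trans (le_of_eq (by ring))
  · rw [integral_const_mul]
    gcongr
    refine (hS.integral_sq_le h2.le (by positivity)).trans (le_of_eq ?_)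
    rw [mul_pow, Real.sq_sqrt (Nat.cast_nonneg _)]

lemma joining_error_le {p D G x y s : ℝ} (h2 : 2 < p) (h3 : p ≤ 3) (hD : 1 ≤ D) (hG4 : 4 ≤ G)
    (hDG : 2 * D ≤ G) (x0 : 0 ≤ x) (sl : 1 ≤ y) (s1 : 1 ≤ s) :
    2 * D * x * (G * s) ^ (p - 1) + 3 * D * (G * y) * (G * s) ^ (p - 2) +
      (3 * D) ^ 2 * (G * s) ^ (p - 2) + (3 * D) ^ p ≤ 9 * G ^ 3 * (s ^ (p - 2) * (x * s + y)) := by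
  have hw1 : 1 ≤ s ^ (p - 2) := Real.one_le_rpow s1 (by linarith)
  have G2 : G ^ (p - 1) ≤ G ^ 2 := by
    rw [← Real.rpow_two]; exact Real.rpow_le_rpow_of_exponent_le (by linarith) (by linarith)
  have G1 : G ^ (p - 2) ≤ G := by
    conv_rhs => rw [← Real.rpow_one G]
    exact Real.rpow_le_rpow_of_exponent_le (by linarith) (by linarith)
  have d3 : (3 * D) ^ p ≤ (3 * D) ^ 3 := by
    rw [← Real.rpow_natCast (3 * D) 3]
    exact Real.rpow_le_rpow_of_exponent_le (by linarith) (by exact_mod_cast h3)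
  rw [Real.mul_rpow (by linarith) (by linarith), Real.mul_rpow (by linarith) (by linarith),
    Localization.rpow_sub_one (x := s) (by linarith) h2]
  set w := s ^ (p - 2)
  have t1 : 2 * D * x * (G ^ (p - 1) * (s * w)) ≤ G * x * (G ^ 2 * (s * w)) := by gcongr
  have t2 : 3 * D * (G * y) * (G ^ (p - 2) * w) ≤ (3 / 2 * G) * (G * y) * (G * w) := by
    have : 3 * D ≤ 3 / 2 * G := by linarith
    gcongr
  have t3 : (3 * D) ^ 2 * (G ^ (p - 2) * w) ≤ (9 / 4 * G ^ 2) * (G * w) := by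
    have : (3 * D) ^ 2 ≤ 9 / 4 * G ^ 2 := by nlinarith
    gcongr
  have t4 : (3 * D) ^ 3 ≤ 27 / 8 * G ^ 3 := by
    calc (3 * D) ^ 3 ≤ (3 / 2 * G) ^ 3 := pow_le_pow_left₀ (by linarith) (by linarith) 3
      _ = _ := by ring
  have hwy : w ≤ w * y := le_mul_of_one_le_right (by linarith) sl
  have t5 : G ^ 3 ≤ G ^ 3 * (w * y) := le_mul_of_one_le_right (by positivity) (by linarith)
  have t6 : G ^ 3 * w ≤ G ^ 3 * (w * y) := mul_le_mul_of_nonneg_left hwy (by positivity)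
  have t7 : 0 ≤ G ^ 3 * (w * (x * s)) := by positivity
  have t8 : 0 ≤ G ^ 3 * (w * y) := by positivity
  calc _ ≤ G * x * (G ^ 2 * (s * w)) + (3 / 2 * G) * (G * y) * (G * w) + (9 / 4 * G ^ 2) * (G * w) +
        27 / 8 * G ^ 3 := by linarith
    _ = G ^ 3 * (w * (x * s)) + 3 / 2 * (G ^ 3 * (w * y)) + 9 / 4 * (G ^ 3 * w) + 27 / 8 * G ^ 3 := by
        ring
    _ ≤ 9 * (G ^ 3 * (w * (x * s))) + 9 * (G ^ 3 * (w * y)) := by linarith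
    _ = _ := by ring

/-- The quotient of the two sides is (|θ|s)^{4-p} ≤ 1. -/
lemma pow_four_mul_sq_le {p θ s : ℝ} (h2 : 2 < p) (h3 : p ≤ 3) (s1 : 1 ≤ s) (hθ : |θ| * s ≤ 1) :
    θ ^ 2 * θ ^ 2 * s ^ 2 ≤ |θ| ^ p * s ^ (p - 2) := by
  rcases (abs_nonneg θ).eq_or_lt with h0 | h0
  · have : θ = 0 := by simpa using h0.symm
    rw [this, abs_zero, Real.zero_rpow (by linarith)]; simp
  have e1 : θ ^ 2 * θ ^ 2 * s ^ 2 = |θ| ^ p * (|θ| ^ (4 - p) * (s ^ (4 - p) * s ^ (p - 2))) := by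
    rw [← Real.rpow_add (by linarith), ← mul_assoc, ← Real.rpow_add h0, ← sq_abs,
      show p + (4 - p) = (4 : ℕ) by push_cast; ring, show 4 - p + (p - 2) = (2 : ℕ) by push_cast; ring,
      Real.rpow_natCast, Real.rpow_natCast]
    ring
  rw [e1, ← mul_assoc (|θ| ^ (4 - p)), ← Real.mul_rpow (by positivity) (by linarith)]
  refine mul_le_mul_of_nonneg_left ?_ (by positivity)
  exact mul_le_of_le_one_left (by positivity) (Real.rpow_le_one (by positivity) hθ (by linarith))

lemma joining_cov_error_le {D G x y s : ℝ} (hD : 1 ≤ D) (hG4 : 4 ≤ G)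
    (hDG : 2 * D ≤ G) (x0 : 0 ≤ x) (sl : 1 ≤ y) (s1 : 1 ≤ s) :
    2 * D * x * (G * s) + 3 * D * (G * y) + (3 * D) ^ 2 / 2 ≤ 4 * G ^ 2 * (x * s + y) := by
  have t1 : 2 * D * x * (G * s) ≤ G * x * (G * s) := by gcongr
  have t2 : 3 * D * (G * y) ≤ 3 / 2 * G * (G * y) := by
    have : 3 * D ≤ 3 / 2 * G := by linarith
    gcongr
  have t3 : (3 * D) ^ 2 ≤ 9 / 4 * G ^ 2 := by nlinarith
  have t5 : G ^ 2 ≤ G ^ 2 * y := le_mul_of_one_le_right (by positivity) sl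
  have t7 : 0 ≤ G ^ 2 * (x * s) := by positivity
  have t8 : 0 ≤ G ^ 2 := by positivity
  calc _ ≤ G ^ 2 * (x * s) + 3 / 2 * (G ^ 2 * y) + 9 / 8 * G ^ 2 := by linarith
    _ ≤ 4 * (G ^ 2 * (x * s)) + 4 * (G ^ 2 * y) := by linarith
    _ = _ := by ring

/-- The decomposition of the first-order version, now with the quadratic expansion in both brackets.
The terms E R² cancel to leading order and E R(S_a + T) - E R T = E R S_a remains, which is half of
v_{a+b} - v_a - v_b. The factor ψ_a in front of the second bracket leaves (ψ_a - 1)θ²(E R T + E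
R²/2), of order θ⁴ and absorbed because |θ|√(a+b) ≤ 1. -/
theorem norm_chf_add_sub_mul_add_le (h : WeakArray μ p α M D m 𝓕 X Xt δ) (hA1 : 1 ≤ A)
    (hA : ∀ (a : ℤ) (L : ℕ), LpBound μ p (blockSum X a L) (A * √L)) {a b l : ℕ} (hl : 1 ≤ l)
    (hla : l ≤ a) (hlb : l ≤ b) (θ : ℝ) (hθ : |θ| * √((a + b : ℕ) : ℝ) ≤ 1) :
    ‖chf μ X (a + b) θ - chf μ X a θ * chf μ X b θ +
      (θ ^ 2 * ∫ ω, (blockSum X a b ω - truncSum Xt a b ω) * blockSum X 0 a ω ∂μ : ℝ)‖ ≤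
      1000 * (A + D) ^ 4 * (|θ| ^ p * √((a + b : ℕ) : ℝ) ^ (p - 2) *
        ((l : ℝ) ^ (-α) * √((a + b : ℕ) : ℝ) + √l)) := by
  have h2 := h.two_lt
  have h3 := h.le_three
  have hD := h.one_le_D
  have L1 := h.localization_block hA1 hA hl hla hlb
  have L2 := h.localization_zero hA1 hA hl hlb (a := a)
  have k1 := L1.norm_charFun_add_sub_quadratic_le h2 h3 θ
  have k2 := L2.norm_charFun_add_sub_quadratic_le h2 h3 θ
  have e2 := h.integral_eI_add (h.measurable_past a) (h.measurable_truncSum (a := a) (L := b)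
    subset_rfl) (disjoint_Iic_Ioc _ _ _ le_rfl) θ
  rw [← chf_add_eq, e2] at k1
  rw [← h.chf_eq] at k2
  change ‖_ - chf μ X a θ * _ + _‖ ≤ _ at k1
  have eκ : ∫ ω, (blockSum X a b ω - truncSum Xt a b ω) * blockSum X 0 a ω ∂μ =
      ∫ ω, (blockSum X a b ω - truncSum Xt a b ω) * (blockSum X 0 a ω + truncSum Xt a b ω) ∂μ -
      ∫ ω, (blockSum X a b ω - truncSum Xt a b ω) * truncSum Xt a b ω ∂μ := by
    rw [← integral_sub (L1.bound_R.integrable_mul h2.le L1.bound_U)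
      (L2.bound_R.integrable_mul h2.le L2.bound_U)]
    congr 1; ext ω; ring
  rw [eκ]
  have kT := L2.abs_integral_mul_le h2
  have kR := L2.bound_R.integral_sq_le h2.le (by linarith)
  have kR0 : 0 ≤ ∫ ω, (blockSum X a b ω - truncSum Xt a b ω) ^ 2 ∂μ :=
    integral_nonneg fun _ => sq_nonneg _
  have kψ := h.norm_chf_sub_one_le hA1 hA a θ
  set t := ∫ ω, eI (θ * truncSum Xt a b ω) ∂μ
  set RU := ∫ ω, (blockSum X a b ω - truncSum Xt a b ω) *
    (blockSum X 0 a ω + truncSum Xt a b ω) ∂μ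
  set RT := ∫ ω, (blockSum X a b ω - truncSum Xt a b ω) * truncSum Xt a b ω ∂μ
  set R2 := ∫ ω, (blockSum X a b ω - truncSum Xt a b ω) ^ 2 ∂μ
  have k3 : ‖chf μ X a θ‖ ≤ 1 := norm_integral_eI_le _
  have e : chf μ X (a + b) θ - chf μ X a θ * chf μ X b θ + (θ ^ 2 * (RU - RT) : ℝ) =
      (chf μ X (a + b) θ - chf μ X a θ * t + (θ ^ 2 * (RU + R2 / 2) : ℝ)) -
      chf μ X a θ * (chf μ X b θ - t + (θ ^ 2 * (RT + R2 / 2) : ℝ)) +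
      (chf μ X a θ - 1) * (θ ^ 2 * (RT + R2 / 2) : ℝ) := by push_cast; ring
  rw [e]
  set s := √((a + b : ℕ) : ℝ) with hs
  set x := (l : ℝ) ^ (-α) with hx
  set G := 2 * (A + D) with hG
  have hG4 : 4 ≤ G := by linarith
  have x0 : 0 ≤ x := by positivity
  have s1 : 1 ≤ s := Real.one_le_sqrt.2 (by exact_mod_cast (by omega))
  have sl : (1 : ℝ) ≤ √l := Real.one_le_sqrt.2 (by exact_mod_cast hl)
  have hw1 : 1 ≤ s ^ (p - 2) := Real.one_le_rpow s1 (by linarith)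
  set w := s ^ (p - 2) with hw
  have main := joining_error_le (y := √l) h2 h3 hD hG4 (by linarith) x0 sl s1
  rw [← hw] at main
  have hθw := pow_four_mul_sq_le h2 h3 s1 hθ
  rw [← hw] at hθw
  have last : ‖(chf μ X a θ - 1) * ((θ ^ 2 * (RT + R2 / 2) : ℝ) : ℂ)‖ ≤
      2 * G ^ 4 * (|θ| ^ p * w * (x * s + √l)) := by
    rw [norm_mul, Complex.norm_real, Real.norm_eq_abs, abs_mul, abs_of_nonneg (sq_nonneg θ)]
    have r1 : |RT + R2 / 2| ≤ 4 * G ^ 2 * (x * s + √l) := by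
      refine (abs_add_le _ _).trans ?_
      rw [abs_of_nonneg (show 0 ≤ R2 / 2 by linarith)]
      linarith [joining_cov_error_le (y := √l) hD hG4 (by linarith) x0 sl s1]
    have r2 : ‖chf μ X a θ - 1‖ ≤ 2 * θ ^ 2 * (G ^ 2 / 4 * s ^ 2) := by
      refine kψ.trans ?_
      have : (a : ℝ) ≤ s ^ 2 := by
        rw [hs, Real.sq_sqrt (Nat.cast_nonneg _)]; exact_mod_cast (by omega)
      have hAG : A ^ 2 ≤ G ^ 2 / 4 := by rw [hG]; nlinarith
      gcongr
    calc _ ≤ 2 * θ ^ 2 * (G ^ 2 / 4 * s ^ 2) * (θ ^ 2 * (4 * G ^ 2 * (x * s + √l))) := by gcongr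
      _ = 2 * G ^ 4 * (θ ^ 2 * θ ^ 2 * s ^ 2 * (x * s + √l)) := by ring
      _ ≤ _ := by gcongr
  have k4 : ‖chf μ X a θ * (chf μ X b θ - t + (θ ^ 2 * (RT + R2 / 2) : ℝ))‖ ≤
      ‖chf μ X b θ - t + (θ ^ 2 * (RT + R2 / 2) : ℝ)‖ := by
    rw [norm_mul]
    exact mul_le_of_le_one_left (norm_nonneg _) k3
  have k5 := k4.trans k2
  set Q := |θ| ^ p * (w * (x * s + √l)) with hQ
  have hQ0 : 0 ≤ Q := by positivity
  have m1 := mul_le_mul_of_nonneg_left main (show 0 ≤ 12 * |θ| ^ p by positivity)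
  have m2 : G ^ 3 * Q ≤ G ^ 4 / 4 * Q := by
    refine mul_le_mul_of_nonneg_right ?_ hQ0
    have := mul_le_mul_of_nonneg_left hG4 (show 0 ≤ G ^ 3 by positivity)
    calc G ^ 3 = G ^ 3 * 4 / 4 := by ring
      _ ≤ G ^ 3 * G / 4 := by linarith
      _ = _ := by ring
  have m3 : G ^ 4 * Q = 16 * ((A + D) ^ 4 * Q) := by rw [hG]; ring
  have m4 : 0 ≤ (A + D) ^ 4 * Q := by positivity
  have last' : ‖(chf μ X a θ - 1) * ((θ ^ 2 * (RT + R2 / 2) : ℝ) : ℂ)‖ ≤ 2 * G ^ 4 * Q := by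
    rw [hQ, ← mul_assoc (|θ| ^ p)]; exact last
  have m5 : 12 * |θ| ^ p * (9 * G ^ 3 * (w * (x * s + √l))) = 108 * (G ^ 3 * Q) := by
    rw [hQ]; ring
  refine ((norm_add_le _ _).trans (add_le_add ((norm_sub_le _ _).trans (add_le_add k1 k5)) last')).trans ?_
  rw [mul_assoc (|θ| ^ p) w, ← hQ]
  linarith

end WeakArray
end WeakDep

namespace WeakDep

set_option linter.unusedSectionVars false

namespace WeakArray
variable {Ω : Type u} [mΩ : MeasurableSpace Ω] {μ : Measure Ω} {p α M D : ℝ} {m : ℕ}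
  {𝓕 : Set ℤ → MeasurableSpace Ω} {X : ℤ → Ω → ℝ} {Xt : ℕ → ℤ → Ω → ℝ} {δ : ℕ → ℝ}
  [IsProbabilityMeasure μ]

/-! ### High frequencies -/

/-- Induction peeling off three blocks Y₁, Y₂, Y₃ of length L ≥ m at a time. W gathers the factors
already treated and depends on innovations after the peeled blocks minus L only. Replacing Y₁ + Y₂
by truncated sums T₁ + T₂ makes exp(iθT₁) independent of everything else, because Y₃ does not reach
back beyond a + L; this yields the factor |ψ_L| + D|θ|. The replacement error G is independent of W,
since Y₃ separates them, so ‖GW‖₂ = ‖G‖₂‖W‖₂ contributes 2D|θ|. Measuring W in L² makes the loss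
multiplicative. -/
lemma norm_integral_eI_mul_le (h : WeakArray μ p α M D m 𝓕 X Xt δ) {L : ℕ} (hmL : m ≤ L) (θ : ℝ)
    (a₀ j : ℕ) (W : Ω → ℂ) (hW : Measurable[𝓕 (Set.Ioi (((a₀ + j * (3 * L) : ℕ) : ℤ) - L))] W)
    (hB : ∃ B : ℝ, ∀ ω, ‖W ω‖ ≤ B) :
    ‖∫ ω, eI (θ * blockSum X 0 (a₀ + j * (3 * L)) ω) * W ω ∂μ‖ ≤
      (‖chf μ X L θ‖ + 3 * D * |θ|) ^ j * √(∫ ω, ‖W ω‖ ^ 2 ∂μ) := by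
  have h2 := h.two_lt
  have hD := h.one_le_D
  set κ := ‖chf μ X L θ‖ + 3 * D * |θ| with hκ
  have κ0 : 0 ≤ κ := by positivity
  induction j generalizing W with
  | zero =>
    obtain ⟨B, hB⟩ := hB
    have mW : Measurable W := hW.mono (h.le _) le_rfl
    have i2 : Integrable (fun ω => ‖W ω‖ ^ 2) μ :=
      Integrable.of_bound (by fun_prop) (B ^ 2) (Filter.Eventually.of_forall fun ω => by
        rw [Real.norm_of_nonneg (by positivity)]; gcongr; exact hB ω)
    have hb : LpBound μ 2 (fun ω => ‖W ω‖) (√(∫ ω, ‖W ω‖ ^ 2 ∂μ)) := by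
      refine LpBound.of_integral_rpow_le two_pos (Real.sqrt_nonneg _) (by fun_prop)
        (by simpa using i2) ?_
      rw [Real.rpow_two, Real.sq_sqrt (integral_nonneg fun _ => by positivity)]
      simp
    rw [pow_zero, one_mul]
    refine norm_integral_le_of_le (hb.integrable (by norm_num)) (fun ω => ?_) ?_
    · rw [norm_mul, norm_eI, one_mul]
    · simpa using hb.integral_abs_le (by norm_num) (Real.sqrt_nonneg _)
  | succ j ih =>
    set a : ℕ := a₀ + j * (3 * L) with ha
    have ha' : a₀ + (j + 1) * (3 * L) = a + L + L + L := by rw [ha]; ring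
    rw [ha'] at hW ⊢
    set Y₁ := blockSum X a L with hY₁
    set Y₂ := blockSum X ((a + L : ℕ) : ℤ) L with hY₂
    set Y₃ := blockSum X ((a + L + L : ℕ) : ℤ) L with hY₃
    set T₁ := truncSum Xt a L with hT₁
    set T₂ := truncSum Xt ((a + L : ℕ) : ℤ) L with hT₂
    have hS : ∀ ω, blockSum X 0 (a + L + L + L) ω = blockSum X 0 a ω + Y₁ ω + Y₂ ω + Y₃ ω := by
      intro ω
      simp only [blockSum_add, zero_add, hY₁, hY₂, hY₃]
    obtain ⟨B, hB⟩ := hB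
    have hB0 : 0 ≤ B := by
      obtain ⟨ω⟩ : Nonempty Ω := μ.nonempty_of_neZero
      exact (norm_nonneg _).trans (hB ω)
    -- measurability with respect to the innovations involved
    have mY₁ : Measurable[𝓕 (Set.Ioc ((a : ℤ) - L) (a + L + L))] Y₁ :=
      h.measurable_blockSum fun x hx => by simp at hx ⊢; omega
    have mY₂ : Measurable[𝓕 (Set.Ioc ((a : ℤ) - L) (a + L + L))] Y₂ :=
      h.measurable_blockSum fun x hx => by simp at hx ⊢; omega
    have mT₁' : Measurable[𝓕 (Set.Ioc ((a : ℤ) - L) (a + L + L))] T₁ :=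
      h.measurable_truncSum fun x hx => by simp at hx ⊢; omega
    have mT₂' : Measurable[𝓕 (Set.Ioc ((a : ℤ) - L) (a + L + L))] T₂ :=
      h.measurable_truncSum fun x hx => by simp at hx ⊢; omega
    have mT₁ : Measurable[𝓕 (Set.Ioc (a : ℤ) (a + L))] T₁ := h.measurable_truncSum subset_rfl
    have mT₂ : Measurable[𝓕 (Set.Ioi ((a : ℤ) + L))] T₂ :=
      h.measurable_truncSum fun x hx => by simp at hx ⊢; omega
    have mY₃ : Measurable[𝓕 (Set.Ioi ((a : ℤ) + L))] Y₃ :=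
      h.measurable_blockSum fun x hx => by simp at hx ⊢; omega
    have mWbig : Measurable[𝓕 (Set.Ioi ((a : ℤ) + L + L))] W :=
      hW.mono (h.mono _ _ fun x hx => by simp at hx ⊢; omega) le_rfl
    have mW' : Measurable[𝓕 (Set.Ioi ((a : ℤ) + L))] W :=
      mWbig.mono (h.mono _ _ fun x hx => by simp at hx ⊢; omega) le_rfl
    set G : Ω → ℂ := fun ω => eI (θ * (Y₁ ω + Y₂ ω)) - eI (θ * (T₁ ω + T₂ ω)) with hG
    have mG : Measurable[𝓕 (Set.Ioc ((a : ℤ) - L) (a + L + L))] G :=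
      (measurable_eI.comp ((mY₁.add mY₂).const_mul θ)).sub
        (measurable_eI.comp ((mT₁'.add mT₂').const_mul θ))
    set V : Ω → ℂ := fun ω => eI (θ * T₂ ω) * (eI (θ * Y₃ ω) * W ω) with hV
    have mV : Measurable[𝓕 (Set.Ioi ((a : ℤ) + L))] V :=
      (measurable_eI.comp (mT₂.const_mul θ)).mul ((measurable_eI.comp (mY₃.const_mul θ)).mul mW')
    -- V and V' are the new future factors. G reaches back L steps before a, which is why the
    -- hypothesis on W allows this overlap.
    set V' : Ω → ℂ := fun ω => G ω * (eI (θ * Y₃ ω) * W ω) with hV'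
    have mV' : Measurable[𝓕 (Set.Ioi ((a : ℤ) - L))] V' :=
      (mG.mono (h.mono _ _ fun x hx => by simp at hx ⊢; omega) le_rfl).mul
        (((measurable_eI.comp (mY₃.const_mul θ)).mul mW').mono
          (h.mono _ _ fun x hx => by simp at hx ⊢; omega) le_rfl)
    have nV : ∀ ω, ‖V ω‖ = ‖W ω‖ := fun ω => by simp [hV, norm_eI]
    have nV' : ∀ ω, ‖V' ω‖ = ‖G ω‖ * ‖W ω‖ := fun ω => by simp [hV', norm_eI]
    have nG : ∀ ω, ‖G ω‖ ≤ 2 := fun ω =>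
      (norm_sub_le _ _).trans (by rw [norm_eI, norm_eI]; norm_num)
    have gW : Measurable W := mW'.mono (h.le _) le_rfl
    have gG : Measurable G := mG.mono (h.le _) le_rfl
    have gV : Measurable V := mV.mono (h.le _) le_rfl
    have gV' : Measurable V' := mV'.mono (h.le _) le_rfl
    have gT₁ : Measurable T₁ := h.measurable_trunc _ _
    have gS : Measurable (blockSum X 0 a) := h.measurable_block _ _
    have ih1 := ih V (mV.mono (h.mono _ _ fun x hx => by simp at hx ⊢; omega) le_rfl)
      ⟨B, fun ω => by rw [nV]; exact hB ω⟩
    have ih2 := ih V' mV' ⟨2 * B, fun ω => by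
      rw [nV']; exact mul_le_mul (nG ω) (hB ω) (norm_nonneg _) (by norm_num)⟩
    simp only [nV] at ih1
    -- the term with `T₁` factorizes
    have hind : IndepFun (fun ω => eI (θ * T₁ ω)) (fun ω => eI (θ * blockSum X 0 a ω) * V ω) μ := by
      refine h.indepFun (A := Set.Ioc (a : ℤ) (a + L)) (B := Set.Iic (a : ℤ) ∪ Set.Ioi ((a : ℤ) + L))
        (measurable_eI.comp (mT₁.const_mul θ)) ?_ ?_
      · exact ((measurable_eI.comp ((h.measurable_past a).const_mul θ)).mono
          (h.mono _ _ Set.subset_union_left) le_rfl).mul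
          (mV.mono (h.mono _ _ Set.subset_union_right) le_rfl)
      · rw [Set.disjoint_left]; intro x hx hy; simp at hx hy; omega
    have e1 : ∫ ω, eI (θ * T₁ ω) * (eI (θ * blockSum X 0 a ω) * V ω) ∂μ =
        (∫ ω, eI (θ * T₁ ω) ∂μ) * ∫ ω, eI (θ * blockSum X 0 a ω) * V ω ∂μ :=
      hind.integral_fun_mul_eq_mul_integral (by fun_prop) (by fun_prop)
    have i1 : Integrable (fun ω => eI (θ * T₁ ω) * (eI (θ * blockSum X 0 a ω) * V ω)) μ :=
      integrable_of_norm_le (by fun_prop) (integrable_const B) fun ω => by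
        simpa [norm_eI, nV] using hB ω
    have i2 : Integrable (fun ω => eI (θ * blockSum X 0 a ω) * V' ω) μ :=
      integrable_of_norm_le (by fun_prop) (integrable_const (2 * B)) fun ω => by
        rw [norm_mul, norm_eI, one_mul, nV']
        exact mul_le_mul (nG ω) (hB ω) (norm_nonneg _) (by norm_num)
    have e : ∫ ω, eI (θ * blockSum X 0 (a + L + L + L) ω) * W ω ∂μ =
        ∫ ω, eI (θ * T₁ ω) * (eI (θ * blockSum X 0 a ω) * V ω) ∂μ +
        ∫ ω, eI (θ * blockSum X 0 a ω) * V' ω ∂μ := by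
      rw [← integral_add i1 i2]
      congr 1; ext ω
      rw [hS, hV, hV', hG]
      simp only [mul_add, eI_add]
      ring
    -- size of the factors
    have kT : ‖∫ ω, eI (θ * T₁ ω) ∂μ‖ ≤ ‖chf μ X L θ‖ + |θ| * D := by
      have k := h.norm_integral_eI_sub_le (h.measurable_block a L) gT₁ (by linarith)
        (h.remainder_bound a L) θ
      rw [h.integral_eI_blockSum] at k
      have := norm_sub_norm_le (∫ ω, eI (θ * T₁ ω) ∂μ) (chf μ X L θ)
      rw [norm_sub_rev] at this
      linarith
    have hR : LpBound μ p (fun ω => (Y₁ ω - T₁ ω) + (Y₂ ω - T₂ ω)) (D + D) :=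
      (h.remainder_bound a L).add (by linarith) (by linarith) (by linarith)
        (h.remainder_bound _ L)
    have kG : ∫ ω, ‖G ω‖ ^ 2 ∂μ ≤ (2 * D * |θ|) ^ 2 := by
      have iR := (hR.integrable_sq h2.le).const_mul (θ ^ 2)
      calc ∫ ω, ‖G ω‖ ^ 2 ∂μ ≤ ∫ ω, θ ^ 2 * ((Y₁ ω - T₁ ω) + (Y₂ ω - T₂ ω)) ^ 2 ∂μ := by
            refine integral_mono_of_nonneg (Filter.Eventually.of_forall fun _ => by positivity) iR
              (Filter.Eventually.of_forall fun ω => ?_)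
            have := norm_eI_sub_eI_le (θ * (Y₁ ω + Y₂ ω)) (θ * (T₁ ω + T₂ ω))
            calc ‖G ω‖ ^ 2 ≤ |θ * (Y₁ ω + Y₂ ω) - θ * (T₁ ω + T₂ ω)| ^ 2 := by gcongr
              _ = _ := by rw [sq_abs]; ring
        _ ≤ θ ^ 2 * (D + D) ^ 2 := by
            rw [integral_const_mul]; gcongr; exact hR.integral_sq_le h2.le (by linarith)
        _ = _ := by rw [mul_pow, sq_abs]; ring
    have kV' : √(∫ ω, ‖V' ω‖ ^ 2 ∂μ) ≤ 2 * D * |θ| * √(∫ ω, ‖W ω‖ ^ 2 ∂μ) := by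
      have hi : IndepFun (fun ω => ‖G ω‖ ^ 2) (fun ω => ‖W ω‖ ^ 2) μ :=
        (h.indepFun mG mWbig (by
          rw [Set.disjoint_left]; intro x hx hy; simp at hx hy; omega)).comp
          (φ := fun z => ‖z‖ ^ 2) (ψ := fun z => ‖z‖ ^ 2) (by fun_prop) (by fun_prop)
      have : ∫ ω, ‖V' ω‖ ^ 2 ∂μ = (∫ ω, ‖G ω‖ ^ 2 ∂μ) * ∫ ω, ‖W ω‖ ^ 2 ∂μ := by
        rw [← hi.integral_fun_mul_eq_mul_integral (by fun_prop) (by fun_prop)]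
        congr 1; ext ω; rw [nV', mul_pow]
      rw [this, Real.sqrt_mul (integral_nonneg fun _ => by positivity)]
      gcongr
      rw [← Real.sqrt_sq (show 0 ≤ 2 * D * |θ| by positivity)]
      exact Real.sqrt_le_sqrt kG
    rw [e, e1]
    set w := √(∫ ω, ‖W ω‖ ^ 2 ∂μ) with hw
    have w0 : 0 ≤ w := Real.sqrt_nonneg _
    calc _ ≤ (‖chf μ X L θ‖ + |θ| * D) * (κ ^ j * w) + κ ^ j * (2 * D * |θ| * w) := by
          refine (norm_add_le _ _).trans (add_le_add ?_ (ih2.trans ?_))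
          · rw [norm_mul]
            exact mul_le_mul kT ih1 (norm_nonneg _) (by positivity)
          · exact mul_le_mul_of_nonneg_left kV' (by positivity)
      _ = _ := by rw [pow_succ, hκ]; ring

/-- Start from W = 1 and leave the residue of n modulo 3L as the initial segment. -/
theorem norm_chf_le_pow (h : WeakArray μ p α M D m 𝓕 X Xt δ) {L : ℕ} (hmL : m ≤ L) (θ : ℝ)
    (n : ℕ) : ‖chf μ X n θ‖ ≤ (‖chf μ X L θ‖ + 3 * D * |θ|) ^ (n / (3 * L)) := by
  have := h.norm_integral_eI_mul_le hmL θ (n % (3 * L)) (n / (3 * L)) (fun _ => 1)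
    measurable_const ⟨1, fun _ => by simp⟩
  rw [mul_comm (n / (3 * L)), Nat.mod_add_div] at this
  simpa [chf] using this

end WeakArray
end WeakDep

/-! ### Gaussian approximation at low frequencies by repeated halving -/

namespace WeakDep

/-- Quantitative information on a family of characteristic functions `ψ L` with variances `v L`,
namely how they behave when blocks are joined. -/
structure CharData (p α C c₀ : ℝ) (L₀ m : ℕ) (ψ : ℕ → ℝ → ℂ) (v : ℕ → ℝ) : Prop where
  norm_le : ∀ L θ, ‖ψ L θ‖ ≤ 1
  crude : ∀ a b θ, ‖ψ (a + b) θ - ψ a θ * ψ b θ‖ ≤ C * |θ|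
  join : ∀ a b l : ℕ, ∀ θ : ℝ, 1 ≤ l → l ≤ a → l ≤ b →
    ‖ψ (a + b) θ - ψ a θ * ψ b θ‖ ≤ C * (|θ| * (l : ℝ) ^ (-α) + θ ^ 2 * √l)
  quad : ∀ a b l : ℕ, ∀ θ : ℝ, 1 ≤ l → l ≤ a → l ≤ b → |θ| * √((a + b : ℕ) : ℝ) ≤ 1 →
    ‖ψ (a + b) θ - ψ a θ * ψ b θ + ((θ ^ 2 * ((v (a + b) - v a - v b) / 2) : ℝ) : ℂ)‖ ≤
      C * (|θ| ^ p * √((a + b : ℕ) : ℝ) ^ (p - 2) *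
        ((l : ℝ) ^ (-α) * √((a + b : ℕ) : ℝ) + √l))
  cov : ∀ a b l : ℕ, 1 ≤ l → l ≤ a → l ≤ b →
    |v (a + b) - v a - v b| ≤ C * ((l : ℝ) ^ (-α) * √((a + b : ℕ) : ℝ) + √l)
  v_nonneg : ∀ L, 0 ≤ v L
  v_le : ∀ L, v L ≤ C * L
  v_ge : ∀ L, L₀ ≤ L → c₀ * L ≤ v L
  base : ∀ θ : ℝ, |θ| ≤ 1 → ‖ψ 1 θ - (Real.exp (-(v 1 * θ ^ 2 / 2)) : ℝ)‖ ≤ C * |θ| ^ p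
  high : ∀ (L n : ℕ) (θ : ℝ), m ≤ L → ‖ψ n θ‖ ≤ (‖ψ L θ‖ + C * |θ|) ^ (n / (3 * L))

lemma abs_exp_neg_sub_sub_le {x z : ℝ} (hx : 0 ≤ x) (hz : 0 ≤ z) :
    |Real.exp (-x) - Real.exp (-z) - (z - x)| ≤ |z - x| * max x z := by
  wlog h : x ≤ z generalizing x z
  · have := this hz hx (by linarith)
    rw [abs_sub_comm z x, max_comm, ← abs_neg]
    convert this using 2; ring
  rw [max_eq_right h, abs_of_nonneg (sub_nonneg.2 h), abs_le]
  have e1 : Real.exp (-x) = Real.exp (-z) * Real.exp (z - x) := by rw [← Real.exp_add]; ring_nf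
  have e2 : Real.exp (-z) = Real.exp (-x) * Real.exp (-(z - x)) := by rw [← Real.exp_add]; ring_nf
  constructor
  · have h1 := Real.add_one_le_exp (z - x)
    have h2 := Real.add_one_le_exp (-z)
    have h3 := Real.exp_pos (-z)
    have : Real.exp (-z) * (z - x + 1) ≤ Real.exp (-x) := by rw [e1]; gcongr
    nlinarith
  · have h1 := Real.add_one_le_exp (-(z - x))
    have h2 : Real.exp (-x) ≤ 1 := Real.exp_le_one_iff.2 (by linarith)
    have h3 := Real.exp_pos (-x)
    have : Real.exp (-x) * (-(z - x) + 1) ≤ Real.exp (-z) := by rw [e2]; gcongr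
    have : 0 ≤ (z - x) * z := by apply mul_nonneg <;> linarith
    nlinarith

lemma nat_sqrt_bounds {α : ℝ} (hα : 0 < α) (hα2 : α ≤ 1 / 2) {n : ℕ} (hn : 1 ≤ n) :
    1 ≤ Nat.sqrt n ∧ ((Nat.sqrt n : ℕ) : ℝ) ^ (-α) ≤ 2 * (n : ℝ) ^ (-(α / 2)) ∧
    √((Nat.sqrt n : ℕ) : ℝ) ≤ (n : ℝ) ^ (1 / 4 : ℝ) := by
  have hn0 : (0 : ℝ) < n := by exact_mod_cast hn
  have h1 : 1 ≤ Nat.sqrt n := Nat.sqrt_pos.2 hn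
  have h2 : (Nat.sqrt n : ℝ) ≤ √n := Real.nat_sqrt_le_real_sqrt
  refine ⟨h1, ?_, ?_⟩
  · have h3 : √(n : ℝ) / 2 ≤ (Nat.sqrt n : ℝ) := by
      have := Real.real_sqrt_le_nat_sqrt_succ (a := n)
      have : (1 : ℝ) ≤ Nat.sqrt n := by exact_mod_cast h1
      linarith
    calc ((Nat.sqrt n : ℕ) : ℝ) ^ (-α) ≤ (√(n : ℝ) / 2) ^ (-α) :=
          Real.rpow_le_rpow_of_nonpos (by positivity) h3 (by linarith)
      _ = (n : ℝ) ^ (-(α / 2)) * 2 ^ α := by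
          rw [Real.div_rpow (by positivity) (by norm_num), Real.sqrt_eq_rpow, ← Real.rpow_mul hn0.le,
            Real.rpow_neg (by norm_num : (0 : ℝ) ≤ 2), div_inv_eq_mul]
          congr 2; ring
      _ ≤ (n : ℝ) ^ (-(α / 2)) * 2 ^ (1 : ℝ) := by
          gcongr
          · norm_num
          · linarith
      _ = _ := by rw [Real.rpow_one]; ring
  · calc √((Nat.sqrt n : ℕ) : ℝ) ≤ √(√n) := Real.sqrt_le_sqrt h2
      _ = _ := by
        rw [Real.sqrt_eq_rpow, Real.sqrt_eq_rpow, ← Real.rpow_mul hn0.le]; norm_num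

/-- The localisation width l = √n is small enough for √l and large enough for l^{-α}√n to gain a
power of n; α ≤ 1/2 makes the second term dominant. -/
lemma nat_sqrt_error_le {α : ℝ} (hα : 0 < α) (hα2 : α ≤ 1 / 2) {n : ℕ} (hn : 1 ≤ n) :
    ((Nat.sqrt n : ℕ) : ℝ) ^ (-α) * √n + √((Nat.sqrt n : ℕ) : ℝ) ≤
      3 * (n : ℝ) ^ (1 / 2 - α / 2) := by
  obtain ⟨-, h1, h2⟩ := nat_sqrt_bounds hα hα2 hn
  have hn1 : (1 : ℝ) ≤ n := by exact_mod_cast hn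
  have hn0 : (0 : ℝ) < n := by linarith
  have h3 : (n : ℝ) ^ (1 / 4 : ℝ) ≤ (n : ℝ) ^ (1 / 2 - α / 2) :=
    Real.rpow_le_rpow_of_exponent_le hn1 (by linarith)
  have h4 : (n : ℝ) ^ (-(α / 2)) * √n = (n : ℝ) ^ (1 / 2 - α / 2) := by
    rw [Real.sqrt_eq_rpow, ← Real.rpow_add hn0]; congr 1; ring
  calc _ ≤ 2 * (n : ℝ) ^ (-(α / 2)) * √n + (n : ℝ) ^ (1 / 4 : ℝ) := by gcongr
    _ ≤ _ := by rw [mul_assoc, h4]; linarith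

lemma nat_sqrt_le_half {L : ℕ} (hL : 2 ≤ L) : Nat.sqrt L ≤ L / 2 := by
  have h := Nat.sqrt_le L
  rw [Nat.le_div_iff_mul_le two_pos]
  rcases Nat.lt_or_ge (Nat.sqrt L) 2 with h1 | h1
  · omega
  · nlinarith

/-- By concavity, splitting L into comparable parts increases the sum of the powers x^{1-η} by a
factor above 1. This absorbs sublinear errors in a halving recursion. -/
lemma rpow_add_rpow_ge {η : ℝ} (hη : 0 < η) {a b L : ℝ} (ha : 0 < a) (hb : 0 < b)
    (hab : a + b = L) (haL : a ≤ 2 / 3 * L) (hbL : b ≤ 2 / 3 * L) :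
    (3 / 2 : ℝ) ^ η * L ^ (1 - η) ≤ a ^ (1 - η) + b ^ (1 - η) := by
  have hL : 0 < L := by linarith
  have key : ∀ x : ℝ, 0 < x → x ≤ 2 / 3 * L → x * ((3 / 2 : ℝ) ^ η * L ^ (-η)) ≤ x ^ (1 - η) := by
    intro x hx hxL
    rw [show (1 : ℝ) - η = 1 + -η by ring, Real.rpow_add hx, Real.rpow_one]
    gcongr
    calc (3 / 2 : ℝ) ^ η * L ^ (-η) = (2 / 3 * L) ^ (-η) := by
          rw [Real.mul_rpow (by norm_num) hL.le, Real.rpow_neg (by norm_num : (0 : ℝ) ≤ 2 / 3),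
            ← Real.inv_rpow (by norm_num)]
          norm_num
      _ ≤ x ^ (-η) := Real.rpow_le_rpow_of_nonpos hx hxL (by linarith)
  have e : (3 / 2 : ℝ) ^ η * L ^ (1 - η) = a * ((3 / 2 : ℝ) ^ η * L ^ (-η)) +
      b * ((3 / 2 : ℝ) ^ η * L ^ (-η)) := by
    rw [← add_mul, hab, show (1 : ℝ) - η = 1 + -η by ring, Real.rpow_add hL, Real.rpow_one]; ring
  rw [e]
  exact add_le_add (key a ha haL) (key b hb hbL)

namespace CharData
variable {p α C c₀ : ℝ} {L₀ m : ℕ} {ψ : ℕ → ℝ → ℂ} {v : ℕ → ℝ}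

/-- The quadratic correction in `quad` equals z - x, the difference of the Gaussian exponents of the
joined block and of the product; replacing exp(-x) by exp(-z) produces the same term up to |z - x|
max(x, z). With l = √L the two errors are at most 3C and 2C² times |θ|^p L^{1-α/2}. -/
lemma gauss_step (h : CharData p α C c₀ L₀ m ψ v) (h2 : 2 < p) (h3 : p ≤ 3) (hα : 0 < α)
    (hα2 : α ≤ 1 / 2) (hC : 1 ≤ C) {a b : ℕ} (hab : 2 ≤ a + b) (ha : (a + b) / 2 ≤ a)
    (hb : (a + b) / 2 ≤ b) (θ : ℝ) (hθ : |θ| * √((a + b : ℕ) : ℝ) ≤ 1) :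
    ‖ψ (a + b) θ - (Real.exp (-(v (a + b) * θ ^ 2 / 2)) : ℝ)‖ ≤
      ‖ψ a θ - (Real.exp (-(v a * θ ^ 2 / 2)) : ℝ)‖ +
      ‖ψ b θ - (Real.exp (-(v b * θ ^ 2 / 2)) : ℝ)‖ +
      5 * C ^ 2 * (|θ| ^ p * ((a + b : ℕ) : ℝ) ^ (1 - α / 2)) := by
  set L := a + b with hL
  have hL1 : (1 : ℝ) ≤ (L : ℝ) := by exact_mod_cast (by omega)
  have hL0 : (0 : ℝ) < (L : ℝ) := by linarith
  have s1 : 1 ≤ √(L : ℝ) := Real.one_le_sqrt.2 hL1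
  have hl := nat_sqrt_le_half hab
  obtain ⟨l1, -, -⟩ := nat_sqrt_bounds hα hα2 (show 1 ≤ L by omega)
  have herr := nat_sqrt_error_le hα hα2 (show 1 ≤ L by omega)
  have q := h.quad a b _ θ l1 (by omega) (by omega) hθ
  have c := h.cov a b _ l1 (by omega) (by omega)
  rw [← hL] at q c
  set κ := (v L - v a - v b) / 2 with hκ
  set X := (L : ℝ) ^ (1 / 2 - α / 2) with hX
  have hX0 : 0 ≤ X := by positivity
  set w := √(L : ℝ) ^ (p - 2) with hw
  have w0 : 0 ≤ w := by positivity
  have wX : w * X ≤ (L : ℝ) ^ (1 - α / 2) := by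
    have hw1 : w ≤ √(L : ℝ) ^ (1 : ℝ) := Real.rpow_le_rpow_of_exponent_le s1 (by linarith)
    calc w * X ≤ √(L : ℝ) ^ (1 : ℝ) * X := by gcongr
      _ = _ := by
        rw [Real.rpow_one, Real.sqrt_eq_rpow, hX, ← Real.rpow_add hL0]; congr 1; ring
  have t1 : ‖ψ L θ - ψ a θ * ψ b θ + ((θ ^ 2 * κ : ℝ) : ℂ)‖ ≤
      3 * C * (|θ| ^ p * (L : ℝ) ^ (1 - α / 2)) := by
    calc _ ≤ C * (|θ| ^ p * w * (3 * X)) := q.trans (by gcongr)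
      _ = 3 * C * (|θ| ^ p * (w * X)) := by ring
      _ ≤ _ := by gcongr
  have hκ' : |κ| ≤ 3 / 2 * C * X := by
    rw [hκ, abs_div, abs_two]
    have : C * (((Nat.sqrt L : ℕ) : ℝ) ^ (-α) * √L + √((Nat.sqrt L : ℕ) : ℝ)) ≤ C * (3 * X) := by
      gcongr
    linarith
  -- the Gaussian part
  set x := (v a + v b) * θ ^ 2 / 2 with hx
  set z := v L * θ ^ 2 / 2 with hz
  have hx0 : 0 ≤ x := by
    have := h.v_nonneg a; have := h.v_nonneg b; positivity
  have hz0 : 0 ≤ z := by have := h.v_nonneg L; positivity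
  have hzx : z - x = θ ^ 2 * κ := by rw [hz, hx, hκ]; ring
  have hmax : max x z ≤ C * L * θ ^ 2 / 2 := by
    refine max_le ?_ ?_
    · have : v a + v b ≤ C * L := by
        have := h.v_le a; have := h.v_le b; rw [hL]; push_cast; linarith
      rw [hx]; gcongr
    · rw [hz]; gcongr; exact h.v_le L
  have hθw := WeakArray.pow_four_mul_sq_le h2 h3 s1 hθ
  rw [Real.sq_sqrt hL0.le, ← hw] at hθw
  have t3 : |Real.exp (-x) - Real.exp (-z) - (z - x)| ≤
      2 * C ^ 2 * (|θ| ^ p * (L : ℝ) ^ (1 - α / 2)) := by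
    refine (abs_exp_neg_sub_sub_le hx0 hz0).trans ?_
    rw [hzx, abs_mul, abs_of_nonneg (sq_nonneg θ)]
    calc θ ^ 2 * |κ| * max x z ≤ θ ^ 2 * (3 / 2 * C * X) * (C * L * θ ^ 2 / 2) := by gcongr
      _ = 3 / 4 * C ^ 2 * ((θ ^ 2 * θ ^ 2 * L) * X) := by ring
      _ ≤ 3 / 4 * C ^ 2 * ((|θ| ^ p * w) * X) := by gcongr
      _ = 3 / 4 * C ^ 2 * (|θ| ^ p * (w * X)) := by ring
      _ ≤ 2 * C ^ 2 * (|θ| ^ p * (L : ℝ) ^ (1 - α / 2)) := by gcongr; norm_num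
  set ga := Real.exp (-(v a * θ ^ 2 / 2)) with hga
  set gb := Real.exp (-(v b * θ ^ 2 / 2)) with hgb
  have hgab : Real.exp (-x) = ga * gb := by rw [hga, hgb, ← Real.exp_add, hx]; ring_nf
  have hga1 : ‖(ga : ℂ)‖ ≤ 1 := by
    rw [Complex.norm_real, Real.norm_of_nonneg (Real.exp_pos _).le]
    exact Real.exp_le_one_iff.2 (by have := h.v_nonneg a; simp; positivity)
  have e : ψ L θ - (Real.exp (-z) : ℝ) = (ψ L θ - ψ a θ * ψ b θ + ((θ ^ 2 * κ : ℝ) : ℂ)) +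
      ((ψ a θ - ga) * ψ b θ + ga * (ψ b θ - gb)) +
      ((Real.exp (-x) - Real.exp (-z) - (z - x) : ℝ) : ℂ) := by
    rw [hgab, hzx]; push_cast; ring
  rw [e]
  have t2 : ‖(ψ a θ - ga) * ψ b θ + ga * (ψ b θ - gb)‖ ≤ ‖ψ a θ - ga‖ + ‖ψ b θ - gb‖ := by
    refine (norm_add_le _ _).trans (add_le_add ?_ ?_)
    · rw [norm_mul]; exact mul_le_of_le_one_right (norm_nonneg _) (h.norm_le b θ)
    · rw [norm_mul]; exact mul_le_of_le_one_left (norm_nonneg _) hga1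
  have n3 : ‖((Real.exp (-x) - Real.exp (-z) - (z - x) : ℝ) : ℂ)‖ ≤
      2 * C ^ 2 * (|θ| ^ p * (L : ℝ) ^ (1 - α / 2)) := by
    rw [Complex.norm_real, Real.norm_eq_abs]; exact t3
  have hQ : 0 ≤ |θ| ^ p * (L : ℝ) ^ (1 - α / 2) := by positivity
  have hCC : 3 * C + 2 * C ^ 2 ≤ 5 * C ^ 2 := by nlinarith
  have := mul_le_mul_of_nonneg_right hCC hQ
  refine (norm_add_le _ _).trans ((add_le_add ((norm_add_le _ _).trans (add_le_add t1 t2)) n3).trans ?_)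
  linarith

/-- The constant in the Gaussian approximation of `ψ L`. -/
noncomputable def gaussConst (α C : ℝ) : ℝ := C + 5 * C ^ 2 / ((3 / 2 : ℝ) ^ (α / 2) - 1)

lemma one_lt_three_halves_rpow {α : ℝ} (hα : 0 < α) : 1 < (3 / 2 : ℝ) ^ (α / 2) :=
  Real.one_lt_rpow (by norm_num) (by linarith)

theorem norm_sub_gauss_le (h : CharData p α C c₀ L₀ m ψ v) (h2 : 2 < p) (h3 : p ≤ 3) (hα : 0 < α)
    (hα2 : α ≤ 1 / 2) (hC : 1 ≤ C) (θ : ℝ) (L : ℕ) (hL : 1 ≤ L) (hθ : |θ| * √(L : ℝ) ≤ 1) :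
    ‖ψ L θ - (Real.exp (-(v L * θ ^ 2 / 2)) : ℝ)‖ ≤ gaussConst α C * (L * |θ| ^ p) := by
  have hr := one_lt_three_halves_rpow hα
  set r := (3 / 2 : ℝ) ^ (α / 2) with hrdef
  set B' := 5 * C ^ 2 / (r - 1) with hB'
  have hB0 : 0 ≤ B' := div_nonneg (by positivity) (by linarith)
  have hBr : B' * (r - 1) = 5 * C ^ 2 := div_mul_cancel₀ _ (by linarith)
  -- The subtracted sublinear term makes the induction close: its two halves exceed the whole by
  -- B'(r-1)L^{1-α/2}, exactly the joining error 5C² L^{1-α/2}.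
  suffices H : ‖ψ L θ - (Real.exp (-(v L * θ ^ 2 / 2)) : ℝ)‖ ≤
      |θ| ^ p * ((C + B') * L - B' * (L : ℝ) ^ (1 - α / 2)) by
    refine H.trans ?_
    unfold gaussConst
    have : 0 ≤ |θ| ^ p * (B' * (L : ℝ) ^ (1 - α / 2)) := by positivity
    linarith
  induction L using Nat.strong_induction_on with
  | _ L ih =>
  rcases hL.eq_or_lt with rfl | hL2
  · have := h.base θ (by simpa using hθ)
    simpa [mul_comm] using this
  obtain ⟨a, b, ha, hb, hab⟩ : ∃ a b : ℕ, L / 2 ≤ a ∧ L / 2 ≤ b ∧ L = a + b :=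
    ⟨L / 2, L - L / 2, le_rfl, by omega, by omega⟩
  have hmono : ∀ c : ℕ, c ≤ L → |θ| * √(c : ℝ) ≤ 1 := fun c hc =>
    le_trans (by gcongr) hθ
  have iha := ih a (by omega) (by omega) (hmono a (by omega))
  have ihb := ih b (by omega) (by omega) (hmono b (by omega))
  have st := h.gauss_step h2 h3 hα hα2 hC (a := a) (b := b) (by omega) (by omega) (by omega) θ
    (by rw [← hab]; exact hθ)
  rw [← hab] at st
  have ha3 : (3 * a : ℝ) ≤ 2 * L := by exact_mod_cast (by omega)
  have hb3 : (3 * b : ℝ) ≤ 2 * L := by exact_mod_cast (by omega)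
  have habR : (a : ℝ) + b = L := by rw [hab]; push_cast; ring
  have sup := rpow_add_rpow_ge (η := α / 2) (by linarith) (a := a) (b := b) (L := L)
    (by exact_mod_cast (by omega)) (by exact_mod_cast (by omega)) habR (by linarith) (by linarith)
  rw [← hrdef] at sup
  refine st.trans ((add_le_add_left (add_le_add iha ihb) _).trans ?_)
  have hθp : 0 ≤ |θ| ^ p := by positivity
  have key : (C + B') * a - B' * (a : ℝ) ^ (1 - α / 2) + ((C + B') * b - B' * (b : ℝ) ^ (1 - α / 2)) +
      5 * C ^ 2 * (L : ℝ) ^ (1 - α / 2) ≤ (C + B') * L - B' * (L : ℝ) ^ (1 - α / 2) := by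
    have := mul_le_mul_of_nonneg_left sup hB0
    rw [← hBr, ← habR]
    rw [← habR] at this
    linarith
  have := mul_le_mul_of_nonneg_left key hθp
  linarith

end CharData
end WeakDep

/-! ### Decay of the characteristic functions and splitting into many blocks -/

namespace WeakDep

lemma exp_neg_le_one_sub_half {u : ℝ} (h0 : 0 ≤ u) (h1 : u ≤ 1) : Real.exp (-u) ≤ 1 - u / 2 := by
  have h := Real.add_one_le_exp u
  rw [Real.exp_neg, inv_le_iff_one_le_mul₀ (Real.exp_pos u)]
  nlinarith

lemma norm_pow_sub_pow_le_mul {x y : ℂ} {ρ : ℝ} (hx : ‖x‖ ≤ ρ) (hy : ‖y‖ ≤ ρ) (k : ℕ) :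
    ‖x ^ (k + 1) - y ^ (k + 1)‖ ≤ (k + 1) * ρ ^ k * ‖x - y‖ := by
  have hρ : 0 ≤ ρ := (norm_nonneg x).trans hx
  induction k with
  | zero => simp
  | succ k ih =>
    have e : x ^ (k + 1 + 1) - y ^ (k + 1 + 1) = (x ^ (k + 1) - y ^ (k + 1)) * x +
        y ^ (k + 1) * (x - y) := by ring
    rw [e]
    refine (norm_add_le _ _).trans ?_
    rw [norm_mul, norm_mul, norm_pow]
    calc _ ≤ (k + 1) * ρ ^ k * ‖x - y‖ * ρ + ρ ^ (k + 1) * ‖x - y‖ := by gcongr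
      _ = _ := by push_cast; ring

lemma abs_exp_neg_sub_exp_neg_le {x z : ℝ} (hx : 0 ≤ x) (hz : 0 ≤ z) :
    |Real.exp (-x) - Real.exp (-z)| ≤ |x - z| := by
  wlog h : x ≤ z generalizing x z
  · rw [abs_sub_comm, abs_sub_comm x]; exact this hz hx (by linarith)
  have h2 : Real.exp (-z) ≤ Real.exp (-x) := Real.exp_le_exp.2 (by linarith)
  rw [abs_of_nonneg (by linarith), abs_of_nonpos (by linarith)]
  have e2 : Real.exp (-z) = Real.exp (-x) * Real.exp (-(z - x)) := by rw [← Real.exp_add]; ring_nf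
  have h1 := Real.add_one_le_exp (-(z - x))
  have h3 : Real.exp (-x) ≤ 1 := Real.exp_le_one_iff.2 (by linarith)
  have h4 := Real.exp_pos (-x)
  have : Real.exp (-x) * (-(z - x) + 1) ≤ Real.exp (-z) := by rw [e2]; gcongr
  nlinarith

namespace CharData
variable {p α C c₀ : ℝ} {L₀ m : ℕ} {ψ : ℕ → ℝ → ℂ} {v : ℕ → ℝ}

lemma gaussConst_pos (hα : 0 < α) (hC : 1 ≤ C) : 0 < gaussConst α C := by
  have := one_lt_three_halves_rpow hα
  have : 0 ≤ 5 * C ^ 2 / ((3 / 2 : ℝ) ^ (α / 2) - 1) := div_nonneg (by positivity) (by linarith)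
  unfold gaussConst; linarith

lemma gauss_le (h : CharData p α C c₀ L₀ m ψ v) {L : ℕ} (hL : L₀ ≤ L) (θ : ℝ) :
    Real.exp (-(v L * θ ^ 2 / 2)) ≤ Real.exp (-(c₀ * L * θ ^ 2 / 2)) := by
  have := h.v_ge L hL
  gcongr

/-- Gaussian decay of the characteristic functions for moderate frequencies. -/
lemma exists_norm_le_exp (h2 : 2 < p) (h3 : p ≤ 3) (hα : 0 < α) (hα2 : α ≤ 1 / 2) (hC : 1 ≤ C)
    (hc : 0 < c₀) (hc1 : c₀ ≤ 1) (L₀ : ℕ) :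
    ∃ L₁ : ℕ, 1 ≤ L₁ ∧ L₀ ≤ L₁ ∧ ∀ (m : ℕ) (ψ : ℕ → ℝ → ℂ) (v : ℕ → ℝ),
      CharData p α C c₀ L₀ m ψ v → ∀ (L : ℕ) (θ : ℝ), L₁ ≤ L → |θ| * √(L : ℝ) ≤ 1 →
        ‖ψ L θ‖ ≤ Real.exp (-(c₀ / 8 * (L * θ ^ 2))) := by
  have hG := gaussConst_pos hα hC
  -- When |θ|√L ≤ 1 the approximation error L|θ|^p is at most Lθ²·√L^{-(p-2)}. For L large it uses
  -- up only half of the drop c₀Lθ²/4 of the Gaussian factor, leaving c₀/8.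
  have ht : Filter.Tendsto (fun L : ℕ => gaussConst α C * (√(L : ℝ)) ^ (-(p - 2))) Filter.atTop
      (nhds (gaussConst α C * 0)) := by
    refine Filter.Tendsto.const_mul _ ((tendsto_rpow_neg_atTop (by linarith)).comp ?_)
    exact Real.tendsto_sqrt_atTop.comp tendsto_natCast_atTop_atTop
  rw [mul_zero] at ht
  obtain ⟨N, hN⟩ := Filter.eventually_atTop.1 (ht.eventually (gt_mem_nhds (show 0 < c₀ / 8 by positivity)))
  refine ⟨max N (max L₀ 1), by simp, by simp, fun m ψ v h L θ hL hθ => ?_⟩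
  have hL1 : 1 ≤ L := le_trans (by simp) hL
  have hLL : L₀ ≤ L := le_trans (by simp) hL
  have hLN := hN L (le_trans (by simp) hL)
  have hLpos : (0 : ℝ) < L := by exact_mod_cast hL1
  have h1 := h.norm_sub_gauss_le h2 h3 hα hα2 hC θ L hL1 hθ
  have hg := h.gauss_le hLL θ
  have hs : 0 < √(L : ℝ) := Real.sqrt_pos.2 hLpos
  have hLθ : L * θ ^ 2 ≤ 1 := by
    have : (|θ| * √(L : ℝ)) ^ 2 ≤ 1 := pow_le_one₀ (by positivity) hθ
    rwa [mul_pow, sq_abs, Real.sq_sqrt hLpos.le, mul_comm] at this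
  have hp : |θ| ^ p ≤ θ ^ 2 * √(L : ℝ) ^ (-(p - 2)) := by
    have : |θ| ≤ (√(L : ℝ))⁻¹ := by rwa [← one_div, le_div_iff₀ hs]
    rw [Real.rpow_neg hs.le, ← Real.inv_rpow hs.le, ← sq_abs]
    calc |θ| ^ p = |θ| ^ 2 * |θ| ^ (p - 2) := by
          rcases (abs_nonneg θ).eq_or_lt with h0 | h0
          · rw [← h0, Real.zero_rpow (by linarith)]; simp
          · rw [← Real.rpow_natCast, ← Real.rpow_add h0]; congr 1; push_cast; ring
      _ ≤ _ := by gcongr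
  have hexp := exp_neg_le_one_sub_half (u := c₀ * L * θ ^ 2 / 2) (by positivity)
    (by nlinarith [mul_nonneg hLpos.le (sq_nonneg θ)])
  have hψ : ‖ψ L θ‖ ≤ Real.exp (-(v L * θ ^ 2 / 2)) + gaussConst α C * (L * |θ| ^ p) := by
    have := norm_add_le (ψ L θ - (Real.exp (-(v L * θ ^ 2 / 2)) : ℝ))
      (Real.exp (-(v L * θ ^ 2 / 2)) : ℝ)
    rw [sub_add_cancel, Complex.norm_real, Real.norm_of_nonneg (Real.exp_pos _).le] at this
    linarith
  have hsmall : gaussConst α C * (L * |θ| ^ p) ≤ c₀ / 8 * (L * θ ^ 2) := by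
    calc gaussConst α C * (L * |θ| ^ p)
        ≤ gaussConst α C * (L * (θ ^ 2 * √(L : ℝ) ^ (-(p - 2)))) := by gcongr
      _ = (gaussConst α C * √(L : ℝ) ^ (-(p - 2))) * (L * θ ^ 2) := by ring
      _ ≤ _ := by gcongr
  have := Real.add_one_le_exp (-(c₀ / 8 * (L * θ ^ 2)))
  linarith

/-- The characteristic functions stay away from one at frequencies bounded below by `L⁻¹ᐟ²`. -/
lemma exists_norm_le_one_sub (h2 : 2 < p) (h3 : p ≤ 3) (hα : 0 < α) (hα2 : α ≤ 1 / 2) (hC : 1 ≤ C)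
    (hc : 0 < c₀) (hc1 : c₀ ≤ 1) (L₀ : ℕ) :
    ∃ κ η : ℝ, 0 < κ ∧ κ ≤ 1 ∧ 0 < η ∧ η ≤ 1 / 2 ∧ C * κ ≤ η / 2 ∧
      ∀ (m : ℕ) (ψ : ℕ → ℝ → ℂ) (v : ℕ → ℝ),
      CharData p α C c₀ L₀ m ψ v → ∀ (L : ℕ) (θ : ℝ), |θ| ≤ κ → 1 / 16 ≤ L * θ ^ 2 →
        ‖ψ L θ‖ ≤ 1 - η := by
  obtain ⟨L₁, hL₁, -, H⟩ := exists_norm_le_exp h2 h3 hα hα2 hC hc hc1 L₀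
  -- The Gaussian decay at the smallest admissible value: (c₀/8)·(1/16).
  set η := 1 - Real.exp (-(c₀ / 128)) with hη
  have hη0 : 0 < η := by
    have : Real.exp (-(c₀ / 128)) < 1 := by
      rw [← Real.exp_zero]; exact Real.exp_lt_exp.2 (by linarith)
    linarith
  have hη1 : η ≤ 1 / 2 := by
    have := Real.add_one_le_exp (-(c₀ / 128)); linarith
  have hL₁R : (1 : ℝ) ≤ L₁ := by exact_mod_cast hL₁
  -- The first bound makes the crude joining error at most η/2; the second ensures that Lθ² ≥ 1/16
  -- forces L ≥ L₁.
  set κ := min (η / (2 * C)) (1 / (4 * L₁)) with hκ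
  have hκ0 : 0 < κ := by positivity
  have hκ1 : C * κ ≤ η / 2 := by
    calc C * κ ≤ C * (η / (2 * C)) := by gcongr; exact min_le_left _ _
      _ = η / 2 := by field_simp
  have hκ2 : κ * (4 * L₁) ≤ 1 := by
    rw [← le_div_iff₀ (by positivity)]; exact min_le_right _ _
  have hκ3 : κ ≤ 1 := by nlinarith
  refine ⟨κ, η, hκ0, hκ3, hη0, hη1, hκ1, fun m ψ v h L θ hθ hLθ => ?_⟩
  have hθ2 : θ ^ 2 ≤ κ ^ 2 := sq_le_sq' (by linarith [neg_abs_le θ]) (by linarith [le_abs_self θ])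
  induction L using Nat.strong_induction_on with
  | _ L ih =>
  -- If Lθ² ≤ 1 the Gaussian decay applies. Otherwise both halves still satisfy the lower bound
  -- 1/16, and (1-η)² + η/2 ≤ 1 - η because η ≤ 1/2.
  rcases le_or_gt (L * θ ^ 2) 1 with hle | hgt
  · have hLL : L₁ ≤ L := by
      have h1 : (1 : ℝ) ≤ 16 * (L * κ ^ 2) := by
        have : L * θ ^ 2 ≤ L * κ ^ 2 := by gcongr
        linarith
      have h4 : (κ * (4 * L₁)) ^ 2 ≤ 1 := pow_le_one₀ (by positivity) hκ2
      by_contra hcon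
      have h5 : (L : ℝ) + 1 ≤ L₁ := by exact_mod_cast (by omega)
      have h6 : (L₁ : ℝ) ≤ L₁ ^ 2 := by nlinarith
      have h7 : 0 < κ ^ 2 := by positivity
      nlinarith
    have := H m ψ v h L θ hLL (by
      rw [← Real.sqrt_sq_eq_abs, ← Real.sqrt_mul (sq_nonneg _), Real.sqrt_le_one]
      linarith)
    refine this.trans ?_
    rw [hη, sub_sub_cancel]
    refine Real.exp_le_exp.2 ?_
    nlinarith
  · have hL2 : 2 ≤ L := by
      by_contra hcon
      have h5 : (L : ℝ) ≤ 1 := by exact_mod_cast (by omega)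
      nlinarith [sq_nonneg θ]
    obtain ⟨a, b, ha, hb, hab⟩ : ∃ a b : ℕ, L ≤ 3 * a ∧ L ≤ 3 * b ∧ L = a + b :=
      ⟨L / 2, L - L / 2, by omega, by omega, by omega⟩
    have ha' : (L : ℝ) ≤ 3 * a := by exact_mod_cast ha
    have hb' : (L : ℝ) ≤ 3 * b := by exact_mod_cast hb
    have iha := ih a (by omega) (by nlinarith [sq_nonneg θ])
    have ihb := ih b (by omega) (by nlinarith [sq_nonneg θ])
    have hcr := h.crude a b θ
    rw [← hab] at hcr
    have : ‖ψ L θ‖ ≤ ‖ψ L θ - ψ a θ * ψ b θ‖ + ‖ψ a θ‖ * ‖ψ b θ‖ := by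
      rw [← norm_mul]
      simpa using norm_add_le (ψ L θ - ψ a θ * ψ b θ) (ψ a θ * ψ b θ)
    have hm : ‖ψ a θ‖ * ‖ψ b θ‖ ≤ (1 - η) * (1 - η) :=
      mul_le_mul iha ihb (norm_nonneg _) (by linarith)
    have : C * |θ| ≤ C * κ := by gcongr
    nlinarith

lemma norm_sub_pow_le (h : CharData p α C c₀ L₀ m ψ v) {L l : ℕ} (hl : 1 ≤ l)
    (hlL : l ≤ L) (θ : ℝ) (k : ℕ) :
    ‖ψ ((k + 1) * L) θ - ψ L θ ^ (k + 1)‖ ≤ k * (C * (|θ| * (l : ℝ) ^ (-α) + θ ^ 2 * √l)) := by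
  induction k with
  | zero => simp
  | succ k ih =>
    have hj := h.join ((k + 1) * L) L l θ hl (hlL.trans (Nat.le_mul_of_pos_left _ (by omega))) hlL
    have e : (k + 1 + 1) * L = (k + 1) * L + L := by ring
    have e2 : ψ ((k + 1 + 1) * L) θ - ψ L θ ^ (k + 1 + 1) =
        (ψ ((k + 1) * L + L) θ - ψ ((k + 1) * L) θ * ψ L θ) +
        (ψ ((k + 1) * L) θ - ψ L θ ^ (k + 1)) * ψ L θ := by rw [e]; ring
    rw [e2]
    refine (norm_add_le _ _).trans ?_
    have : ‖(ψ ((k + 1) * L) θ - ψ L θ ^ (k + 1)) * ψ L θ‖ ≤ _ :=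
      (norm_mul_le _ _).trans (mul_le_of_le_one_right (norm_nonneg _) (h.norm_le L θ))
    push_cast
    linarith

lemma abs_v_sub_mul_le (h : CharData p α C c₀ L₀ m ψ v) (hC : 1 ≤ C) {L l n : ℕ} (hl : 1 ≤ l)
    (hlL : l ≤ L) (k : ℕ) (hn : (k + 1) * L ≤ n) :
    |v ((k + 1) * L) - (k + 1) * v L| ≤ k * (C * ((l : ℝ) ^ (-α) * √(n : ℝ) + √l)) := by
  induction k with
  | zero => simp
  | succ k ih =>
    have e : (k + 1 + 1) * L = (k + 1) * L + L := by ring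
    have hj := h.cov ((k + 1) * L) L l hl (hlL.trans (Nat.le_mul_of_pos_left _ (by omega))) hlL
    have ih' := ih (by rw [e] at hn; omega)
    have hle : C * ((l : ℝ) ^ (-α) * √(((k + 1) * L + L : ℕ) : ℝ) + √l) ≤
        C * ((l : ℝ) ^ (-α) * √(n : ℝ) + √l) := by
      rw [e] at hn
      gcongr
    rw [e, show v ((k + 1) * L + L) - ((k + 1 : ℕ) + 1) * v L =
      (v ((k + 1) * L + L) - v ((k + 1) * L) - v L) + (v ((k + 1) * L) - (k + 1) * v L) by
        push_cast; ring]
    refine (abs_add_le _ _).trans ?_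
    push_cast at *
    linarith

/-- Gaussian approximation at moderate frequencies, by splitting into `k + 2` blocks. -/
lemma norm_sub_gauss_le_blocks (h : CharData p α C c₀ L₀ m ψ v) (h2 : 2 < p) (h3 : p ≤ 3)
    (hα : 0 < α) (hα2 : α ≤ 1 / 2) (hC : 1 ≤ C) {L b l k n : ℕ} (hl : 1 ≤ l)
    (hlL : l ≤ L) (hLb : L ≤ b) (hn : n = (k + 1) * L + b) (θ : ℝ) (hθ : |θ| * √(b : ℝ) ≤ 1)
    {ρ : ℝ} (hρ : ‖ψ L θ‖ ≤ ρ) (hgρ : Real.exp (-(v L * θ ^ 2 / 2)) ≤ ρ) (hρ1 : ρ ≤ 1) :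
    ‖ψ n θ - (Real.exp (-(v n * θ ^ 2 / 2)) : ℝ)‖ ≤
      ρ ^ k * (gaussConst α C * (n * |θ| ^ p)) +
      (k + 1) * (C * (|θ| * (l : ℝ) ^ (-α) + θ ^ 2 * √l)) +
      (k + 1) * (θ ^ 2 * (C * ((l : ℝ) ^ (-α) * √(n : ℝ) + √l))) := by
  have hρ0 : 0 ≤ ρ := (norm_nonneg _).trans hρ
  have hG := gaussConst_pos hα hC
  set F := C * (|θ| * (l : ℝ) ^ (-α) + θ ^ 2 * √l) with hF
  set F' := C * ((l : ℝ) ^ (-α) * √(n : ℝ) + √l) with hF'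
  have hlkL : l ≤ (k + 1) * L := hlL.trans (Nat.le_mul_of_pos_left _ (by omega))
  have hF0 : 0 ≤ F := by positivity
  set gL := Real.exp (-(v L * θ ^ 2 / 2)) with hgL
  set gb := Real.exp (-(v b * θ ^ 2 / 2)) with hgb
  have vL := h.v_nonneg L
  have vb := h.v_nonneg b
  have hgb1 : gb ≤ 1 := Real.exp_le_one_iff.2 (by simp; positivity)
  have ngL : ‖(gL : ℂ)‖ ≤ ρ := by
    rwa [Complex.norm_real, Real.norm_of_nonneg (Real.exp_pos _).le]
  have eL := h.norm_sub_gauss_le h2 h3 hα hα2 hC θ L (by omega) (le_trans (by gcongr) hθ)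
  have eb := h.norm_sub_gauss_le h2 h3 hα hα2 hC θ b (by omega) hθ
  rw [← hgL] at eL
  rw [← hgb] at eb
  -- dependence between the blocks
  have s1 : ‖ψ n θ - ψ L θ ^ (k + 1) * ψ b θ‖ ≤ (k + 1) * F := by
    have hj := h.join ((k + 1) * L) b l θ hl hlkL (hlL.trans hLb)
    have hk := h.norm_sub_pow_le hl hlL θ k
    have e2 : ψ n θ - ψ L θ ^ (k + 1) * ψ b θ =
        (ψ ((k + 1) * L + b) θ - ψ ((k + 1) * L) θ * ψ b θ) +
        (ψ ((k + 1) * L) θ - ψ L θ ^ (k + 1)) * ψ b θ := by rw [hn]; ring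
    rw [e2]
    refine (norm_add_le _ _).trans ?_
    have : ‖(ψ ((k + 1) * L) θ - ψ L θ ^ (k + 1)) * ψ b θ‖ ≤ _ :=
      (norm_mul_le _ _).trans (mul_le_of_le_one_right (norm_nonneg _) (h.norm_le b θ))
    linarith
  -- Gaussian approximation of the blocks
  have s2 : ‖ψ L θ ^ (k + 1) * ψ b θ - (gL : ℂ) ^ (k + 1) * gb‖ ≤
      ρ ^ k * (gaussConst α C * (n * |θ| ^ p)) := by
    have e2 : ψ L θ ^ (k + 1) * ψ b θ - (gL : ℂ) ^ (k + 1) * gb =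
        (ψ L θ ^ (k + 1) - (gL : ℂ) ^ (k + 1)) * ψ b θ + (gL : ℂ) ^ (k + 1) * (ψ b θ - gb) := by ring
    rw [e2]
    refine (norm_add_le _ _).trans ?_
    have hp := norm_pow_sub_pow_le_mul hρ ngL k
    have t1 : ‖(ψ L θ ^ (k + 1) - (gL : ℂ) ^ (k + 1)) * ψ b θ‖ ≤ _ :=
      (norm_mul_le _ _).trans (mul_le_of_le_one_right (norm_nonneg _) (h.norm_le b θ))
    have t2 : ‖(gL : ℂ) ^ (k + 1) * (ψ b θ - gb)‖ ≤ ρ ^ k * (gaussConst α C * (b * |θ| ^ p)) := by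
      rw [norm_mul, norm_pow]
      have : ‖(gL : ℂ)‖ ^ (k + 1) ≤ ρ ^ k := by
        calc ‖(gL : ℂ)‖ ^ (k + 1) ≤ ρ ^ (k + 1) := by gcongr
          _ ≤ ρ ^ k := pow_le_pow_of_le_one hρ0 hρ1 (by omega)
      gcongr
    have t3 : (k + 1) * ρ ^ k * ‖ψ L θ - gL‖ ≤
        (k + 1) * ρ ^ k * (gaussConst α C * (L * |θ| ^ p)) := by gcongr
    have e3 : ρ ^ k * (gaussConst α C * (n * |θ| ^ p)) =
        (k + 1) * ρ ^ k * (gaussConst α C * (L * |θ| ^ p)) +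
        ρ ^ k * (gaussConst α C * (b * |θ| ^ p)) := by rw [hn]; push_cast; ring
    linarith
  -- variances
  have s3 : ‖(gL : ℂ) ^ (k + 1) * gb - (Real.exp (-(v n * θ ^ 2 / 2)) : ℝ)‖ ≤
      (k + 1) * (θ ^ 2 * F') := by
    have e1 : gL ^ (k + 1) * gb = Real.exp (-(((k + 1) * v L + v b) * θ ^ 2 / 2)) := by
      rw [hgL, hgb, ← Real.exp_nat_mul, ← Real.exp_add]; congr 1; push_cast; ring
    rw [← Complex.ofReal_pow, ← Complex.ofReal_mul, ← Complex.ofReal_sub, Complex.norm_real, e1,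
      Real.norm_eq_abs]
    have hvn := h.v_nonneg n
    refine (abs_exp_neg_sub_exp_neg_le (by positivity) (by positivity)).trans ?_
    have hc1 := h.cov ((k + 1) * L) b l hl hlkL (hlL.trans hLb)
    have hc2 := h.abs_v_sub_mul_le hC hl hlL k (n := n) (by omega)
    rw [← hn] at hc1
    have hd : |((k + 1) * v L + v b) - v n| ≤ (k + 1) * F' := by
      rw [abs_sub_comm, show v n - ((k + 1) * v L + v b) = (v n - v ((k + 1) * L) - v b) +
        (v ((k + 1) * L) - (k + 1) * v L) by ring]
      refine (abs_add_le _ _).trans ?_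
      linarith
    rw [show ((k + 1) * v L + v b) * θ ^ 2 / 2 - v n * θ ^ 2 / 2 =
      θ ^ 2 * ((((k + 1) * v L + v b) - v n) / 2) by ring, abs_mul, abs_of_nonneg (sq_nonneg θ),
      abs_div, abs_two]
    have : |((k + 1) * v L + v b) - v n| / 2 ≤ (k + 1) * F' := by
      have := abs_nonneg (((k + 1) * v L + v b) - v n); linarith
    calc _ ≤ θ ^ 2 * ((k + 1) * F') := by gcongr
      _ = _ := by ring
  have e : ψ n θ - (Real.exp (-(v n * θ ^ 2 / 2)) : ℝ) = (ψ n θ - ψ L θ ^ (k + 1) * ψ b θ) +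
      (ψ L θ ^ (k + 1) * ψ b θ - (gL : ℂ) ^ (k + 1) * gb) +
      ((gL : ℂ) ^ (k + 1) * gb - (Real.exp (-(v n * θ ^ 2 / 2)) : ℝ)) := by ring
  rw [e]
  refine (norm_add_le _ _).trans ((add_le_add_left (norm_add_le _ _) _).trans ?_)
  linarith

end CharData
end WeakDep

/-! ### Gaussian approximation for all frequencies up to κ√n -/

namespace WeakDep

lemma one_add_sq_mul_exp_le {κ x : ℝ} (hκ : 0 < κ) (hκ1 : κ ≤ 1) (hx : 0 ≤ x) :
    (1 + x) ^ 2 * Real.exp (-(κ * x)) ≤ 8 / κ ^ 2 := by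
  have h := Real.quadratic_le_exp_of_nonneg (x := κ * x) (by positivity)
  rw [Real.exp_neg, ← div_eq_mul_inv, div_le_div_iff₀ (Real.exp_pos _) (by positivity)]
  have h1 : κ * (1 + x) ≤ 1 + κ * x := by nlinarith
  have h2 : (κ * (1 + x)) ^ 2 ≤ (1 + κ * x) ^ 2 := by
    apply pow_le_pow_left₀ (by positivity) h1
  nlinarith [sq_nonneg (κ * x), mul_nonneg hκ.le hx]

lemma rpow_le_mul_one_add_sq {p t : ℝ} (h2 : 2 < p) (h3 : p ≤ 3) (ht0 : 0 < t) :
    t ^ p ≤ t * (1 + t ^ 2) := by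
  rw [show p = 1 + (p - 1) by ring, Real.rpow_add ht0, Real.rpow_one]
  gcongr
  rcases le_or_gt t 1 with h1 | h1
  · have := Real.rpow_le_one ht0.le h1 (show 0 ≤ p - 1 by linarith)
    nlinarith [sq_nonneg t]
  · have := Real.rpow_le_rpow_of_exponent_le h1.le (show p - 1 ≤ (2 : ℕ) by push_cast; linarith)
    rw [Real.rpow_natCast] at this
    linarith

/-- The joining and variance errors of q blocks at θ = t/√n total O(q t(1+t) n^{-1/2-α/2}). As t² ≤
q/4, inserting the factor 1 + t² costs at most another O(q²), and q³ ≤ n^{α/2} leaves n^{-1/2} ≤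
n^{1-p/2}. -/
lemma block_error_le {C p α t n q k lα sl θ : ℝ} (hC : 1 ≤ C) (h3 : p ≤ 3)
    (hn : 1 ≤ n) (hq3 : 3 ≤ q) (hk1 : k + 1 ≤ q) (hk : 0 ≤ k) (ht0 : 0 < t) (ht2 : t ^ 2 ≤ q / 4)
    (hq : q ^ 3 ≤ n ^ (α / 2)) (hθ : θ = t / √n) (hlα : 0 ≤ lα) (hsl : 0 ≤ sl)
    (la : lα ≤ 2 * n ^ (-(α / 2))) (herr : lα * √n + sl ≤ 3 * n ^ (1 / 2 - α / 2)) :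
    (k + 1) * (C * (|θ| * lα + θ ^ 2 * sl)) + (k + 1) * (θ ^ 2 * (C * (lα * √n + sl))) ≤
      12 * C * (n ^ (1 - p / 2) * (t / (1 + t ^ 2))) := by
  have hn0 : 0 < n := by linarith
  have hsn : 0 < √n := Real.sqrt_pos.2 hn0
  have hθ0 : 0 < θ := by rw [hθ]; positivity
  have hθ2 : θ ^ 2 = t ^ 2 / n := by rw [hθ, div_pow, Real.sq_sqrt hn0.le]
  set Y := n ^ (-(1 / 2) - α / 2) with hY
  have hY0 : 0 < Y := by positivity
  have g1 : |θ| * lα ≤ 2 * t * Y := by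
    rw [abs_of_pos hθ0, hθ]
    have e : (√n)⁻¹ * n ^ (-(α / 2)) = Y := by
      rw [Real.sqrt_eq_rpow, ← Real.rpow_neg hn0.le, ← Real.rpow_add hn0, hY]; congr 1
    calc t / √n * lα ≤ t / √n * (2 * n ^ (-(α / 2))) := by gcongr
      _ = 2 * t * ((√n)⁻¹ * n ^ (-(α / 2))) := by ring
      _ = _ := by rw [e]
  have g3 : θ ^ 2 * (lα * √n + sl) ≤ 3 * t ^ 2 * Y := by
    have e : n⁻¹ * n ^ (1 / 2 - α / 2) = Y := by
      rw [← Real.rpow_neg_one, ← Real.rpow_add hn0, hY]; congr 1; ring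
    calc _ ≤ θ ^ 2 * (3 * n ^ (1 / 2 - α / 2)) := by gcongr
      _ = 3 * t ^ 2 * (n⁻¹ * n ^ (1 / 2 - α / 2)) := by rw [hθ2]; ring
      _ = _ := by rw [e]
  have g2 : θ ^ 2 * sl ≤ 3 * t ^ 2 * Y := by
    refine le_trans ?_ g3
    gcongr
    have : 0 ≤ lα * √n := by positivity
    linarith
  have hcub : (1 + t) * (1 + t ^ 2) ≤ 2 * q ^ 2 := by
    have : t ≤ q / 2 := by nlinarith
    calc (1 + t) * (1 + t ^ 2) ≤ (1 + q / 2) * (1 + q / 4) := by gcongr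
      _ ≤ _ := by nlinarith
  have hYn : q ^ 3 * Y ≤ n ^ (1 - p / 2) := by
    calc q ^ 3 * Y ≤ n ^ (α / 2) * Y := by gcongr
      _ = n ^ (-(1 / 2) : ℝ) := by rw [hY, ← Real.rpow_add hn0]; congr 1; ring
      _ ≤ _ := Real.rpow_le_rpow_of_exponent_le hn (by linarith)
  calc _ = (k + 1) * (C * (|θ| * lα + θ ^ 2 * sl +
        θ ^ 2 * (lα * √n + sl))) := by ring
    _ ≤ q * (C * (2 * t * Y + 3 * t ^ 2 * Y + 3 * t ^ 2 * Y)) := by gcongr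
    _ ≤ q * (C * (6 * t * (1 + t) * Y)) := by
        gcongr
        have : 0 < t * Y := by positivity
        linarith
    _ = 6 * C * (q * Y) * ((1 + t) * (1 + t ^ 2)) * (t / (1 + t ^ 2)) := by field_simp
    _ ≤ 6 * C * (q * Y) * (2 * q ^ 2) * (t / (1 + t ^ 2)) := by gcongr
    _ = 12 * C * ((q ^ 3 * Y) * (t / (1 + t ^ 2))) := by ring
    _ ≤ _ := by gcongr


namespace CharData
variable {p α C c₀ : ℝ} {L₀ m : ℕ} {ψ : ℕ → ℝ → ℂ} {v : ℕ → ℝ}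

set_option maxHeartbeats 800000 in
-- For t ≤ √q/2 every block, including the longer last one, satisfies |θ|√b ≤ 1, so the block
-- decomposition applies. The Gaussian error n|θ|^p = n^{1-p/2}t^p is turned into a multiple of
-- t/(1+t²) by the decay ρ^k.
lemma norm_sub_gauss_le_of_le_sqrt (h : CharData p α C c₀ L₀ m ψ v) (h2 : 2 < p) (h3 : p ≤ 3)
    (hα : 0 < α) (hα2 : α ≤ 1 / 2) (hC : 1 ≤ C) (hc : 0 < c₀) (hc1 : c₀ ≤ 1) {L₁ : ℕ} (hL₀ : L₀ ≤ L₁)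
    (H : ∀ (L : ℕ) (θ : ℝ), L₁ ≤ L → |θ| * √(L : ℝ) ≤ 1 →
        ‖ψ L θ‖ ≤ Real.exp (-(c₀ / 8 * (L * θ ^ 2))))
    {n q : ℕ} (hq3 : 3 ≤ q) (hqn : q * q ≤ n) (hsq : Nat.sqrt n * q ≤ n)
    (hq : (q : ℝ) ^ 3 ≤ (n : ℝ) ^ (α / 2)) (hL₁ : L₁ ≤ n / q) {t : ℝ} (ht0 : 0 < t)
    (ht : t ≤ √(q : ℝ) / 2) :
    ‖ψ n (t / √n) - (Real.exp (-(v n * (t / √n) ^ 2 / 2)) : ℝ)‖ ≤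
      (gaussConst α C * (8 / (c₀ / 32) ^ 2) + 12 * C) * ((n : ℝ) ^ (1 - p / 2) * (t / (1 + t ^ 2))) := by
  have hG := gaussConst_pos hα hC
  have hn1 : 1 ≤ n := by nlinarith
  have hnR : (1 : ℝ) ≤ n := by exact_mod_cast hn1
  have hn0 : (0 : ℝ) < n := by linarith
  have hqR : (3 : ℝ) ≤ q := by exact_mod_cast hq3
  obtain ⟨k, rfl⟩ : ∃ k, q = k + 2 := ⟨q - 2, by omega⟩
  set q := k + 2 with hqk
  set L := n / q with hL
  obtain ⟨l1, la, lb⟩ := nat_sqrt_bounds hα hα2 hn1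
  have herr := nat_sqrt_error_le hα hα2 hn1
  set l := Nat.sqrt n with hl
  have hlL : l ≤ L := (Nat.le_div_iff_mul_le (by omega)).2 hsq
  have hqL : q ≤ L := (Nat.le_div_iff_mul_le (by omega)).2 hqn
  have hdiv := Nat.div_add_mod n q
  have hmod := Nat.mod_lt n (show q > 0 by omega)
  rw [← hL] at hdiv
  have hnb : n = (k + 1) * L + (L + n % q) := by
    conv_lhs => rw [← hdiv, hqk]
    ring
  set b := L + n % q with hb
  have hb2 : b ≤ 2 * L := by omega
  have hqLn : (q : ℝ) * L ≤ n := by exact_mod_cast (by omega : q * L ≤ n)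
  have hnlt : (n : ℝ) ≤ (q + 1) * L := by
    have : n ≤ (q + 1) * L := by rw [add_mul]; omega
    exact_mod_cast this
  set θ := t / √(n : ℝ) with hθ
  have hsn : 0 < √(n : ℝ) := Real.sqrt_pos.2 hn0
  have hθ0 : 0 < θ := by positivity
  have hθ2 : θ ^ 2 = t ^ 2 / n := by rw [hθ, div_pow, Real.sq_sqrt hn0.le]
  have ht2 : t ^ 2 ≤ q / 4 := by
    have := pow_le_pow_left₀ ht0.le ht 2
    rw [div_pow, Real.sq_sqrt (by positivity)] at this
    linarith
  have hLpos : (0 : ℝ) < L := by exact_mod_cast (by omega)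
  have hθb : |θ| * √(b : ℝ) ≤ 1 := by
    rw [abs_of_pos hθ0, ← Real.sqrt_sq hθ0.le, ← Real.sqrt_mul (sq_nonneg _), Real.sqrt_le_one, hθ2,
      div_mul_eq_mul_div, div_le_one hn0]
    have : (b : ℝ) ≤ 2 * L := by exact_mod_cast hb2
    have : t ^ 2 * b ≤ q / 4 * (2 * L) := by gcongr
    nlinarith
  have hθL : |θ| * √(L : ℝ) ≤ 1 := le_trans (by gcongr; omega) hθb
  set ρ := Real.exp (-(c₀ / 8 * (L * θ ^ 2))) with hρ
  have main := h.norm_sub_gauss_le_blocks h2 h3 hα hα2 hC (L := L) (b := b) (l := l) (k := k) l1 hlL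
    (by omega) hnb θ hθb (ρ := ρ) (H L θ hL₁ hθL)
    ((h.gauss_le (hL₀.trans hL₁) θ).trans (Real.exp_le_exp.2 (by
      have : 0 ≤ c₀ * (L * θ ^ 2) := by positivity
      linarith)))
    (Real.exp_le_one_iff.2 (by simp; positivity))
  refine main.trans ?_
  have hρk : ρ ^ k ≤ Real.exp (-(c₀ / 32 * t ^ 2)) := by
    rw [hρ, ← Real.exp_nat_mul]
    refine Real.exp_le_exp.2 ?_
    -- The k blocks that provide decay cover a quarter of n: n ≤ (k+3)L and k ≥ 1, which is why q ≥
    -- 3.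
    have h4 : (n : ℝ) ≤ 4 * (k * L) := by
      have hk : (1 : ℝ) ≤ k := by exact_mod_cast (by omega)
      have : (q : ℝ) = k + 2 := by rw [hqk]; push_cast; ring
      rw [this] at hnlt
      nlinarith
    have h5 : t ^ 2 ≤ 4 * (k * L) * θ ^ 2 := by
      rw [hθ2, ← mul_div_assoc, le_div_iff₀ hn0]
      nlinarith [sq_nonneg t]
    have := mul_le_mul_of_nonneg_left h5 (show 0 ≤ c₀ / 32 by positivity)
    linarith
  have hnp : (n : ℝ) * |θ| ^ p = (n : ℝ) ^ (1 - p / 2) * t ^ p := by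
    rw [abs_of_pos hθ0, hθ, Real.div_rpow ht0.le hsn.le, Real.sqrt_eq_rpow, ← Real.rpow_mul hn0.le,
      Real.rpow_sub hn0, Real.rpow_one]
    rw [show (1 / 2 * p : ℝ) = p / 2 by ring]; ring
  have hpos : (0 : ℝ) < 1 + t ^ 2 := by positivity
  have f1 : ρ ^ k * (gaussConst α C * (n * |θ| ^ p)) ≤
      (gaussConst α C * (8 / (c₀ / 32) ^ 2)) * ((n : ℝ) ^ (1 - p / 2) * (t / (1 + t ^ 2))) := by
    rw [hnp]
    have htp := rpow_le_mul_one_add_sq h2 h3 ht0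
    have hex := one_add_sq_mul_exp_le (κ := c₀ / 32) (x := t ^ 2) (by positivity) (by linarith)
      (by positivity)
    calc ρ ^ k * (gaussConst α C * ((n : ℝ) ^ (1 - p / 2) * t ^ p))
        ≤ Real.exp (-(c₀ / 32 * t ^ 2)) * (gaussConst α C * ((n : ℝ) ^ (1 - p / 2) *
          (t * (1 + t ^ 2)))) := by gcongr
      _ = gaussConst α C * ((1 + t ^ 2) ^ 2 * Real.exp (-(c₀ / 32 * t ^ 2))) *
          ((n : ℝ) ^ (1 - p / 2) * (t / (1 + t ^ 2))) := by field_simp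
      _ ≤ _ := by gcongr
  have hk1 : ((k : ℝ) + 1) ≤ q := by rw [hqk]; push_cast; linarith
  have f2 : (k + 1) * (C * (|θ| * (l : ℝ) ^ (-α) + θ ^ 2 * √l)) +
      (k + 1) * (θ ^ 2 * (C * ((l : ℝ) ^ (-α) * √(n : ℝ) + √l))) ≤
      12 * C * ((n : ℝ) ^ (1 - p / 2) * (t / (1 + t ^ 2))) :=
    block_error_le hC h3 hnR hqR hk1 (by positivity) ht0 ht2 hq hθ (by positivity) (by positivity) la herr
  rw [add_assoc]
  refine (add_le_add f1 f2).trans (le_of_eq ?_)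
  ring

/-- For t ≥ √q/2 one has Lθ² ≥ 1/16, so |ψ_L| + C|θ| ≤ 1 - η/2 and the bound `high`, available since
L ≥ m, makes |ψ_n| at most 1/n. The Gaussian term is as small, and 1/n is dominated by the target
because 1/2 ≤ t ≤ √n. -/
lemma norm_sub_gauss_le_of_sqrt_le (h : CharData p α C c₀ L₀ m ψ v) (h3 : p ≤ 3)
    (hC : 1 ≤ C) (hc : 0 < c₀) {κ η : ℝ} (hκ1 : κ ≤ 1) (hη0 : 0 < η) (hη : η ≤ 1 / 2)
    (hCκ : C * κ ≤ η / 2)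
    (H : ∀ (L : ℕ) (θ : ℝ), |θ| ≤ κ → 1 / 16 ≤ L * θ ^ 2 → ‖ψ L θ‖ ≤ 1 - η)
    {n q : ℕ} (hq3 : 3 ≤ q) (hqn : q * q ≤ n) (hm : m ≤ n / q) (hn : L₀ ≤ n)
    (he1 : Real.exp (-(η / 2 * (q / 3 : ℕ))) ≤ 1 / n) (he2 : Real.exp (-(c₀ / 8 * q)) ≤ 1 / n)
    {t : ℝ} (htq : √(q : ℝ) / 2 ≤ t) (ht : t ≤ κ * √n) :
    ‖ψ n (t / √n) - (Real.exp (-(v n * (t / √n) ^ 2 / 2)) : ℝ)‖ ≤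
      10 * ((n : ℝ) ^ (1 - p / 2) * (t / (1 + t ^ 2))) := by
  have hn1 : 1 ≤ n := by nlinarith
  have hnR : (1 : ℝ) ≤ n := by exact_mod_cast hn1
  have hn0 : (0 : ℝ) < n := by linarith
  have hqR : (3 : ℝ) ≤ q := by exact_mod_cast hq3
  have hsq : 1 ≤ √(q : ℝ) := Real.one_le_sqrt.2 (by linarith)
  have ht0 : 1 / 2 ≤ t := by linarith
  have hsn : 0 < √(n : ℝ) := Real.sqrt_pos.2 hn0
  set L := n / q with hL
  have hqL : q ≤ L := (Nat.le_div_iff_mul_le (by omega)).2 hqn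
  have hdiv := Nat.div_add_mod n q
  have hmod := Nat.mod_lt n (show q > 0 by omega)
  rw [← hL] at hdiv
  have hnlt : (n : ℝ) ≤ (q + 1) * L := by
    have : n ≤ (q + 1) * L := by rw [add_mul]; omega
    exact_mod_cast this
  set θ := t / √(n : ℝ) with hθ
  have hθ0 : 0 < θ := by positivity
  have hθκ : |θ| ≤ κ := by rw [abs_of_pos hθ0, hθ, div_le_iff₀ hsn]; exact ht
  have hθ2 : θ ^ 2 = t ^ 2 / n := by rw [hθ, div_pow, Real.sq_sqrt hn0.le]
  have ht2 : q / 4 ≤ t ^ 2 := by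
    have := pow_le_pow_left₀ (by positivity) htq 2
    rw [div_pow, Real.sq_sqrt (by positivity)] at this
    linarith
  have hLpos : (0 : ℝ) < L := by exact_mod_cast (by omega)
  have hLθ : 1 / 16 ≤ L * θ ^ 2 := by
    rw [hθ2, ← mul_div_assoc, le_div_iff₀ hn0]
    have : (L : ℝ) * (q / 4) ≤ L * t ^ 2 := by gcongr
    nlinarith
  have b1 : ‖ψ n θ‖ ≤ 1 / n := by
    refine le_trans ?_ he1
    have hb : ‖ψ L θ‖ + C * |θ| ≤ Real.exp (-(η / 2)) := by
      have h1 := H L θ hθκ hLθ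
      have h2 : C * |θ| ≤ C * κ := by gcongr
      have := Real.add_one_le_exp (-(η / 2))
      linarith
    calc ‖ψ n θ‖ ≤ (‖ψ L θ‖ + C * |θ|) ^ (n / (3 * L)) := h.high L n θ hm
      _ ≤ Real.exp (-(η / 2)) ^ (n / (3 * L)) := by gcongr
      _ ≤ Real.exp (-(η / 2)) ^ (q / 3) := by
          refine pow_le_pow_of_le_one (Real.exp_pos _).le (Real.exp_le_one_iff.2 (by linarith)) ?_
          rw [Nat.le_div_iff_mul_le (by omega)]
          calc q / 3 * (3 * L) = (q / 3 * 3) * L := by ring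
            _ ≤ q * L := Nat.mul_le_mul_right _ (Nat.div_mul_le_self q 3)
            _ ≤ n := by omega
      _ = _ := by rw [← Real.exp_nat_mul]; congr 1; ring
  have b2 : Real.exp (-(v n * θ ^ 2 / 2)) ≤ 1 / n := by
    refine (h.gauss_le hn θ).trans (le_trans (Real.exp_le_exp.2 ?_) he2)
    have : c₀ * n * θ ^ 2 = c₀ * t ^ 2 := by rw [hθ2]; field_simp
    rw [this]
    nlinarith
  have b3 : 1 / (n : ℝ) ≤ 5 * ((n : ℝ) ^ (1 - p / 2) * (t / (1 + t ^ 2))) := by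
    have hnp : (√(n : ℝ))⁻¹ ≤ (n : ℝ) ^ (1 - p / 2) := by
      rw [Real.sqrt_eq_rpow, ← Real.rpow_neg hn0.le]
      exact Real.rpow_le_rpow_of_exponent_le hnR (by linarith)
    have htt : (√(n : ℝ))⁻¹ ≤ 5 * (t / (1 + t ^ 2)) := by
      have htn : t ≤ √n := ht.trans (mul_le_of_le_one_left hsn.le hκ1)
      rw [inv_eq_one_div, ← mul_div_assoc, div_le_div_iff₀ hsn (by positivity)]
      nlinarith
    calc 1 / (n : ℝ) = (√(n : ℝ))⁻¹ * (√(n : ℝ))⁻¹ := by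
          rw [← mul_inv, Real.mul_self_sqrt hn0.le, one_div]
      _ ≤ (n : ℝ) ^ (1 - p / 2) * (5 * (t / (1 + t ^ 2))) := by gcongr
      _ = _ := by ring
  have := norm_sub_le (ψ n θ) (Real.exp (-(v n * θ ^ 2 / 2)) : ℝ)
  rw [Complex.norm_real, Real.norm_of_nonneg (Real.exp_pos _).le] at this
  linarith

/-- q is the integer part of n^δ. With δ ≤ α/10 the polynomial constraints hold; δ ≤ (1-𝔪)/2 and K ≤
n^δ give mq ≤ n^{𝔪+2δ} ≤ n; and log n = o(n^δ) gives the exponential ones. The threshold does not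
depend on m. -/
lemma exists_block_number (hα : 0 < α) (hα2 : α ≤ 1 / 2) {𝔪 : ℝ} (h𝔪₁ : 𝔪 < 1) (K : ℝ)
    {e₁ e₂ : ℝ} (he₁ : 0 < e₁) (he₂ : 0 < e₂) (L₁ : ℕ) :
    ∃ N : ℕ, ∀ n, N ≤ n → ∀ m : ℕ, (m : ℝ) ≤ K * (n : ℝ) ^ 𝔪 → ∃ q : ℕ, 3 ≤ q ∧ q * q ≤ n ∧
      Nat.sqrt n * q ≤ n ∧ (q : ℝ) ^ 3 ≤ (n : ℝ) ^ (α / 2) ∧ L₁ ≤ n / q ∧ m ≤ n / q ∧ L₁ ≤ n ∧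
      Real.exp (-(e₁ * (q / 3 : ℕ))) ≤ 1 / n ∧ Real.exp (-(e₂ * q)) ≤ 1 / n := by
  set δ := min (α / 10) ((1 - 𝔪) / 2) with hδ
  have hδ0 : 0 < δ := lt_min (by linarith) (by linarith)
  have hδ1 : δ ≤ α / 10 := min_le_left _ _
  have hδ2 : δ ≤ (1 - 𝔪) / 2 := min_le_right _ _
  have T : Filter.Tendsto (fun n : ℕ => (n : ℝ) ^ δ) Filter.atTop Filter.atTop :=
    (tendsto_rpow_atTop hδ0).comp tendsto_natCast_atTop_atTop
  have ev1 := T.eventually_ge_atTop 3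
  have ev2 : ∀ᶠ n : ℕ in Filter.atTop, K ≤ (n : ℝ) ^ δ := T.eventually_ge_atTop K
  have evlog : ∀ e : ℝ, 0 < e → ∀ᶠ n : ℕ in Filter.atTop, Real.log n ≤ e * (n : ℝ) ^ δ := by
    intro e he
    have := (isLittleO_log_rpow_atTop hδ0).comp_tendsto tendsto_natCast_atTop_atTop
    filter_upwards [this.bound he, Filter.eventually_ge_atTop 1] with n hn h1
    have h1' : (1 : ℝ) ≤ n := by exact_mod_cast h1
    simp only [Function.comp, Real.norm_eq_abs] at hn
    rw [abs_of_nonneg (Real.log_nonneg h1'), abs_of_nonneg (by positivity)] at hn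
    exact hn
  have ev3 := evlog (e₁ / 12) (by positivity)
  have ev4 := evlog (e₂ / 2) (by positivity)
  have ev5 := Filter.eventually_ge_atTop (L₁ * L₁ + L₁ + 1)
  obtain ⟨N, hN⟩ := Filter.eventually_atTop.1 (ev1.and (ev2.and (ev3.and (ev4.and ev5))))
  refine ⟨N, fun n hn m hm => ?_⟩
  obtain ⟨h1, h2, h3, h4, h5⟩ := hN n hn
  have hnR : (1 : ℝ) ≤ n := by exact_mod_cast (by omega)
  have hn0 : (0 : ℝ) < n := by linarith
  set q := ⌊(n : ℝ) ^ δ⌋₊ with hq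
  have hqle : (q : ℝ) ≤ (n : ℝ) ^ δ := Nat.floor_le (by positivity)
  have hqlt : (n : ℝ) ^ δ < q + 1 := Nat.lt_floor_add_one _
  have hq3 : 3 ≤ q := Nat.le_floor (by exact_mod_cast h1)
  have hq3R : (3 : ℝ) ≤ q := by exact_mod_cast hq3
  have hsq : Nat.sqrt n * q ≤ n := by
    have hs : (Nat.sqrt n : ℝ) ≤ (n : ℝ) ^ (1 / 2 : ℝ) := by
      rw [← Real.sqrt_eq_rpow]; exact Real.nat_sqrt_le_real_sqrt
    have : (Nat.sqrt n : ℝ) * q ≤ n := by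
      calc (Nat.sqrt n : ℝ) * q ≤ (n : ℝ) ^ (1 / 2 : ℝ) * (n : ℝ) ^ δ := by gcongr
        _ = (n : ℝ) ^ (1 / 2 + δ) := by rw [← Real.rpow_add hn0]
        _ ≤ (n : ℝ) ^ (1 : ℝ) := Real.rpow_le_rpow_of_exponent_le hnR (by linarith)
        _ = n := Real.rpow_one _
    exact_mod_cast this
  refine ⟨q, hq3, ?_, hsq, ?_, ?_, ?_, by nlinarith, ?_, ?_⟩
  · have : (q : ℝ) * q ≤ n := by
      calc (q : ℝ) * q ≤ (n : ℝ) ^ δ * (n : ℝ) ^ δ := by gcongr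
        _ = (n : ℝ) ^ (δ + δ) := by rw [← Real.rpow_add hn0]
        _ ≤ (n : ℝ) ^ (1 : ℝ) := Real.rpow_le_rpow_of_exponent_le hnR (by linarith)
        _ = n := Real.rpow_one _
    exact_mod_cast this
  · calc (q : ℝ) ^ 3 ≤ ((n : ℝ) ^ δ) ^ 3 := by gcongr
      _ = (n : ℝ) ^ (δ * 3) := by
          rw [← Real.rpow_natCast, ← Real.rpow_mul hn0.le]; norm_num
      _ ≤ _ := Real.rpow_le_rpow_of_exponent_le hnR (by linarith)
  · have : L₁ ≤ Nat.sqrt n := by rw [Nat.le_sqrt]; omega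
    exact this.trans ((Nat.le_div_iff_mul_le (by omega)).2 hsq)
  · rw [Nat.le_div_iff_mul_le (by omega)]
    have : (m : ℝ) * q ≤ n := by
      calc (m : ℝ) * q ≤ ((n : ℝ) ^ δ * (n : ℝ) ^ 𝔪) * (n : ℝ) ^ δ := by
            gcongr
            exact hm.trans (by gcongr)
        _ = (n : ℝ) ^ (δ + 𝔪 + δ) := by rw [← Real.rpow_add hn0, ← Real.rpow_add hn0]
        _ ≤ (n : ℝ) ^ (1 : ℝ) := Real.rpow_le_rpow_of_exponent_le hnR (by linarith)
        _ = n := Real.rpow_one _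
    exact_mod_cast this
  · rw [one_div, ← Real.exp_log hn0, ← Real.exp_neg]
    refine Real.exp_le_exp.2 (neg_le_neg ?_)
    have : (q : ℝ) ≤ 3 * (q / 3 : ℕ) + 2 := by exact_mod_cast (by omega)
    have h1 : (1 : ℝ) ≤ (q / 3 : ℕ) := by exact_mod_cast (by omega)
    nlinarith
  · rw [one_div, ← Real.exp_log hn0, ← Real.exp_neg]
    refine Real.exp_le_exp.2 (neg_le_neg ?_)
    nlinarith

/-- Gaussian approximation of the characteristic function of the normalised sum. -/
theorem exists_norm_sub_gauss_le (h2 : 2 < p) (h3 : p ≤ 3) (hα : 0 < α) (hα2 : α ≤ 1 / 2)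
    (hC : 1 ≤ C) (hc : 0 < c₀) (hc1 : c₀ ≤ 1) (L₀ : ℕ) {𝔪 : ℝ} (h𝔪₁ : 𝔪 < 1) (K : ℝ) :
    ∃ B κ : ℝ, ∃ N : ℕ, 0 < B ∧ 0 < κ ∧ ∀ (m : ℕ) (ψ : ℕ → ℝ → ℂ) (v : ℕ → ℝ),
      CharData p α C c₀ L₀ m ψ v → ∀ n : ℕ, N ≤ n → (m : ℝ) ≤ K * (n : ℝ) ^ 𝔪 →
      L₀ ≤ n ∧ ∀ t : ℝ, 0 < t → t ≤ κ * √n →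
      ‖ψ n (t / √n) - (Real.exp (-(v n * (t / √n) ^ 2 / 2)) : ℝ)‖ ≤
        B * ((n : ℝ) ^ (1 - p / 2) * (t / (1 + t ^ 2))) := by
  obtain ⟨L₁, hL₁, hL₀, H1⟩ := exists_norm_le_exp h2 h3 hα hα2 hC hc hc1 L₀
  obtain ⟨κ, η, hκ, hκ1, hη, hη1, hCκ, H2⟩ := exists_norm_le_one_sub h2 h3 hα hα2 hC hc hc1 L₀
  obtain ⟨N, hN⟩ := exists_block_number hα hα2 h𝔪₁ K (e₁ := η / 2) (e₂ := c₀ / 8) (by positivity)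
    (by positivity) L₁
  have hG := gaussConst_pos hα hC
  set B₁ := gaussConst α C * (8 / (c₀ / 32) ^ 2) + 12 * C with hB₁
  have hB₁0 : 0 < B₁ := by positivity
  refine ⟨B₁ + 10, κ, N, by linarith, hκ, fun m ψ v h n hn hm => ?_⟩
  obtain ⟨q, q1, q2, q3, q4, q5, q6, q7, q8, q9⟩ := hN n hn m hm
  refine ⟨hL₀.trans q7, fun t ht htκ => ?_⟩
  have hnn : 0 ≤ (n : ℝ) ^ (1 - p / 2) * (t / (1 + t ^ 2)) := by positivity
  rcases le_total t (√(q : ℝ) / 2) with hle | hle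
  · refine (h.norm_sub_gauss_le_of_le_sqrt h2 h3 hα hα2 hC hc hc1 hL₀ (H1 m ψ v h) q1 q2 q3 q4 q5 ht
      hle).trans ?_
    rw [← hB₁]
    gcongr; linarith
  · refine (h.norm_sub_gauss_le_of_sqrt_le h3 hC hc hκ1 hη hη1 hCκ (H2 m ψ v h) q1 q2 q6 (hL₀.trans q7)
      q8 q9 hle htκ).trans ?_
    gcongr; linarith

end CharData
end WeakDep

/-! ### The joining estimates for weakly dependent arrays, with uniform constants -/

namespace WeakDep

namespace WeakArray
variable {Ω : Type u} [mΩ : MeasurableSpace Ω] {μ : Measure Ω} {p α M D : ℝ} {m : ℕ}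
  {𝓕 : Set ℤ → MeasurableSpace Ω} {X : ℤ → Ω → ℝ} {Xt : ℕ → ℤ → Ω → ℝ} {δ : ℕ → ℝ}
  [IsProbabilityMeasure μ]

lemma norm_chf_one_sub_le (h : WeakArray μ p α M D m 𝓕 X Xt δ) (θ : ℝ) :
    ‖chf μ X 1 θ - 1 + ((var μ X 1 * θ ^ 2 / 2 : ℝ) : ℂ)‖ ≤ 3 * M ^ 3 * |θ| ^ p := by
  have h2 := h.two_lt; have h3 := h.le_three
  have hM := h.one_le_M
  have hS : LpBound μ p (blockSum X 0 1) M := by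
    have : blockSum X 0 1 = X (0 + 1) := by ext ω; simp [blockSum]
    rw [this]; exact h.moment _
  have mS := hS.1
  have i := hS.integrable (by linarith)
  have i2 := hS.integrable_sq h2.le
  have ip := (hS.integrable_rpow (by linarith)).const_mul (3 * |θ| ^ p)
  have z : ∫ ω, (((θ * blockSum X 0 1 ω : ℝ) : ℂ) * Complex.I) ∂μ = 0 := by
    rw [integral_mul_const, integral_complex_ofReal, integral_const_mul, h.integral_blockSum]
    simp
  have zv : ∫ ω, ((θ ^ 2 / 2 * blockSum X 0 1 ω ^ 2 : ℝ) : ℂ) ∂μ =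
      ((var μ X 1 * θ ^ 2 / 2 : ℝ) : ℂ) := by
    rw [integral_complex_ofReal, integral_const_mul, var]; congr 1; ring
  have e : chf μ X 1 θ - 1 + ((var μ X 1 * θ ^ 2 / 2 : ℝ) : ℂ) = ∫ ω, (eI (θ * blockSum X 0 1 ω) - 1 -
      ((θ * blockSum X 0 1 ω : ℝ) : ℂ) * Complex.I +
      ((θ ^ 2 / 2 * blockSum X 0 1 ω ^ 2 : ℝ) : ℂ)) ∂μ := by
    have i0 : Integrable (fun ω => eI (θ * blockSum X 0 1 ω)) μ := integrable_eI (by fun_prop)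
    have i1 : Integrable (fun ω => eI (θ * blockSum X 0 1 ω) - 1) μ := i0.sub (integrable_const _)
    have i3 : Integrable (fun ω => ((θ * blockSum X 0 1 ω : ℝ) : ℂ) * Complex.I) μ :=
      ((i.const_mul θ).ofReal (𝕜 := ℂ)).mul_const _
    have i4 : Integrable (fun ω => ((θ ^ 2 / 2 * blockSum X 0 1 ω ^ 2 : ℝ) : ℂ)) μ :=
      (i2.const_mul (θ ^ 2 / 2)).ofReal (𝕜 := ℂ)
    have i5 : Integrable (fun ω => eI (θ * blockSum X 0 1 ω) - 1 -
        ((θ * blockSum X 0 1 ω : ℝ) : ℂ) * Complex.I) μ := i1.sub i3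
    rw [integral_add i5 i4, integral_sub i1 i3, z, zv, integral_sub i0 (integrable_const _)]
    simp [chf]
  rw [e]
  refine norm_integral_le_of_le ip (fun ω => ?_) ?_
  · have := norm_eI_sub_quadratic_le_rpow (θ * blockSum X 0 1 ω) h2.le h3
    rw [abs_mul, Real.mul_rpow (abs_nonneg _) (abs_nonneg _)] at this
    refine le_trans (le_of_eq ?_) (this.trans (le_of_eq (by ring)))
    congr 2; push_cast; ring
  · rw [integral_const_mul, mul_right_comm]
    have h1 := hS.integral_rpow_le (by linarith) (by linarith)
    have h4 : M ^ p ≤ M ^ 3 := by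
      rw [← Real.rpow_natCast M 3]
      exact Real.rpow_le_rpow_of_exponent_le hM (by push_cast; linarith)
    gcongr
    exact h1.trans h4

lemma norm_chf_one_sub_gauss_le (h : WeakArray μ p α M D m 𝓕 X Xt δ) {θ : ℝ} (hθ : |θ| ≤ 1) :
    ‖chf μ X 1 θ - (Real.exp (-(var μ X 1 * θ ^ 2 / 2)) : ℝ)‖ ≤
      (3 * M ^ 3 + (M ^ 2 + 2 * (M * D)) ^ 2) * |θ| ^ p := by
  have h2 := h.two_lt; have h3 := h.le_three
  have hM := h.one_le_M; have hD := h.one_le_D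
  have h1 := h.norm_chf_one_sub_le θ
  have hv0 := var_nonneg (μ := μ) (X := X) 1
  have hv := h.var_le 1
  rw [Nat.cast_one, mul_one] at hv
  set x := var μ X 1 * θ ^ 2 / 2 with hx
  have hx0 : 0 ≤ x := by positivity
  have he := abs_exp_neg_sub_sub_le hx0 le_rfl
  rw [max_eq_left hx0, neg_zero, Real.exp_zero, zero_sub, abs_neg, abs_of_nonneg hx0] at he
  have hθ4 : θ ^ 2 * θ ^ 2 ≤ |θ| ^ p := by
    have := pow_four_mul_sq_le h2 h3 (s := 1) (θ := θ) le_rfl (by simpa using hθ)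
    simpa using this
  have hxx : x * x ≤ (M ^ 2 + 2 * (M * D)) ^ 2 * |θ| ^ p := by
    calc x * x = (var μ X 1) ^ 2 / 4 * (θ ^ 2 * θ ^ 2) := by rw [hx]; ring
      _ ≤ (M ^ 2 + 2 * (M * D)) ^ 2 * |θ| ^ p := by
          gcongr
          have : (var μ X 1) ^ 2 ≤ (M ^ 2 + 2 * (M * D)) ^ 2 := by gcongr
          linarith [sq_nonneg (var μ X 1)]
  have e : chf μ X 1 θ - (Real.exp (-x) : ℝ) =
      (chf μ X 1 θ - 1 + (x : ℂ)) - ((Real.exp (-x) - 1 - -x : ℝ) : ℂ) := by push_cast; ring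
  rw [e]
  refine (norm_sub_le _ _).trans ?_
  rw [Complex.norm_real, Real.norm_eq_abs]
  linarith

/-- The index from which `covSum` exceeds s² may depend on the array, but the tail bound D l^{-α}
does not: beyond l₁ every `covSum` is at least s²/2. The first l₁ terms cost a bounded amount,
recovered once L is large. -/
lemma le_var (h : WeakArray μ p α M D m 𝓕 X Xt δ) {s : ℝ}
    (hs : ∀ᶠ l in Filter.atTop, s ^ 2 ≤ covSum μ X l) {l₁ : ℕ} (hl₁ : 1 ≤ l₁)
    (hl : 2 * (M * (D * (l₁ : ℝ) ^ (-α))) ≤ s ^ 2 / 2) {L : ℕ}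
    (hL : l₁ * (s ^ 2 / 2 + (M ^ 2 + 2 * (M * D))) ≤ L * (s ^ 2 / 4)) (hlL : l₁ ≤ L) :
    s ^ 2 / 4 * L ≤ var μ X L := by
  have hM := h.one_le_M; have hD := h.one_le_D
  obtain ⟨N, hN⟩ := Filter.eventually_atTop.1 hs
  have hcov : ∀ l, l₁ ≤ l → s ^ 2 / 2 ≤ covSum μ X l := by
    intro l hll
    have h1 := h.abs_covSum_sub_le (hl₁.trans hll) N
    have h2 := hN (l + N) (by omega)
    have h3 : (l : ℝ) ^ (-α) ≤ (l₁ : ℝ) ^ (-α) :=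
      Real.rpow_le_rpow_of_nonpos (by exact_mod_cast hl₁) (by exact_mod_cast hll)
        (by linarith [h.α_pos])
    have h4 : 2 * (M * (D * (l : ℝ) ^ (-α))) ≤ 2 * (M * (D * (l₁ : ℝ) ^ (-α))) := by gcongr
    have := (abs_le.1 h1).2
    linarith
  obtain ⟨k, rfl⟩ := Nat.exists_eq_add_of_le hlL
  rw [h.var_eq_sum, Finset.sum_range_add]
  have s1 : -((M ^ 2 + 2 * (M * D)) * l₁) ≤ ∑ l ∈ Finset.range l₁, covSum μ X l := by
    calc _ = ∑ l ∈ Finset.range l₁, -(M ^ 2 + 2 * (M * D)) := by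
          rw [Finset.sum_const, Finset.card_range, nsmul_eq_mul]; ring
      _ ≤ _ := Finset.sum_le_sum fun l _ => (abs_le.1 (h.abs_covSum_le l)).1
  have s2 : s ^ 2 / 2 * k ≤ ∑ l ∈ Finset.range k, covSum μ X (l₁ + l) := by
    calc _ = ∑ l ∈ Finset.range k, s ^ 2 / 2 := by
          rw [Finset.sum_const, Finset.card_range, nsmul_eq_mul]; ring
      _ ≤ _ := Finset.sum_le_sum fun l _ => hcov _ (by omega)
  push_cast at hL ⊢
  linarith

theorem charData (h : WeakArray μ p α M D m 𝓕 X Xt δ) {A C c₀ : ℝ} {L₀ : ℕ} (hA1 : 1 ≤ A)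
    (hA : ∀ (a : ℤ) (L : ℕ), LpBound μ p (blockSum X a L) (A * √L))
    (hC : C = 1000 * (A + D) ^ 4 + 3 * M ^ 3 + (M ^ 2 + 2 * (M * D)) ^ 2)
    (hv : ∀ L, L₀ ≤ L → c₀ * L ≤ var μ X L) :
    CharData p α C c₀ L₀ m (chf μ X) (var μ X) := by
  have h2 := h.two_lt; have h3 := h.le_three
  have hM := h.one_le_M; have hD := h.one_le_D
  set G := A + D with hG
  have hG2 : 2 ≤ G := by linarith
  set B := M ^ 2 + 2 * (M * D) with hB
  have hB1 : 1 ≤ B := by nlinarith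
  have hM3 : 0 < M ^ 3 := by positivity
  have hGG : G ≤ G ^ 2 := by nlinarith
  have hG4 : G ^ 2 ≤ G ^ 4 := pow_le_pow_right₀ (by linarith) (by norm_num)
  have hBB : B ≤ B ^ 2 := by nlinarith
  have c1 : 3 * D ≤ C := by nlinarith [sq_nonneg B]
  have c2 : 100 * G ^ 2 ≤ C := by nlinarith [sq_nonneg B]
  have c3 : 1000 * G ^ 4 ≤ C := by nlinarith [sq_nonneg B]
  have c4 : B ≤ C := by nlinarith [sq_nonneg (G ^ 2)]
  have c5 : 3 * M ^ 3 + B ^ 2 ≤ C := by nlinarith [sq_nonneg (G ^ 2)]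
  have hcov : ∀ a b : ℕ, (var μ X (a + b) - var μ X a - var μ X b) / 2 =
      ∫ ω, (blockSum X a b ω - truncSum Xt a b ω) * blockSum X 0 a ω ∂μ := by
    intro a b; rw [h.var_add hA1 hA]; ring
  refine ⟨fun L θ => norm_integral_eI_le _, fun a b θ => ?_, fun a b l θ hl hla hlb => ?_,
    fun a b l θ hl hla hlb hθ => ?_, fun a b l hl hla hlb => ?_, var_nonneg, fun L => ?_, hv,
    fun θ hθ => ?_, fun L n θ hmL => ?_⟩
  · refine (h.norm_chf_add_sub_mul_le a b θ).trans ?_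
    gcongr; linarith
  · exact (h.norm_chf_add_sub_mul_le_of_le hA1 hA hl hla hlb θ).trans (by gcongr)
  · rw [hcov]
    exact (h.norm_chf_add_sub_mul_add_le hA1 hA hl hla hlb θ hθ).trans (by gcongr)
  · have := h.abs_integral_remainder_mul_le hA1 hA hl hla hlb
    rw [← hcov, abs_div, abs_two] at this
    refine le_trans (show _ ≤ 48 * G ^ 2 * ((l : ℝ) ^ (-α) * √((a + b : ℕ) : ℝ) + √l) by linarith) ?_
    gcongr
    linarith [sq_nonneg G]
  · exact (h.var_le L).trans (by gcongr)
  · exact (h.norm_chf_one_sub_gauss_le hθ).trans (by gcongr)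
  · refine (h.norm_chf_le_pow hmL θ n).trans ?_
    gcongr

end WeakArray

/-- The characteristic functions of block sums satisfy `CharData` with constants that depend on
the moment and dependence bounds only. -/
theorem exists_charData {p α M D s : ℝ} (h2 : 2 < p) (hα : 0 < α) (hM : 1 ≤ M) (hD : 1 ≤ D)
    (hs : 0 < s) :
    ∃ A C c₀ : ℝ, ∃ L₀ : ℕ, 1 ≤ C ∧ 0 < c₀ ∧ c₀ ≤ 1 ∧ 1 ≤ L₀ ∧
      ∀ (Ω : Type u) [MeasurableSpace Ω] (μ : Measure Ω) [IsProbabilityMeasure μ] (m : ℕ)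
        (𝓕 : Set ℤ → MeasurableSpace Ω) (X : ℤ → Ω → ℝ) (Xt : ℕ → ℤ → Ω → ℝ) (δ : ℕ → ℝ),
        WeakArray μ p α M D m 𝓕 X Xt δ → (∀ᶠ l in Filter.atTop, s ^ 2 ≤ WeakArray.covSum μ X l) →
        (∀ (a : ℤ) (L : ℕ), LpBound μ p (blockSum X a L) (A * √L)) ∧
        CharData p α C c₀ L₀ m (chf μ X) (var μ X) := by
  -- r < 1 is the contraction factor of the halving recursion, and Q below solves Q = rQ + 24(M +
  -- 2D) + 2D; adding M + D gives an admissible constant A.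
  set r := ((2 / 3 : ℝ) ^ (p / 2 - 1)) ^ (1 / p) with hr
  have hr0 : 0 ≤ r := by positivity
  have hr1 : r < 1 := Real.rpow_lt_one (by positivity)
    (Real.rpow_lt_one (by norm_num) (by norm_num) (by linarith)) (by positivity)
  have hrp : r ^ p = (2 / 3 : ℝ) ^ (p / 2 - 1) := by
    rw [hr, ← Real.rpow_mul (by positivity), one_div, inv_mul_cancel₀ (by linarith), Real.rpow_one]
  set Q := (24 * (M + 2 * D) + 2 * D) / (1 - r) with hQ
  have hQ0 : 0 ≤ Q := div_nonneg (by linarith) (by linarith)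
  have hQr : Q * (1 - r) = 24 * (M + 2 * D) + 2 * D := div_mul_cancel₀ _ (by linarith)
  set A := Q + M + D with hA
  set B := M ^ 2 + 2 * (M * D) with hB
  have ht : Filter.Tendsto (fun l : ℕ => 2 * (M * (D * (l : ℝ) ^ (-α)))) Filter.atTop
      (nhds (2 * (M * (D * 0)))) :=
    (((((tendsto_rpow_neg_atTop hα).comp tendsto_natCast_atTop_atTop).const_mul D).const_mul
      M).const_mul 2)
  simp only [mul_zero] at ht
  obtain ⟨l₁, hl₁, hl⟩ := ((ht.eventually (gt_mem_nhds (show 0 < s ^ 2 / 2 by positivity))).and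
    (Filter.eventually_ge_atTop 1)).exists
  obtain ⟨L', hL'⟩ := exists_nat_ge ((l₁ * (s ^ 2 / 2 + B)) / (s ^ 2 / 4))
  rw [div_le_iff₀ (by positivity)] at hL'
  refine ⟨A, 1000 * (A + D) ^ 4 + 3 * M ^ 3 + B ^ 2, min (s ^ 2 / 4) 1, max L' l₁, ?_,
    lt_min (by positivity) one_pos, min_le_right _ _, by omega, ?_⟩
  · have : 1 ≤ A + D := by linarith
    have : 1 ≤ (A + D) ^ 4 := one_le_pow₀ this
    have : 0 ≤ M ^ 3 := by positivity
    nlinarith [sq_nonneg B]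
  intro Ω _ μ _ m 𝓕 X Xt δ h hcov
  have hbd : ∀ (a : ℤ) (L : ℕ), LpBound μ p (blockSum X a L) (A * √L) := by
    intro a L
    rcases Nat.eq_zero_or_pos L with rfl | hL
    · have : blockSum X a 0 = fun _ => 0 := by ext ω; simp [blockSum]
      rw [this]; simpa using LpBound.zero
    · refine (h.bound_blockSum_sub (A := A) hr0 hrp (by linarith) ?_ L hL a).mono (by linarith)
      have : r * M ≤ M := by nlinarith
      have : r * D ≤ D := by nlinarith
      rw [hA]; linarith
  refine ⟨hbd, h.charData (by linarith) hbd rfl fun L hL => ?_⟩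
  refine le_trans ?_ (h.le_var hcov hl hl₁.le (L := L) (hL'.trans ?_) (by omega))
  · gcongr; exact min_le_left _ _
  · have : (L' : ℝ) ≤ L := by exact_mod_cast (by omega)
    gcongr

end WeakDep

namespace WeakDep

/-! ### Esseen's smoothing inequality -/

/-- The (unnormalised) Fejér kernel `(1 - cos v) / v²`. -/
noncomputable def fejer (v : ℝ) : ℝ := ∫ t in (0 : ℝ)..1, (1 - t) * Real.cos (t * v)

lemma continuous_fejer : Continuous fejer :=
  intervalIntegral.continuous_parametric_intervalIntegral_of_continuous' (by fun_prop) _ _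

lemma fejer_eq {v : ℝ} (hv : v ≠ 0) : fejer v = (1 - Real.cos v) / v ^ 2 := by
  have hd : ∀ t ∈ Set.uIcc (0 : ℝ) 1, HasDerivAt
      (fun t : ℝ => (1 - t) * (Real.sin (t * v) / v) - Real.cos (t * v) / v ^ 2)
      ((1 - t) * Real.cos (t * v)) t := by
    intro t _
    have h1 : HasDerivAt (fun t : ℝ => t * v) v t := by simpa using (hasDerivAt_id t).mul_const v
    have h2 := ((hasDerivAt_id t).const_sub 1).mul (h1.sin.div_const v)
    have h3 := h1.cos.div_const (v ^ 2)
    refine (h2.sub h3).congr_deriv ?_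
    simp only [id]
    field_simp
    ring
  have := intervalIntegral.integral_eq_sub_of_hasDerivAt hd
    ((by fun_prop : Continuous fun t : ℝ => (1 - t) * Real.cos (t * v)).intervalIntegrable _ _)
  rw [fejer, this]
  simp
  ring

lemma fejer_nonneg (v : ℝ) : 0 ≤ fejer v := by
  rcases eq_or_ne v 0 with rfl | hv
  · unfold fejer
    refine intervalIntegral.integral_nonneg zero_le_one fun t ht => ?_
    simp; linarith [ht.2]
  · rw [fejer_eq hv]
    exact div_nonneg (by linarith [Real.cos_le_one v]) (by positivity)

lemma fejer_le (v : ℝ) : fejer v ≤ 4 * (1 + v ^ 2)⁻¹ := by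
  have hpos : 0 < 1 + v ^ 2 := by positivity
  rw [← div_eq_mul_inv, le_div_iff₀ hpos]
  have h1 : fejer v ≤ 1 := by
    have : ‖fejer v‖ ≤ 1 * |(1 : ℝ) - 0| := by
      refine intervalIntegral.norm_integral_le_of_norm_le_const fun t ht => ?_
      rw [Set.uIoc_of_le zero_le_one] at ht
      rw [norm_mul, Real.norm_eq_abs, Real.norm_eq_abs, abs_of_nonneg (by linarith [ht.2])]
      exact mul_le_one₀ (by linarith [ht.1]) (abs_nonneg _) (Real.abs_cos_le_one _)
    rw [Real.norm_eq_abs] at this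
    simpa using (le_abs_self _).trans this
  have h2 : fejer v * v ^ 2 ≤ 2 := by
    rcases eq_or_ne v 0 with rfl | hv
    · simp
    · rw [fejer_eq hv, div_mul_cancel₀ _ (by positivity)]
      linarith [Real.neg_one_le_cos v]
  linarith

lemma integrable_fejer : Integrable fejer :=
  (integrable_inv_one_add_sq.const_mul 4).mono' continuous_fejer.aestronglyMeasurable
    (Filter.Eventually.of_forall fun v => by
      rw [Real.norm_of_nonneg (fejer_nonneg v)]; exact fejer_le v)

/-- The finite measure with density `fejer`. -/
noncomputable def fejerMeasure : Measure ℝ :=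
  volume.withDensity fun v => ENNReal.ofReal (fejer v)

instance : IsFiniteMeasure fejerMeasure :=
  isFiniteMeasure_withDensity_ofReal integrable_fejer.2

lemma fejerMeasure_real {s : Set ℝ} (hs : MeasurableSet s) :
    fejerMeasure.real s = ∫ v in s, fejer v := by
  rw [fejerMeasure, Measure.real, withDensity_apply _ hs,
    ← ofReal_integral_eq_lintegral_ofReal integrable_fejer.integrableOn
      (Filter.Eventually.of_forall fejer_nonneg), ENNReal.toReal_ofReal]
  exact integral_nonneg fejer_nonneg

/-- Integrating cos(tv) in v produces sin(tz)/t, written with `Real.sinc` so that t = 0 needs no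
exception. -/
lemma intervalIntegral_fejer (z : ℝ) :
    ∫ v in (0 : ℝ)..z, fejer v = ∫ t in (0 : ℝ)..1, (1 - t) * (z * Real.sinc (t * z)) := by
  unfold fejer
  rw [intervalIntegral_intervalIntegral_swap]
  · refine intervalIntegral.integral_congr fun t _ => ?_
    rw [intervalIntegral.integral_const_mul]
    congr 1
    rcases eq_or_ne t 0 with rfl | ht
    · simp
    · simp only [mul_comm t]
      rw [intervalIntegral.integral_comp_mul_right _ ht, integral_cos]
      rcases eq_or_ne z 0 with rfl | hz
      · simp
      · rw [Real.sinc_of_ne_zero (mul_ne_zero hz ht)]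
        simp
        field_simp
  · exact (by fun_prop : Continuous (Function.uncurry fun v t : ℝ => (1 - t) * Real.cos (t * v)))
      |>.continuousOn.integrableOn_compact (isCompact_uIcc.prod isCompact_uIcc) |>.mono_set
        (Set.prod_mono Set.uIoc_subset_uIcc Set.uIoc_subset_uIcc)

lemma fejerMeasure_Ici (z : ℝ) :
    fejerMeasure.real (Set.Ici z) = fejerMeasure.real (Set.Ici 0) - ∫ v in (0 : ℝ)..z, fejer v := by
  rw [fejerMeasure_real measurableSet_Ici, fejerMeasure_real measurableSet_Ici,
    integral_Ici_eq_integral_Ioi, integral_Ici_eq_integral_Ioi,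
    ← intervalIntegral.integral_Ioi_sub_Ioi' integrable_fejer.integrableOn
      integrable_fejer.integrableOn]
  ring

/-- The Fourier representation of a cdf smoothed by the Fejér kernel. -/
lemma integral_cdf_fejer (P : Measure ℝ) [IsProbabilityMeasure P] (hP : Integrable (fun y => y) P)
    (x : ℝ) {T : ℝ} (hT : 0 < T) :
    ∫ v, cdf P (x + v / T) ∂fejerMeasure = fejerMeasure.real (Set.Ici 0) -
      ∫ t in (0 : ℝ)..1, (1 - t) * ∫ y, T * (y - x) * Real.sinc (t * (T * (y - x))) ∂P := by
  have h1 : ∀ v, cdf P (x + v / T) = ∫ y, Set.indicator {z : ℝ × ℝ | z.2 ≤ x + z.1 / T} 1 (v, y) ∂P := by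
    intro v
    rw [cdf_eq_real, ← integral_indicator_one measurableSet_Iic]
    rfl
  have hmeas : MeasurableSet {z : ℝ × ℝ | z.2 ≤ x + z.1 / T} :=
    measurableSet_le (by fun_prop) (by fun_prop)
  have h2 : ∀ y, ∫ v, Set.indicator {z : ℝ × ℝ | z.2 ≤ x + z.1 / T} (1 : ℝ × ℝ → ℝ) (v, y) ∂fejerMeasure =
      fejerMeasure.real (Set.Ici 0) -
        ∫ t in (0 : ℝ)..1, (1 - t) * (T * (y - x) * Real.sinc (t * (T * (y - x)))) := by
    intro y
    rw [← intervalIntegral_fejer, ← fejerMeasure_Ici, ← integral_indicator_one measurableSet_Ici]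
    congr 1; ext v
    simp only [Set.indicator, Set.mem_ofPred_eq, Set.mem_Ici]
    have : y ≤ x + v / T ↔ T * (y - x) ≤ v := by
      rw [← sub_le_iff_le_add', le_div_iff₀ hT, mul_comm]
    simp only [this]
    rfl
  have : IsFiniteMeasure (volume.restrict (Set.uIoc (0 : ℝ) 1)) := by
    rw [Set.uIoc_of_le zero_le_one]; infer_instance
  have h_fub : Integrable (Function.uncurry fun (t y : ℝ) =>
      (1 - t) * (T * (y - x) * Real.sinc (t * (T * (y - x)))))
      ((volume.restrict (Set.uIoc 0 1)).prod P) := by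
    have hb : Integrable (fun z : ℝ × ℝ => |T * (z.2 - x)|)
        ((volume.restrict (Set.uIoc 0 1)).prod P) := by
      have : Integrable (fun y => |T * (y - x)|) P := ((hP.sub (integrable_const x)).const_mul T).abs
      exact this.comp_snd _
    refine hb.mono' (Continuous.aestronglyMeasurable (by
      have := Real.continuous_sinc
      fun_prop)) ?_
    have hae : ∀ᵐ z ∂((volume.restrict (Set.uIoc (0 : ℝ) 1)).prod P), z.1 ∈ Set.uIoc (0 : ℝ) 1 :=
      Measure.quasiMeasurePreserving_fst.ae (ae_restrict_mem measurableSet_uIoc)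
    filter_upwards [hae] with z hz
    rw [Set.uIoc_of_le zero_le_one] at hz
    simp only [Function.uncurry, Real.norm_eq_abs]
    rw [abs_mul, abs_mul, abs_of_nonneg (show 0 ≤ 1 - z.1 by linarith [hz.2])]
    have h1 := Real.abs_sinc_le_one (z.1 * (T * (z.2 - x)))
    calc (1 - z.1) * (|T * (z.2 - x)| * |Real.sinc (z.1 * (T * (z.2 - x)))|)
        ≤ 1 * (|T * (z.2 - x)| * 1) := by
          gcongr
          · linarith [hz.1]
      _ = _ := by ring
  simp_rw [h1]
  rw [integral_integral_swap]
  · simp_rw [h2]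
    have hi2 : Integrable (fun y => ∫ t in (0 : ℝ)..1, (1 - t) *
        (T * (y - x) * Real.sinc (t * (T * (y - x))))) P := by
      simp_rw [intervalIntegral.intervalIntegral_eq_integral_uIoc]
      simp only [if_pos (zero_le_one' ℝ), one_smul]
      exact h_fub.integral_prod_right
    rw [integral_sub (integrable_const _) hi2, intervalIntegral_integral_swap h_fub |>.symm]
    simp [integral_const_mul]
  · exact (integrable_const (1 : ℝ)).indicator hmeas

lemma integral_sin_eq_im (P : Measure ℝ) [IsProbabilityMeasure P] (x s : ℝ) :
    ∫ y, Real.sin (s * (y - x)) ∂P = (Complex.exp (-(s * x) * Complex.I) * charFun P s).im := by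
  have hi : Integrable (fun y : ℝ => Complex.exp (-(s * x) * Complex.I) *
      Complex.exp (s * y * Complex.I)) P := by
    refine Integrable.of_bound (Continuous.aestronglyMeasurable (by fun_prop)) 1
      (Filter.Eventually.of_forall fun y => le_of_eq ?_)
    rw [norm_mul, ← Complex.ofReal_mul, ← Complex.ofReal_mul, ← Complex.ofReal_neg,
      Complex.norm_exp_ofReal_mul_I, Complex.norm_exp_ofReal_mul_I, one_mul]
  rw [charFun_apply_real, ← integral_const_mul]
  have := integral_im hi
  simp only [RCLike.im_to_complex] at this
  rw [← this]
  congr 1; ext y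
  rw [← Complex.exp_add, ← add_mul]
  rw [show (-(s * x) + s * y : ℂ) = ((s * (y - x) : ℝ) : ℂ) by push_cast; ring,
    Complex.exp_ofReal_mul_I_im]

lemma abs_integral_sinc_sub_le {P Q : Measure ℝ} [IsProbabilityMeasure P] [IsProbabilityMeasure Q]
    (x : ℝ) {s B : ℝ} (hs : 0 < s) (hB : ‖charFun P s - charFun Q s‖ ≤ s * B) :
    |∫ y, (y - x) * Real.sinc (s * (y - x)) ∂P - ∫ y, (y - x) * Real.sinc (s * (y - x)) ∂Q| ≤ B := by
  have e : ∀ y : ℝ, (y - x) * Real.sinc (s * (y - x)) = s⁻¹ * Real.sin (s * (y - x)) := by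
    intro y
    rcases eq_or_ne (y - x) 0 with h | h
    · simp [h]
    · rw [Real.sinc_of_ne_zero (mul_ne_zero hs.ne' h)]; field_simp
  simp_rw [e]
  rw [integral_const_mul, integral_const_mul, ← mul_sub, integral_sin_eq_im, integral_sin_eq_im,
    ← Complex.sub_im, ← mul_sub, abs_mul, abs_of_pos (inv_pos.2 hs), inv_mul_le_iff₀ hs]
  refine (Complex.abs_im_le_norm _).trans (le_trans (le_of_eq ?_) hB)
  rw [norm_mul, ← Complex.ofReal_mul, ← Complex.ofReal_neg, Complex.norm_exp_ofReal_mul_I, one_mul]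

/-- In the Fourier representation the masses of the half-line cancel, and the integrand at t is
bounded by εT/(1 + (Tt)²). Its integral over [0,1] is ε arctan T ≤ επ/2 ≤ 2ε. The shape t/(1+t²) of
the hypothesis is what removes the singularity at 0 and makes the bound independent of T. -/
lemma abs_integral_cdf_fejer_sub_le {P Q : Measure ℝ} [IsProbabilityMeasure P]
    [IsProbabilityMeasure Q] (hP : Integrable (fun y => y) P) (hQ : Integrable (fun y => y) Q)
    {T ε : ℝ} (hT : 0 < T) (hε : 0 ≤ ε)
    (h : ∀ t, 0 < t → t ≤ T → ‖charFun P t - charFun Q t‖ ≤ ε * (t / (1 + t ^ 2))) (x : ℝ) :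
    |∫ v, cdf P (x + v / T) ∂fejerMeasure - ∫ v, cdf Q (x + v / T) ∂fejerMeasure| ≤ 2 * ε := by
  rw [integral_cdf_fejer P hP x hT, integral_cdf_fejer Q hQ x hT, sub_sub_sub_cancel_left,
    abs_sub_comm]
  have hc : ∀ ρ : Measure ℝ, IsProbabilityMeasure ρ → Integrable (fun y => y) ρ →
      Continuous fun t : ℝ => ∫ y, T * (y - x) * Real.sinc (t * (T * (y - x))) ∂ρ := by
    intro ρ _ hR
    have := Real.continuous_sinc
    refine continuous_of_dominated (bound := fun y => |T * (y - x)|)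
      (fun t => Continuous.aestronglyMeasurable (by fun_prop))
      (fun t => Filter.Eventually.of_forall fun y => ?_)
      ((hR.sub (integrable_const x)).const_mul T).abs
      (Filter.Eventually.of_forall fun y => by fun_prop)
    rw [norm_mul]
    exact mul_le_of_le_one_right (norm_nonneg _) (Real.abs_sinc_le_one _)
  have hcP := hc P inferInstance hP
  have hcQ := hc Q inferInstance hQ
  rw [← intervalIntegral.integral_sub (Continuous.intervalIntegrable (by fun_prop) _ _)
    (Continuous.intervalIntegrable (by fun_prop) _ _)]
  simp_rw [← mul_sub]
  have hbound : ∀ t ∈ Set.Ioc (0 : ℝ) 1,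
      ‖(1 - t) * (∫ y, T * (y - x) * Real.sinc (t * (T * (y - x))) ∂P -
        ∫ y, T * (y - x) * Real.sinc (t * (T * (y - x))) ∂Q)‖ ≤ ε * (T * (1 + (T * t) ^ 2)⁻¹) := by
    intro t ht
    have hs : 0 < T * t := mul_pos hT ht.1
    have k := abs_integral_sinc_sub_le (P := P) (Q := Q) x (s := T * t)
      (B := ε * (1 + (T * t) ^ 2)⁻¹) hs
      ((h _ hs (mul_le_of_le_one_right hT.le ht.2)).trans (le_of_eq (by ring)))
    have e : ∀ ρ : Measure ℝ, ∫ y, T * (y - x) * Real.sinc (t * (T * (y - x))) ∂ρ =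
        T * ∫ y, (y - x) * Real.sinc (T * t * (y - x)) ∂ρ := by
      intro ρ
      rw [← integral_const_mul]
      congr 1; ext y
      rw [show t * (T * (y - x)) = T * t * (y - x) by ring]; ring
    rw [e, e, ← mul_sub, norm_mul, Real.norm_eq_abs, Real.norm_eq_abs, abs_mul, abs_of_pos hT,
      abs_of_nonneg (show 0 ≤ 1 - t by linarith [ht.2])]
    calc _ ≤ 1 * (T * (ε * (1 + (T * t) ^ 2)⁻¹)) := by
          gcongr
          linarith [ht.1]
      _ = _ := by ring
  have hle := intervalIntegral.norm_integral_le_of_norm_le (μ := volume) zero_le_one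
    (Filter.Eventually.of_forall hbound)
    (Continuous.intervalIntegrable (Continuous.mul continuous_const (continuous_const.mul
      (Continuous.inv₀ (by fun_prop) fun t => by positivity))) _ _)
  rw [Real.norm_eq_abs, intervalIntegral.integral_const_mul, intervalIntegral.integral_const_mul,
    intervalIntegral.mul_integral_comp_mul_left (f := fun s : ℝ => (1 + s ^ 2)⁻¹),
    integral_inv_one_add_sq] at hle
  refine hle.trans ?_
  rw [mul_comm]
  gcongr
  have := Real.arctan_lt_pi_div_two (T * 1)
  have := Real.pi_le_four
  simp only [mul_zero, Real.arctan_zero, sub_zero]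
  linarith

lemma fejerMeasure_univ_pos : 0 < fejerMeasure.real Set.univ := by
  rw [fejerMeasure_real MeasurableSet.univ, setIntegral_univ]
  have h1 : fejer 1 ≠ 0 := by
    rw [fejer_eq one_ne_zero]
    have := Real.cos_one_le
    norm_num
    linarith
  exact integral_pos_of_integrable_nonneg_nonzero continuous_fejer integrable_fejer fejer_nonneg h1

/-- The kernel is integrable, so a large window carries most of its mass. The ratio 1/3 lets the
supremum be absorbed in the smoothing inequality. -/
lemma exists_fejerMeasure_compl_le :
    ∃ a : ℝ, 0 < a ∧ fejerMeasure.real (Set.Icc (-a) a)ᶜ ≤ fejerMeasure.real (Set.Icc (-a) a) / 3 := by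
  have hW := fejerMeasure_univ_pos
  have hmono : Monotone fun n : ℕ => Set.Icc (-(n : ℝ)) n := fun i j hij =>
    Set.Icc_subset_Icc (by simpa using hij) (by simpa using hij)
  have hU : ⋃ n : ℕ, Set.Icc (-(n : ℝ)) n = Set.univ := by
    ext x
    simp only [Set.mem_iUnion, Set.mem_Icc, Set.mem_univ, iff_true]
    obtain ⟨n, hn⟩ := exists_nat_ge |x|
    exact ⟨n, abs_le.1 hn⟩
  have ht := tendsto_measure_iUnion_atTop (μ := fejerMeasure) hmono
  rw [hU] at ht
  have ht' := (ENNReal.tendsto_toReal (measure_ne_top fejerMeasure Set.univ)).comp ht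
  obtain ⟨n, hn, hn1⟩ := ((ht'.eventually (lt_mem_nhds (show 3 / 4 * fejerMeasure.real Set.univ <
    (fejerMeasure Set.univ).toReal by change _ < fejerMeasure.real Set.univ; linarith))).and
    (Filter.eventually_ge_atTop 1)).exists
  refine ⟨n, by exact_mod_cast hn1, ?_⟩
  change _ < fejerMeasure.real (Set.Icc (-(n : ℝ)) n) at hn
  rw [measureReal_compl measurableSet_Icc]
  linarith

lemma le_integral_fejer {a c Δ : ℝ} {E : ℝ → ℝ} (hE : Measurable E) (hEΔ : ∀ v, |E v| ≤ Δ)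
    (hc : ∀ v ∈ Set.Icc (-a) a, c ≤ E v) :
    c * fejerMeasure.real (Set.Icc (-a) a) - Δ * fejerMeasure.real (Set.Icc (-a) a)ᶜ ≤
      ∫ v, E v ∂fejerMeasure := by
  have hi : Integrable E fejerMeasure := Integrable.of_bound hE.aestronglyMeasurable Δ
    (Filter.Eventually.of_forall hEΔ)
  have i1 : Integrable ((Set.Icc (-a) a).indicator fun _ => c) fejerMeasure :=
    (integrable_const c).indicator measurableSet_Icc
  have i2 : Integrable ((Set.Icc (-a) a)ᶜ.indicator fun _ => Δ) fejerMeasure :=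
    (integrable_const Δ).indicator measurableSet_Icc.compl
  calc _ = ∫ v, ((Set.Icc (-a) a).indicator (fun _ => c) v -
        (Set.Icc (-a) a)ᶜ.indicator (fun _ => Δ) v) ∂fejerMeasure := by
        rw [integral_sub i1 i2, integral_indicator_const _ measurableSet_Icc,
          integral_indicator_const _ measurableSet_Icc.compl]
        simp [mul_comm]
    _ ≤ _ := by
        refine integral_mono (i1.sub i2) hi fun v => ?_
        by_cases hv : v ∈ Set.Icc (-a) a
        · simp only [Set.indicator_of_mem hv, Set.indicator_of_notMem (fun h => h hv : v ∉ (Set.Icc (-a) a)ᶜ)]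
          simpa using hc v hv
        · simp only [Set.indicator_of_notMem hv, Set.indicator_of_mem (Set.mem_compl hv)]
          linarith [(abs_le.1 (hEΔ v)).1]

/-- **Esseen's smoothing inequality**, for differences of characteristic functions bounded by a
multiple of `t / (1 + t²)`. -/
theorem exists_smoothing : ∃ C₁ C₂ : ℝ, 0 < C₁ ∧ 0 < C₂ ∧
    ∀ (P Q : Measure ℝ) [IsProbabilityMeasure P] [IsProbabilityMeasure Q],
      Integrable (fun y => y) P → Integrable (fun y => y) Q →
      ∀ T ε Λ : ℝ, 0 < T → 0 ≤ ε → 0 ≤ Λ → (∀ x y, x ≤ y → cdf Q y - cdf Q x ≤ Λ * (y - x)) →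
      (∀ t, 0 < t → t ≤ T → ‖charFun P t - charFun Q t‖ ≤ ε * (t / (1 + t ^ 2))) →
      ∀ x, |cdf P x - cdf Q x| ≤ C₁ * ε + C₂ * (Λ / T) := by
  obtain ⟨a, ha, hB⟩ := exists_fejerMeasure_compl_le
  have hW := fejerMeasure_univ_pos
  have hAB := measureReal_compl (μ := fejerMeasure) (measurableSet_Icc (a := -a) (b := a))
  set A := fejerMeasure.real (Set.Icc (-a) a) with hAdef
  set B := fejerMeasure.real (Set.Icc (-a) a)ᶜ with hBdef
  have hA : 0 < A := by linarith
  have hB0 : 0 ≤ B := measureReal_nonneg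
  refine ⟨3 / A, 3 * a, by positivity, by positivity, fun P Q _ _ hP hQ T ε Λ hT hε hΛ hL h => ?_⟩
  set E : ℝ → ℝ := fun x => cdf P x - cdf Q x with hE
  have hmE : Measurable E := (monotone_cdf P).measurable.sub (monotone_cdf Q).measurable
  have hE1 : ∀ x, |E x| ≤ 1 := fun x => abs_le.2
    ⟨by linarith [cdf_nonneg P x, cdf_le_one Q x], by linarith [cdf_nonneg Q x, cdf_le_one P x]⟩
  have hbdd : BddAbove (Set.range fun x => |E x|) := ⟨1, by rintro _ ⟨x, rfl⟩; exact hE1 x⟩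
  set Δ := ⨆ x, |E x| with hΔ
  have hEΔ : ∀ x, |E x| ≤ Δ := fun x => le_ciSup hbdd x
  have hΔ0 : 0 ≤ Δ := (abs_nonneg _).trans (hEΔ 0)
  have hJ : ∀ x, |∫ v, E (x + v / T) ∂fejerMeasure| ≤ 2 * ε := by
    intro x
    have hi : ∀ ρ : Measure ℝ, Integrable (fun v => cdf ρ (x + v / T)) fejerMeasure := fun ρ =>
      Integrable.of_bound (((monotone_cdf ρ).measurable.comp
        (by fun_prop : Measurable fun v : ℝ => x + v / T)).aestronglyMeasurable) 1
        (Filter.Eventually.of_forall fun v => by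
          rw [Real.norm_of_nonneg (cdf_nonneg _ _)]; exact cdf_le_one _ _)
    rw [hE, integral_sub (hi P) (hi Q)]
    exact abs_integral_cdf_fejer_sub_le hP hQ hT hε h x
  -- The centre is shifted by ±a/T so that every point of the window lies on the side of x where
  -- monotonicity of P's distribution function preserves the discrepancy; the Lipschitz function
  -- loses at most 2aΛ/T.
  have key : ∀ x, |E x| * A ≤ 2 * ε + 2 * a * (Λ / T) * A + Δ * B := by
    intro x
    have hav : ∀ v ∈ Set.Icc (-a) a, 0 ≤ (a + v) / T ∧ 0 ≤ (a - v) / T ∧ Λ * ((a + v) / T) ≤ 2 * a * (Λ / T) ∧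
        Λ * ((a - v) / T) ≤ 2 * a * (Λ / T) := by
      intro v hv
      have h1 := hv.1; have h2 := hv.2
      refine ⟨div_nonneg (by linarith) hT.le, div_nonneg (by linarith) hT.le, ?_, ?_⟩
      · rw [show 2 * a * (Λ / T) = Λ * ((2 * a) / T) by ring]; gcongr; linarith
      · rw [show 2 * a * (Λ / T) = Λ * ((2 * a) / T) by ring]; gcongr; linarith
    rcases le_total 0 (E x) with h0 | h0
    · rw [abs_of_nonneg h0]
      have := le_integral_fejer (a := a) (c := E x - 2 * a * (Λ / T)) (Δ := Δ)
        (E := fun v => E (x + a / T + v / T)) (by fun_prop) (fun v => hEΔ _) (fun v hv => by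
          obtain ⟨h1, -, h3, -⟩ := hav v hv
          have hle : x ≤ x + a / T + v / T := by rw [add_assoc, ← add_div]; linarith
          have hP' := monotone_cdf P hle
          have hQ' := hL _ _ hle
          rw [show x + a / T + v / T - x = (a + v) / T by ring] at hQ'
          simp only [hE]
          linarith)
      have hJ' := (abs_le.1 (hJ (x + a / T))).2
      rw [← hAdef, ← hBdef] at this
      linarith
    · rw [abs_of_nonpos h0]
      have := le_integral_fejer (a := a) (c := -E x - 2 * a * (Λ / T)) (Δ := Δ)
        (E := fun v => -E (x - a / T + v / T)) (by fun_prop) (fun v => by rw [abs_neg]; exact hEΔ _)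
        (fun v hv => by
          obtain ⟨-, h2, -, h4⟩ := hav v hv
          have hle : x - a / T + v / T ≤ x := by
            rw [show x - a / T + v / T = x - (a - v) / T by ring]; linarith
          have hP' := monotone_cdf P hle
          have hQ' := hL _ _ hle
          rw [show x - (x - a / T + v / T) = (a - v) / T by ring] at hQ'
          simp only [hE]
          linarith)
      have hJ' := (abs_le.1 (hJ (x - a / T))).1
      rw [← hAdef, ← hBdef, integral_neg] at this
      linarith
  -- Taking the supremum bounds Δ by itself; since B ≤ A/3 two thirds of ΔA remain on the left.
  have hfin : Δ * A ≤ 2 * ε + 2 * a * (Λ / T) * A + Δ * B := by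
    rw [← le_div_iff₀ hA]
    exact ciSup_le fun x => by rw [le_div_iff₀ hA]; exact key x
  intro x
  refine (hEΔ x).trans ?_
  have h1 : Δ * B ≤ Δ * (A / 3) := by gcongr
  have h2 : Δ * A ≤ (3 / A * ε + 3 * a * (Λ / T)) * A := by
    have : (3 / A * ε + 3 * a * (Λ / T)) * A = 3 * ε + 3 * a * (Λ / T) * A := by field_simp
    rw [this]; linarith
  exact le_of_mul_le_mul_right h2 hA

/-- The distribution function of a centred normal law is Lipschitz. -/
lemma cdf_gaussianReal_sub_le {v : ℝ≥0} (hv : v ≠ 0) {x y : ℝ} (hxy : x ≤ y) :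
    cdf (gaussianReal 0 v) y - cdf (gaussianReal 0 v) x ≤ (√v)⁻¹ * (y - x) := by
  have hv0 : (0 : ℝ) < v := by positivity
  have hpdf : ∀ z, gaussianPDFReal 0 v z ≤ (√v)⁻¹ := by
    intro z
    rw [gaussianPDFReal]
    have h1 : Real.exp (-(z - 0) ^ 2 / (2 * v)) ≤ 1 :=
      Real.exp_le_one_iff.2 (div_nonpos_of_nonpos_of_nonneg (by simp; positivity) (by positivity))
    have h2 : (√(2 * Real.pi * v))⁻¹ ≤ (√v)⁻¹ := by
      gcongr
      nlinarith [Real.pi_gt_three]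
    calc _ ≤ (√v)⁻¹ * 1 := by gcongr
      _ = _ := mul_one _
  rw [cdf_eq_real, cdf_eq_real, ← measureReal_sdiff (Set.Iic_subset_Iic.2 hxy) measurableSet_Iic,
    Measure.real, gaussianReal_apply_eq_integral _ hv, ENNReal.toReal_ofReal
      (integral_nonneg fun z => gaussianPDFReal_nonneg _ _ _)]
  have : Set.Iic y \ Set.Iic x = Set.Ioc x y := by ext z; simp [and_comm]
  rw [this]
  calc ∫ z in Set.Ioc x y, gaussianPDFReal 0 v z ≤ ∫ _z in Set.Ioc x y, (√v)⁻¹ :=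
        integral_mono (integrable_gaussianPDFReal 0 v).integrableOn (integrable_const _) hpdf
    _ = _ := by
        rw [setIntegral_const, Measure.real, Real.volume_Ioc, ENNReal.toReal_ofReal (by linarith),
          smul_eq_mul, mul_comm]

end WeakDep

set_option linter.unusedSectionVars false

/-! ### From i.i.d. innovations to a weakly dependent array -/

namespace MDependent

open WeakDep

section Construction

variable {Ω : Type u} {E : Type v} [MeasurableSpace Ω] [MeasurableSpace E] {μ : Measure Ω}
  {ε ε' : ℤ → Ω → E}

lemma measurable_family {Ω' ι β : Type*} {m' : MeasurableSpace Ω'} [MeasurableSpace β]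
    {x : ι → Ω' → β} (hx : ∀ i, Measurable[m'] (x i)) : Measurable[m'] fun ω i => x i ω :=
  measurable_pi_iff.2 hx

lemma IsIIDWithCopy.measurable_elim (h : IsIIDWithCopy μ ε ε') (j : ℤ ⊕ ℤ) :
    Measurable (Sum.elim ε ε' j) := by
  cases j
  · exact h.measurable _
  · exact h.measurable_copy _

/-- Any two families of distinct innovations with the same index set have the same law. -/
lemma IsIIDWithCopy.identDistrib_family (h : IsIIDWithCopy μ ε ε') {ι : Type*} {g g' : ι → ℤ ⊕ ℤ}
    (hg : g.Injective) (hg' : g'.Injective) :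
    IdentDistrib (fun ω i => Sum.elim ε ε' (g i) ω) (fun ω i => Sum.elim ε ε' (g' i) ω) μ μ where
  aemeasurable_fst := (measurable_pi_iff.2 fun i => h.measurable_elim _).aemeasurable
  aemeasurable_snd := (measurable_pi_iff.2 fun i => h.measurable_elim _).aemeasurable
  map_eq := by
    rw [(h.indep.precomp hg).map_fun_eq_infinitePi_map fun i => h.measurable_elim _,
      (h.indep.precomp hg').map_fun_eq_infinitePi_map fun i => h.measurable_elim _]
    have hl : ∀ j, μ.map (Sum.elim ε ε' j) = μ.map (ε 0) := by
      intro j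
      cases j
      · exact (h.identDistrib _).map_eq
      · exact (h.identDistrib_copy _).map_eq
    simp only [hl]

/-- The σ-algebra generated by the innovations with index in `S`. -/
abbrev noiseSigma (ε ε' : ℤ → Ω → E) (S : Set (ℤ ⊕ ℤ)) : MeasurableSpace Ω :=
  ⨆ j ∈ S, MeasurableSpace.comap (Sum.elim ε ε' j) inferInstance

lemma measurable_noiseSigma {S : Set (ℤ ⊕ ℤ)} {j : ℤ ⊕ ℤ} (hj : j ∈ S) :
    Measurable[noiseSigma ε ε' S] (Sum.elim ε ε' j) :=
  (comap_measurable _).mono (le_iSup₂_of_le (f := fun j (_ : j ∈ S) =>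
    MeasurableSpace.comap (Sum.elim ε ε' j) inferInstance) j hj le_rfl) le_rfl

lemma noiseSigma_mono {S T : Set (ℤ ⊕ ℤ)} (hST : S ⊆ T) : noiseSigma ε ε' S ≤ noiseSigma ε ε' T :=
  biSup_mono hST

lemma IsIIDWithCopy.noiseSigma_le (h : IsIIDWithCopy μ ε ε') (S : Set (ℤ ⊕ ℤ)) :
    noiseSigma ε ε' S ≤ ‹MeasurableSpace Ω› :=
  iSup₂_le fun j _ => (h.measurable_elim j).comap_le

lemma IsIIDWithCopy.indep_noiseSigma (h : IsIIDWithCopy μ ε ε') {S T : Set (ℤ ⊕ ℤ)}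
    (hST : Disjoint S T) : Indep (noiseSigma ε ε' S) (noiseSigma ε ε' T) μ :=
  indep_iSup_of_disjoint (fun j => (h.measurable_elim j).comap_le) h.indep hST

variable {m : ℕ} {f : (Fin m → E) → ℝ}

lemma IsIIDWithCopy.identDistrib_shift (h : IsIIDWithCopy μ ε ε') {β : Type*} [MeasurableSpace β]
    {G : (ℤ → E) → β} (hG : Measurable G) (a b : ℤ) :
    IdentDistrib (fun ω => G fun j => ε (a + j) ω) (fun ω => G fun j => ε (b + j) ω) μ μ :=
  (h.identDistrib_family (g := fun j : ℤ => Sum.inl (a + j)) (g' := fun j : ℤ => Sum.inl (b + j))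
    (fun i j hij => by simpa using hij) (fun i j hij => by simpa using hij)).comp hG

/-- The process is a fixed functional on the sequence space, evaluated at the shifted innovations;
stationarity then reduces to the equality in law of shifted sequences. -/
lemma proc_eq (f : (Fin m → E) → ℝ) (ε : ℤ → Ω → E) (a k : ℤ) (ω : Ω) :
    proc f ε (a + k) ω = proc f (fun j (y : ℤ → E) => y j) k fun j => ε (a + j) ω := by
  unfold proc
  congr 1; ext i
  congr 1; ring

lemma measurable_proc (hf : Measurable f) (hε : ∀ k, Measurable (ε k)) (k : ℤ) :
    Measurable (proc f ε k) := hf.comp (measurable_pi_iff.2 fun _ => hε _)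

lemma measurable_proc_eval (hf : Measurable f) (k : ℤ) :
    Measurable (proc f (fun j (y : ℤ → E) => y j) k) :=
  measurable_proc hf (fun k => measurable_pi_apply k) k

/-- The law of `m` consecutive innovations. -/
noncomputable def windowLaw (μ : Measure Ω) (ε : ℤ → Ω → E) (m : ℕ) : Measure (Fin m → E) :=
  μ.map fun ω i => ε (0 - (i : ℕ)) ω

lemma IsIIDWithCopy.map_window (h : IsIIDWithCopy μ ε ε') {g : Fin m → ℤ ⊕ ℤ} (hg : g.Injective) :
    μ.map (fun ω i => Sum.elim ε ε' (g i) ω) = windowLaw μ ε m :=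
  (h.identDistrib_family hg (g' := fun i : Fin m => Sum.inl (0 - (i : ℕ) : ℤ))
    (fun i j hij => by simpa [Fin.ext_iff] using hij)).map_eq

lemma IsIIDWithCopy.isProbabilityMeasure_windowLaw [IsProbabilityMeasure μ]
    (h : IsIIDWithCopy μ ε ε') : IsProbabilityMeasure (windowLaw μ ε m) :=
  Measure.isProbabilityMeasure_map (measurable_pi_iff.2 fun _ => h.measurable _).aemeasurable

/-- The variable obtained from `proc f ε k` by integrating out all innovations except the last
`l`. -/
noncomputable def truncProc (μ : Measure Ω) (f : (Fin m → E) → ℝ) (ε : ℤ → Ω → E) (l : ℕ) (k : ℤ)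
    (ω : Ω) : ℝ :=
  ∫ y, f (fun i => if (i : ℕ) < l then ε (k - (i : ℕ)) ω else y i) ∂windowLaw μ ε m

/-- The σ-algebra on Ω' is left free so that it can be the one generated by the last l innovations;
only the retained coordinates need be measurable for it. -/
lemma measurable_integral_mask {Ω' : Type*} [MeasurableSpace Ω'] (hf : Measurable f)
    (π : Measure (Fin m → E)) [SFinite π] (l : ℕ) {x : Fin m → Ω' → E}
    (hx : ∀ i : Fin m, (i : ℕ) < l → Measurable (x i)) :
    Measurable fun ω => ∫ y, f (fun i => if (i : ℕ) < l then x i ω else y i) ∂π := by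
  refine (StronglyMeasurable.integral_prod_right (f := fun ω (y : Fin m → E) =>
    f (fun i => if (i : ℕ) < l then x i ω else y i)) ?_).measurable
  refine Measurable.stronglyMeasurable (hf.comp (measurable_pi_iff.2 fun i => ?_))
  by_cases hi : (i : ℕ) < l
  · simp only [if_pos hi]
    exact (hx i hi).comp measurable_fst
  · simp only [if_neg hi]
    exact (measurable_pi_apply i).comp measurable_snd

lemma IsIIDWithCopy.measurable_truncProc [IsProbabilityMeasure μ] (h : IsIIDWithCopy μ ε ε')
    (hf : Measurable f) (l : ℕ) (k : ℤ) :
    Measurable[noiseSigma ε ε' (Sum.inl '' Set.Ioc (k - l) k)] (truncProc μ f ε l k) := by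
  have := h.isProbabilityMeasure_windowLaw (m := m)
  refine @measurable_integral_mask E _ m f Ω (noiseSigma ε ε' (Sum.inl '' Set.Ioc (k - l) k)) hf
    (windowLaw μ ε m) _ l _ fun i hi => ?_
  exact measurable_noiseSigma (j := Sum.inl (k - (i : ℕ))) ⟨_, ⟨by omega, by omega⟩, rfl⟩

lemma measurable_proc_noiseSigma (hf : Measurable f) (k : ℤ) :
    Measurable[noiseSigma ε ε' (Sum.inl '' Set.Ioc (k - m) k)] (proc f ε k) := by
  refine hf.comp (measurable_family fun i => ?_)
  have := i.2
  exact measurable_noiseSigma (j := Sum.inl (k - (i : ℕ))) ⟨_, ⟨by omega, by omega⟩, rfl⟩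

/-- At time l the innovations with index at most 0 are those at lag i ≥ l, so the star replaces
precisely what a truncation to the last l innovations discards. -/
lemma procStar_eq (f : (Fin m → E) → ℝ) (ε ε' : ℤ → Ω → E) (l : ℕ) (ω : Ω) :
    procStar f ε ε' l ω =
      f (fun i => if (i : ℕ) < l then ε ((l : ℤ) - (i : ℕ)) ω else ε' ((l : ℤ) - (i : ℕ)) ω) := by
  unfold procStar proc
  congr 1; ext i
  unfold starNoise
  by_cases hi : (i : ℕ) < l
  · rw [if_neg (by omega), if_pos hi]
  · rw [if_pos (by omega), if_neg hi]

lemma IsIIDWithCopy.identDistrib_procStar (h : IsIIDWithCopy μ ε ε') (hf : Measurable f) (l : ℕ) :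
    IdentDistrib (procStar f ε ε' l) (proc f ε l) μ μ := by
  have := (h.identDistrib_family (ι := Fin m)
    (g := fun i => if (i : ℕ) < l then Sum.inl ((l : ℤ) - (i : ℕ)) else Sum.inr ((l : ℤ) - (i : ℕ)))
    (g' := fun i => Sum.inl ((l : ℤ) - (i : ℕ)))
    (fun i j hij => by
      by_cases hi : (i : ℕ) < l <;> by_cases hj : (j : ℕ) < l <;> simp [hi, hj] at hij <;> omega)
    (fun i j hij => by simpa [Fin.ext_iff] using hij)).comp hf
  convert! this using 1
  ext ω
  rw [procStar_eq]
  simp only [Function.comp]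
  congr 1; ext i
  by_cases hi : (i : ℕ) < l <;> simp [hi]

/-- The joint law of two disjoint windows. -/
lemma IsIIDWithCopy.map_pair [IsProbabilityMeasure μ] (h : IsIIDWithCopy μ ε ε') (k : ℤ) :
    μ.map (fun ω => ((fun i : Fin m => ε (k - (i : ℕ)) ω), fun i : Fin m => ε' (k - (i : ℕ)) ω)) =
      (windowLaw μ ε m).prod (windowLaw μ ε m) := by
  have m1 : Measurable[noiseSigma ε ε' (Set.range Sum.inl)] fun ω (i : Fin m) => ε (k - (i : ℕ)) ω :=
    measurable_family fun i => measurable_noiseSigma (j := Sum.inl (k - (i : ℕ))) ⟨_, rfl⟩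
  have m2 : Measurable[noiseSigma ε ε' (Set.range Sum.inr)] fun ω (i : Fin m) => ε' (k - (i : ℕ)) ω :=
    measurable_family fun i => measurable_noiseSigma (j := Sum.inr (k - (i : ℕ))) ⟨_, rfl⟩
  have hi : IndepFun (fun ω (i : Fin m) => ε (k - (i : ℕ)) ω)
      (fun ω (i : Fin m) => ε' (k - (i : ℕ)) ω) μ := by
    rw [IndepFun_iff_Indep]
    refine indep_of_indep_of_le_left (indep_of_indep_of_le_right
      (h.indep_noiseSigma Set.isCompl_range_inl_range_inr.disjoint) m2.comap_le) m1.comap_le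
  have M1 := (m1.mono (h.noiseSigma_le _) le_rfl).aemeasurable (μ := μ)
  have M2 := (m2.mono (h.noiseSigma_le _) le_rfl).aemeasurable (μ := μ)
  rw [(indepFun_iff_map_prod_eq_prod_map_map M1 M2).1 hi]
  congr 1
  · exact h.map_window (g := fun i : Fin m => Sum.inl (k - (i : ℕ)))
      (fun i j hij => by simpa [Fin.ext_iff] using hij)
  · exact h.map_window (g := fun i : Fin m => Sum.inr (k - (i : ℕ)))
      (fun i j hij => by simpa [Fin.ext_iff] using hij)

end Construction
end MDependent

set_option linter.unusedSectionVars false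

namespace WeakDep

/-- Jensen's inequality on each fibre: for a probability measure the L¹ norm is at most the L^p
norm. -/
lemma eLpNorm_integral_prod_le {α β : Type*} [MeasurableSpace α] [MeasurableSpace β]
    (π₁ : Measure α) (π₂ : Measure β) [SFinite π₁] [IsProbabilityMeasure π₂] {φ : α × β → ℝ}
    (hφ : Measurable φ) {p : ℝ} (hp : 1 ≤ p) :
    eLpNorm (fun x => ∫ y, φ (x, y) ∂π₂) (ENNReal.ofReal p) π₁ ≤
      eLpNorm φ (ENNReal.ofReal p) (π₁.prod π₂) := by
  have hp0 : ENNReal.ofReal p ≠ 0 := by simpa using (by linarith : 0 < p)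
  have hpp : 0 < p := by linarith
  rw [eLpNorm_eq_lintegral_rpow_enorm_toReal hp0 ENNReal.ofReal_ne_top,
    eLpNorm_eq_lintegral_rpow_enorm_toReal hp0 ENNReal.ofReal_ne_top,
    ENNReal.toReal_ofReal hpp.le, lintegral_prod _ (by fun_prop)]
  gcongr with x
  have h1 : ‖∫ y, φ (x, y) ∂π₂‖ₑ ≤ eLpNorm (fun y => φ (x, y)) (ENNReal.ofReal p) π₂ :=
    calc _ ≤ ∫⁻ y, ‖φ (x, y)‖ₑ ∂π₂ := enorm_integral_le_lintegral_enorm _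
      _ = eLpNorm (fun y => φ (x, y)) 1 π₂ := eLpNorm_one_eq_lintegral_enorm.symm
      _ ≤ _ := eLpNorm_le_eLpNorm_of_exponent_le (by simpa using hp)
        (Measurable.aestronglyMeasurable (by fun_prop))
  calc _ ≤ (eLpNorm (fun y => φ (x, y)) (ENNReal.ofReal p) π₂) ^ p := by gcongr
    _ = _ := by
      rw [eLpNorm_eq_lintegral_rpow_enorm_toReal hp0 ENNReal.ofReal_ne_top,
        ENNReal.toReal_ofReal hpp.le, ← ENNReal.rpow_mul, one_div, inv_mul_cancel₀ hpp.ne',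
        ENNReal.rpow_one]

end WeakDep

namespace MDependent

open WeakDep

variable {Ω : Type u} {E : Type v} [MeasurableSpace Ω] [MeasurableSpace E] {μ : Measure Ω}
  {ε ε' : ℤ → Ω → E} {m : ℕ} {f : (Fin m → E) → ℝ}

/-- The first `l` coordinates of `x` followed by the remaining ones of `y`. -/
def mask (l : ℕ) (z : (Fin m → E) × (Fin m → E)) (i : Fin m) : E :=
  if (i : ℕ) < l then z.1 i else z.2 i

lemma measurable_mask (l : ℕ) : Measurable (mask l : (Fin m → E) × (Fin m → E) → Fin m → E) := by
  refine measurable_pi_iff.2 fun i => ?_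
  unfold mask
  split_ifs <;> fun_prop

lemma IsIIDWithCopy.measurable_pair (h : IsIIDWithCopy μ ε ε') (k : ℤ) :
    Measurable fun ω => ((fun i : Fin m => ε (k - (i : ℕ)) ω), fun i : Fin m => ε' (k - (i : ℕ)) ω) :=
  (measurable_family fun _ => h.measurable _).prodMk (measurable_family fun _ => h.measurable_copy _)

lemma IsIIDWithCopy.map_window_left (h : IsIIDWithCopy μ ε ε') (k : ℤ) :
    μ.map (fun ω (i : Fin m) => ε (k - (i : ℕ)) ω) = windowLaw μ ε m :=
  h.map_window (g := fun i : Fin m => Sum.inl (k - (i : ℕ)))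
    (fun i j hij => by simpa [Fin.ext_iff] using hij)

lemma IsIIDWithCopy.integral_window (h : IsIIDWithCopy μ ε ε') {Θ : (Fin m → E) → ℝ}
    (hΘ : Measurable Θ) (k : ℤ) :
    ∫ ω, Θ (fun i => ε (k - (i : ℕ)) ω) ∂μ = ∫ x, Θ x ∂windowLaw μ ε m := by
  rw [← h.map_window_left k, integral_map (measurable_family fun _ => h.measurable _).aemeasurable
    hΘ.aestronglyMeasurable]

lemma IsIIDWithCopy.eLpNorm_window (h : IsIIDWithCopy μ ε ε') {Θ : (Fin m → E) → ℝ}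
    (hΘ : Measurable Θ) (p : ℝ≥0∞) (k : ℤ) :
    eLpNorm (fun ω => Θ (fun i => ε (k - (i : ℕ)) ω)) p μ = eLpNorm Θ p (windowLaw μ ε m) := by
  rw [← h.map_window_left k, eLpNorm_map_measure hΘ.aestronglyMeasurable
    (measurable_family fun _ => h.measurable _).aemeasurable]
  rfl

lemma IsIIDWithCopy.measurable_procStar (h : IsIIDWithCopy μ ε ε') (hf : Measurable f) (k : ℤ) :
    Measurable (procStar f ε ε' k) :=
  measurable_proc hf (fun j => by
    unfold starNoise; split_ifs
    · exact h.measurable_copy _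
    · exact h.measurable _) k

lemma IsIIDWithCopy.integrable_mask [IsProbabilityMeasure μ] (h : IsIIDWithCopy μ ε ε')
    (hf : Measurable f) {l : ℕ} (hi : Integrable (proc f ε l) μ) :
    Integrable (fun z => f (mask l z)) ((windowLaw μ ε m).prod (windowLaw μ ε m)) := by
  have mfm : Measurable fun z => f (mask (m := m) (E := E) l z) := hf.comp (measurable_mask l)
  rw [← h.map_pair (l : ℤ), integrable_map_measure mfm.aestronglyMeasurable
    (h.measurable_pair _).aemeasurable]
  have := (h.identDistrib_procStar hf l).integrable_iff.2 hi
  convert! this using 1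
  ext ω
  rw [procStar_eq]; rfl

lemma IsIIDWithCopy.integral_mask [IsProbabilityMeasure μ] (h : IsIIDWithCopy μ ε ε')
    (hf : Measurable f) (l : ℕ) :
    ∫ z, f (mask l z) ∂(windowLaw μ ε m).prod (windowLaw μ ε m) = ∫ ω, proc f ε l ω ∂μ := by
  have mfm : Measurable fun z => f (mask (m := m) (E := E) l z) := hf.comp (measurable_mask l)
  rw [← h.map_pair (l : ℤ), integral_map (h.measurable_pair _).aemeasurable
    mfm.aestronglyMeasurable, ← (h.identDistrib_procStar hf l).integral_eq]
  congr 1; ext ω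
  rw [procStar_eq]; rfl

lemma IsIIDWithCopy.integral_truncProc [IsProbabilityMeasure μ] (h : IsIIDWithCopy μ ε ε')
    (hf : Measurable f) (hi : ∀ k, Integrable (proc f ε k) μ) (l : ℕ) (k : ℤ) :
    ∫ ω, truncProc μ f ε l k ω ∂μ = ∫ ω, proc f ε l ω ∂μ := by
  have := h.isProbabilityMeasure_windowLaw (m := m)
  have mfm : Measurable fun z => f (mask (m := m) (E := E) l z) := hf.comp (measurable_mask l)
  rw [← h.integral_mask hf, integral_prod _ (h.integrable_mask hf (hi l))]
  exact h.integral_window (mfm.stronglyMeasurable.integral_prod_right').measurable k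

/-- X_l - X_l^* has the law of f(x) - f(mask l (x, y)) for two independent windows x, y. Averaging
over y turns it into the truncation error, and averaging does not increase the L^p norm.
Stationarity permits a different time k on the left. -/
lemma IsIIDWithCopy.eLpNorm_sub_truncProc_le [IsProbabilityMeasure μ] (h : IsIIDWithCopy μ ε ε')
    (hf : Measurable f) (hi : ∀ k, Integrable (proc f ε k) μ) {p : ℝ} (hp : 1 ≤ p) (l : ℕ) (k : ℤ) :
    eLpNorm (fun ω => proc f ε k ω - truncProc μ f ε l k ω) (ENNReal.ofReal p) μ ≤
      eLpNorm (fun ω => proc f ε l ω - procStar f ε ε' l ω) (ENNReal.ofReal p) μ := by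
  have := h.isProbabilityMeasure_windowLaw (m := m)
  set π := windowLaw μ ε m with hπ
  have mfm : Measurable fun z => f (mask (m := m) (E := E) l z) := hf.comp (measurable_mask l)
  have mφ : Measurable fun z : (Fin m → E) × (Fin m → E) => f z.1 - f (mask l z) :=
    (hf.comp measurable_fst).sub mfm
  have hR : eLpNorm (fun ω => proc f ε l ω - procStar f ε ε' l ω) (ENNReal.ofReal p) μ =
      eLpNorm (fun z : (Fin m → E) × (Fin m → E) => f z.1 - f (mask l z)) (ENNReal.ofReal p)
        (π.prod π) := by
    rw [hπ, ← h.map_pair (l : ℤ), eLpNorm_map_measure mφ.aestronglyMeasurable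
      (h.measurable_pair _).aemeasurable]
    congr 1; ext ω
    rw [procStar_eq]; rfl
  have mψ : Measurable fun x : Fin m → E => f x - ∫ y, f (mask l (x, y)) ∂π :=
    hf.sub (mfm.stronglyMeasurable.integral_prod_right').measurable
  have hL : eLpNorm (fun ω => proc f ε k ω - truncProc μ f ε l k ω) (ENNReal.ofReal p) μ =
      eLpNorm (fun x : Fin m → E => f x - ∫ y, f (mask l (x, y)) ∂π) (ENNReal.ofReal p) π :=
    h.eLpNorm_window mψ _ k
  rw [hL, hR]
  refine le_trans (le_of_eq (eLpNorm_congr_ae ?_)) (eLpNorm_integral_prod_le π π mφ hp)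
  filter_upwards [(h.integrable_mask hf (hi l)).prod_right_ae] with x hx
  rw [integral_sub (integrable_const _) hx]
  simp only [integral_const, probReal_univ, one_smul]
  rfl

lemma blockSum_proc_eq (f : (Fin m → E) → ℝ) (ε : ℤ → Ω → E) (a : ℤ) (L : ℕ) (ω : Ω) :
    blockSum (proc f ε) a L ω =
      blockSum (proc f fun j (y : ℤ → E) => y j) 0 L fun j => ε (a + j) ω := by
  unfold blockSum
  refine Finset.sum_congr rfl fun j _ => ?_
  rw [add_assoc, proc_eq]
  congr 1

lemma IsIIDWithCopy.identDistrib_blockSum (h : IsIIDWithCopy μ ε ε') (hf : Measurable f) (a : ℤ)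
    (L : ℕ) : IdentDistrib (blockSum (proc f ε) a L) (blockSum (proc f ε) 0 L) μ μ := by
  have hG : Measurable (blockSum (proc f fun j (y : ℤ → E) => y j) 0 L) := by
    unfold blockSum
    exact Finset.measurable_fun_sum _ fun j _ => measurable_proc_eval hf _
  have := h.identDistrib_shift hG a 0
  simp only [← blockSum_proc_eq] at this
  exact this

lemma IsIIDWithCopy.integral_mul_shift (h : IsIIDWithCopy μ ε ε') (hf : Measurable f) (k d : ℤ) :
    ∫ ω, proc f ε k ω * proc f ε (k + d) ω ∂μ = ∫ ω, proc f ε 0 ω * proc f ε d ω ∂μ := by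
  have hG : Measurable fun y : ℤ → E => proc f (fun j (y : ℤ → E) => y j) 0 y *
      proc f (fun j (y : ℤ → E) => y j) d y := (measurable_proc_eval hf _).mul (measurable_proc_eval hf _)
  have := (h.identDistrib_shift hG k 0).integral_eq
  simp only [← proc_eq, add_zero, zero_add] at this
  exact this

lemma IsIIDWithCopy.indepFun_proc [IsProbabilityMeasure μ] (h : IsIIDWithCopy μ ε ε')
    (hf : Measurable f) {k : ℤ} (hk : (m : ℤ) ≤ k) : IndepFun (proc f ε 0) (proc f ε k) μ := by
  rw [IndepFun_iff_Indep]
  refine indep_of_indep_of_le_left (indep_of_indep_of_le_right (h.indep_noiseSigma ?_)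
    (measurable_proc_noiseSigma hf k).comap_le) (measurable_proc_noiseSigma hf 0).comap_le
  rw [Set.disjoint_image_iff Sum.inl_injective, Set.disjoint_left]
  intro x hx hy
  simp at hx hy
  omega

/-- For `l ≥ m` the partial sums of the autocovariances equal the long run variance. -/
lemma IsIIDWithCopy.covSum_eq [IsProbabilityMeasure μ] (h : IsIIDWithCopy μ ε ε')
    (hf : Measurable f) (hz : ∀ k, ∫ ω, proc f ε k ω ∂μ = 0) {l : ℕ} (hl : m ≤ l) :
    WeakArray.covSum μ (proc f ε) l = longRunVariance μ f ε := by
  set γ : ℤ → ℝ := fun k => ∫ ω, proc f ε 0 ω * proc f ε k ω ∂μ with hγ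
  have hneg : ∀ d : ℤ, γ (-d) = γ d := by
    intro d
    rw [hγ]
    simp only
    rw [← h.integral_mul_shift hf (-d) d]
    simp [mul_comm]
  have hγ0 : ∀ k : ℤ, (m : ℤ) ≤ k → γ k = 0 := by
    intro k hk
    rw [hγ]
    simp only
    rw [(h.indepFun_proc hf hk).integral_fun_mul_eq_mul_integral
      (measurable_proc hf h.measurable _).aestronglyMeasurable
      (measurable_proc hf h.measurable _).aestronglyMeasurable, hz, zero_mul]
  have s1 : HasSum (fun n : ℕ => γ n) (∑ n ∈ Finset.range (l + 1), γ n) :=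
    hasSum_sum_of_ne_finset_zero fun n hn => hγ0 _ (by simp at hn; omega)
  have s2 : HasSum (fun n : ℕ => γ (-((n : ℤ) + 1))) (∑ n ∈ Finset.range l, γ (-((n : ℤ) + 1))) :=
    hasSum_sum_of_ne_finset_zero fun n hn => by
      rw [hneg]; exact hγ0 _ (by simp at hn; omega)
  have := (s1.of_nat_of_neg_add_one s2).tsum_eq
  rw [longRunVariance, this, WeakArray.covSum, Finset.sum_range_succ', add_comm (∑ n ∈ _, _) (γ _)]
  simp only [hneg]
  simp only [hγ]
  push_cast
  ring

variable {p a s : ℝ} {M D : ℝ≥0}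

lemma DependenceAssumption.mono [IsProbabilityMeasure μ] (hA : DependenceAssumption μ ε ε' p a s M D f)
    (h : IsIIDWithCopy μ ε ε') (hf : Measurable f) {q b : ℝ} (hq : q ≤ p) (hb : b ≤ a) :
    DependenceAssumption μ ε ε' q b s M D f where
  moment k := (eLpNorm_le_eLpNorm_of_exponent_le (ENNReal.ofReal_le_ofReal hq)
    (measurable_proc hf h.measurable k).aestronglyMeasurable).trans (hA.moment k)
  mean_zero := hA.mean_zero
  dependence := by
    refine le_trans (ENNReal.tsum_le_tsum fun k => ?_) hA.dependence
    gcongr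
    · linarith [(Nat.cast_nonneg k : (0 : ℝ) ≤ k)]
    · exact eLpNorm_le_eLpNorm_of_exponent_le (ENNReal.ofReal_le_ofReal hq)
        ((measurable_proc hf h.measurable _).sub (h.measurable_procStar hf _)).aestronglyMeasurable
  nondegenerate := hA.nondegenerate

/-- The size of the effect of replacing the innovations more than `l` steps back. -/
noncomputable def depCoeff (μ : Measure Ω) (p : ℝ) (f : (Fin m → E) → ℝ) (ε ε' : ℤ → Ω → E)
    (l : ℕ) : ℝ :=
  (eLpNorm (fun ω => proc f ε l ω - procStar f ε ε' l ω) (ENNReal.ofReal p) μ).toReal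

/-- The coefficients δ_l are the norms ‖X_l - X_l^*‖_p. The bounds M and D are raised to at least 1,
which simplifies the later constants. -/
theorem DependenceAssumption.weakArray [IsProbabilityMeasure μ]
    (hA : DependenceAssumption μ ε ε' p a s M D f)
    (h : IsIIDWithCopy μ ε ε') (hf : Measurable f) (hp : 2 < p) (hp3 : p ≤ 3) (ha : 0 < a) :
    WeakArray μ p a (max M 1) (max D 1) m (fun A => noiseSigma ε ε' (Sum.inl '' A)) (proc f ε)
      (truncProc μ f ε) (depCoeff μ p f ε ε') := by
  have hp1 : 1 ≤ p := by linarith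
  have mX := measurable_proc hf h.measurable
  have hmem : ∀ k, MemLp (proc f ε k) (ENNReal.ofReal p) μ := fun k =>
    ⟨(mX k).aestronglyMeasurable, (hA.moment k).trans_lt ENNReal.coe_lt_top⟩
  have hi : ∀ k, Integrable (proc f ε k) μ := fun k => (hmem k).integrable (by simpa using hp1)
  have hfin : ∀ l : ℕ, eLpNorm (fun ω => proc f ε l ω - procStar f ε ε' l ω) (ENNReal.ofReal p) μ ≠ ⊤ :=
    fun l => ((hmem l).sub ((h.identDistrib_procStar hf l).memLp_iff.2 (hmem l))).2.ne
  exact {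
    two_lt := hp
    le_three := hp3
    α_pos := ha
    one_le_M := le_max_right _ _
    one_le_D := le_max_right _ _
    le := fun A => h.noiseSigma_le _
    mono := fun A B hAB => noiseSigma_mono (Set.image_mono hAB)
    indep := fun A B hAB => h.indep_noiseSigma (by
      rwa [Set.disjoint_image_iff Sum.inl_injective])
    meas_X := measurable_proc_noiseSigma hf
    meas_Xt := h.measurable_truncProc hf
    mean := hA.mean_zero
    mean_t := fun l k => by rw [h.integral_truncProc hf hi, hA.mean_zero]
    moment := fun k => ⟨mX k, (hA.moment k).trans (by
      rw [← ENNReal.ofReal_coe_nnreal]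
      exact ENNReal.ofReal_le_ofReal (le_max_left _ _))⟩
    δ_nonneg := fun l => ENNReal.toReal_nonneg
    approx := fun l k _ => ⟨(mX k).sub ((h.measurable_truncProc hf l k).mono (h.noiseSigma_le _) le_rfl), by
      rw [depCoeff, ENNReal.ofReal_toReal (hfin l)]
      exact h.eLpNorm_sub_truncProc_le hf hi hp1 l k⟩
    sum_le := fun N => by
      refine le_trans ?_ (le_max_left (D : ℝ) 1)
      have h1 := (ENNReal.sum_le_tsum (Finset.range N)).trans hA.dependence
      rw [← ENNReal.ofReal_le_ofReal_iff (by positivity), ENNReal.ofReal_coe_nnreal,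
        ENNReal.ofReal_sum_of_nonneg fun i _ =>
          mul_nonneg (by positivity) (by unfold depCoeff; exact ENNReal.toReal_nonneg)]
      refine le_trans (Finset.sum_le_sum fun i _ => ?_) h1
      rw [ENNReal.ofReal_mul (by positivity), depCoeff, ENNReal.ofReal_toReal (hfin _)]
      push_cast
      exact le_rfl
    stationary := h.identDistrib_blockSum hf
    stationary_cov := fun k d => h.integral_mul_shift hf k d }

end MDependent

/-! ### Conclusion: from characteristic functions to distribution functions -/

namespace MDependent

open WeakDep

lemma partialSum_eq_blockSum {Ω : Type u} {E : Type v} {m : ℕ} (f : (Fin m → E) → ℝ)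
    (ε : ℤ → Ω → E) (n : ℕ) (ω : Ω) : partialSum f ε n ω = blockSum (proc f ε) 0 n ω := by
  unfold partialSum blockSum
  have e : Finset.Icc 1 n = Finset.Ico (0 + 1) (n + 1) := by ext k; simp
  rw [e, Finset.range_eq_Ico, ← Finset.sum_Ico_add' (fun k : ℕ => proc f ε (k : ℤ) ω) 0 n 1]
  refine Finset.sum_congr rfl fun j _ => ?_
  congr 1; push_cast; ring

lemma stdNormalCDF_div {v : ℝ} (hv : 0 < v) (x : ℝ) :
    stdNormalCDF (x / √v) = cdf (gaussianReal 0 v.toNNReal) x := by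
  have hs : 0 < √v := Real.sqrt_pos.2 hv
  have hm := gaussianReal_map_const_mul (μ := 0) (v := 1) (√v)
  rw [mul_zero, mul_one, show NNReal.mk (√v ^ 2) (sq_nonneg _) = v.toNNReal by
    ext; simp [Real.sq_sqrt hv.le, hv.le]] at hm
  rw [stdNormalCDF, cdf_eq_real, cdf_eq_real, ← hm,
    map_measureReal_apply (by fun_prop) measurableSet_Iic]
  congr 1
  ext y
  simp [le_div_iff₀ hs, mul_comm]

lemma abs_real_sub_stdNormalCDF_le_one {Ω : Type u} [MeasurableSpace Ω] (μ : Measure Ω)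
    [IsProbabilityMeasure μ] (A : Set Ω) (y : ℝ) : |μ.real A - stdNormalCDF y| ≤ 1 := by
  have h1 : μ.real A ≤ 1 := measureReal_le_one
  have h2 : 0 ≤ μ.real A := measureReal_nonneg
  have h3 := cdf_nonneg (gaussianReal 0 1) y
  have h4 := cdf_le_one (gaussianReal 0 1) y
  unfold stdNormalCDF
  exact abs_le.2 ⟨by linarith, by linarith⟩

lemma charFun_map_div_sqrt {Ω : Type u} [MeasurableSpace Ω] {μ : Measure Ω} {X : ℤ → Ω → ℝ} {n : ℕ}
    (hX : Measurable (blockSum X 0 n)) (t : ℝ) :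
    charFun (μ.map fun ω => blockSum X 0 n ω / √n) t = chf μ X n (t / √n) := by
  rw [charFun_apply_real, integral_map (by fun_prop)
    (Continuous.aestronglyMeasurable (by fun_prop)), chf]
  congr 1; ext ω
  unfold eI
  congr 2; push_cast; ring

lemma charFun_gaussianReal_eq {v : ℝ} (hv : 0 ≤ v) (n : ℕ) (t : ℝ) :
    charFun (gaussianReal 0 (v / n).toNNReal) t =
      (Real.exp (-(v * (t / √n) ^ 2 / 2)) : ℝ) := by
  rw [charFun_gaussianReal, Complex.ofReal_exp, Real.coe_toNNReal _ (by positivity), div_pow,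
    Real.sq_sqrt (Nat.cast_nonneg n)]
  congr 1
  push_cast
  ring

end MDependent

open WeakDep MDependent

theorem theorem5p1
    (p a s : ℝ) (M D : ℝ≥0) (𝔪 c K : ℝ)
    (hp : 2 < p) (ha : 0 < a) (hs : 0 < s)
    (h𝔪₀ : 0 < 𝔪) (h𝔪₁ : 𝔪 < 1) (hc : 0 < c) (hcK : c ≤ K) :
    ∃ C : ℝ, 0 < C ∧
      ∀ (Ω : Type u) [MeasurableSpace Ω] (μ : Measure Ω) [IsProbabilityMeasure μ]
        (E : Type v) [MeasurableSpace E] (ε ε' : ℤ → Ω → E),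
        MDependent.IsIIDWithCopy μ ε ε' →
        ∀ (n m : ℕ), 1 ≤ n → c * (n : ℝ) ^ 𝔪 ≤ (m : ℝ) → (m : ℝ) ≤ K * (n : ℝ) ^ 𝔪 →
        ∀ f : (Fin m → E) → ℝ, Measurable f →
          MDependent.DependenceAssumption μ ε ε' p a s M D f →
          ∀ x : ℝ,
            |μ.real {ω | MDependent.partialSum f ε n ω / Real.sqrt n ≤ x} -
                MDependent.stdNormalCDF (x / MDependent.sampleStd μ f ε n)| ≤
              C * (n : ℝ) ^ (-(min p 3) / 2 + 1) := by
  -- Both assumptions are monotone in the exponents, and the rate only involves `min p 3`.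
  set q := min p 3 with hq
  set α := min a (1 / 2) with hα
  have hq2 : 2 < q := lt_min hp (by norm_num)
  have hq3 : q ≤ 3 := min_le_right _ _
  have hα0 : 0 < α := lt_min ha (by norm_num)
  have hα2 : α ≤ 1 / 2 := min_le_right _ _
  obtain ⟨A, C, c₀, L₀, hC, hc₀, hc1, hL₀, H⟩ := exists_charData.{u} (M := max M 1) (D := max D 1)
    hq2 hα0 (le_max_right _ _) (le_max_right _ _) hs
  obtain ⟨B, κ, N, hB, hκ, HG⟩ := CharData.exists_norm_sub_gauss_le hq2 hq3 hα0 hα2 hC hc₀ hc1 L₀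
    h𝔪₁ K
  obtain ⟨C₁, C₂, hC₁, hC₂, HS⟩ := exists_smoothing
  -- The three terms come from the comparison of characteristic functions, from the Lipschitz term
  -- with T = κ√n, and from the trivial bound for n < N.
  refine ⟨C₁ * B + C₂ * ((√c₀)⁻¹ / κ) + (N + 1), by positivity, ?_⟩
  intro Ω _ μ _ E _ ε ε' h n m hn _ hm f hf hA x
  have hnR : (1 : ℝ) ≤ n := by exact_mod_cast hn
  have hn0 : (0 : ℝ) < n := by linarith
  have hsn : 0 < √(n : ℝ) := Real.sqrt_pos.2 hn0
  set w := (n : ℝ) ^ (-q / 2 + 1) with hw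
  have hw0 : 0 < w := by positivity
  have hws : (√(n : ℝ))⁻¹ ≤ w := by
    rw [Real.sqrt_eq_rpow, ← Real.rpow_neg hn0.le]
    exact Real.rpow_le_rpow_of_exponent_le hnR (by linarith)
  have hC0 : 0 ≤ C₁ * B + C₂ * ((√c₀)⁻¹ / κ) := by positivity
  -- Below N the difference is at most 1 and n^{1-q/2} ≥ n^{-1/2} ≥ 1/(N+1); a vanishing variance
  -- can only occur here, since v_n ≥ c₀n from N on.
  rcases lt_or_ge n N with hlt | hge
  · refine (abs_real_sub_stdNormalCDF_le_one μ _ _).trans ?_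
    have h1 : 1 ≤ (N + 1) * w := by
      have hNn : (n : ℝ) ≤ N := by exact_mod_cast hlt.le
      have hsN : √(n : ℝ) ≤ N + 1 := by
        have : √(n : ℝ) ≤ n := by
          rw [Real.sqrt_le_iff]; exact ⟨hn0.le, by nlinarith⟩
        linarith
      calc (1 : ℝ) = √n * (√n)⁻¹ := (mul_inv_cancel₀ hsn.ne').symm
        _ ≤ (N + 1) * w := by gcongr
    have := mul_nonneg hC0 hw0.le
    linarith
  have hA' := hA.mono h hf (q := q) (b := α) (min_le_left _ _) (min_le_left _ _)
  have hW := hA'.weakArray h hf hq2 hq3 hα0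
  have hcov : ∀ᶠ l in Filter.atTop, s ^ 2 ≤ WeakArray.covSum μ (proc f ε) l := by
    filter_upwards [Filter.eventually_ge_atTop m] with l hl
    rw [h.covSum_eq hf hA.mean_zero hl]
    exact hA.nondegenerate
  obtain ⟨hbd, hcd⟩ := H Ω μ m _ _ _ _ hW hcov
  obtain ⟨hLn, hG⟩ := HG m _ _ hcd n hge hm
  have hv := hcd.v_ge n hLn
  set V := var μ (proc f ε) n with hV
  have hV0 : 0 < V := lt_of_lt_of_le (by positivity) hv
  have hVn : c₀ ≤ V / n := by rwa [le_div_iff₀ hn0]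
  have hS := (hbd 0 n).1
  have hmS : Measurable fun ω => blockSum (proc f ε) 0 n ω / √n := by fun_prop
  have hstd : sampleStd μ f ε n = √(V / n) := by
    unfold sampleStd
    simp only [partialSum_eq_blockSum]
    rfl
  rw [hstd, stdNormalCDF_div (by positivity)]
  set P := μ.map fun ω => blockSum (proc f ε) 0 n ω / √n with hP
  have : IsProbabilityMeasure P := Measure.isProbabilityMeasure_map hmS.aemeasurable
  have hcdf : μ.real {ω | partialSum f ε n ω / Real.sqrt n ≤ x} = cdf P x := by
    rw [cdf_eq_real, hP, map_measureReal_apply hmS measurableSet_Iic]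
    simp only [partialSum_eq_blockSum]
    rfl
  rw [hcdf]
  have hPi : Integrable (fun y => y) P := by
    rw [hP, integrable_map_measure (by fun_prop) hmS.aemeasurable]
    exact ((hbd 0 n).integrable (by linarith)).div_const _
  have hQi : Integrable (fun y => y) (gaussianReal 0 (V / n).toNNReal) :=
    (memLp_id_gaussianReal 1).integrable (by simp)
  have hnn : (V / n).toNNReal ≠ 0 := by
    simp only [ne_eq, Real.toNNReal_eq_zero, not_le]; positivity
  have hmain := HS P (gaussianReal 0 (V / n).toNNReal) hPi hQi (κ * √n) (B * w) (√c₀)⁻¹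
    (by positivity) (by positivity) (by positivity)
    (fun y z hyz => (cdf_gaussianReal_sub_le hnn hyz).trans (by
      have : 0 ≤ z - y := by linarith
      rw [Real.coe_toNNReal _ (by positivity)]
      gcongr))
    (fun t ht htT => by
      rw [hP, charFun_map_div_sqrt hS, charFun_gaussianReal_eq hV0.le, mul_assoc]
      refine (hG t ht htT).trans (le_of_eq ?_)
      rw [hw, show -q / 2 + 1 = 1 - q / 2 by ring]) x
  refine hmain.trans ?_
  have e1 : C₂ * ((√c₀)⁻¹ / (κ * √n)) ≤ C₂ * ((√c₀)⁻¹ / κ) * w := by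
    calc C₂ * ((√c₀)⁻¹ / (κ * √n)) = C₂ * ((√c₀)⁻¹ / κ) * (√n)⁻¹ := by
          rw [← div_div, div_eq_mul_inv _ (√(n : ℝ))]; ring
      _ ≤ _ := by gcongr
  have e2 : 0 ≤ ((N : ℝ) + 1) * w := by positivity
  linarith
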